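/- Let $G$ be a connected semisimple Lie group with finite center, $K$ a maximal compact subgroup, $\theta$ the Cartan involution belonging to $K$, $\mathfrak g_0=\mathfrak k_0\oplus\mathfrak p_0$ the corresponding Cartan decomposition of the real Lie algebra of $G$, and $B$ the Killing form. Dropping the index $0$ denotes complexification. Assume that $X=G/K$ is Hermitian, i.e. that it carries a $G$-invariant complex structure; let $\mathfrak p=\mathfrak p_+\oplus\mathfrak p_-$ be the resulting decomposition of the complexified tangent space $\mathfrak p$ at $eK$ into its holomorphic and antiholomorphic parts. Let $H=AB_H$ be a $\theta$-stable Cartan subgroup of $G$ with connected split component $A$, where $B_H$ is compact and $\dim A=1$. Let $\mathfrak h_0=\mathfrak a_0\oplus\mathfrak b_0$ be its Lie algebra, with $\mathfrak a_0=\mathfrak h_0\cap\mathfrak p_0$ and $\mathfrak b_0=\mathfrak h_0\cap\mathfrak k_0$. Let $P=MAN$ be a parabolic subgroup with split component $A$ and $\theta$-stable Levi subgroup $MA$, the centralizer of $A$ in $G$. Put $K_M=K\cap M$ and let $\mathfrak p_M=\mathfrak m\cap\mathfrak p$, where $\mathfrak m$ is the complexified Lie algebra of $M$. The group $K_M$ acts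 on $\mathfrak g$ by the adjoint representation. Let $\alpha_r$ be the root of $(\mathfrak g,\mathfrak h)$ that is real (it annihilates $\mathfrak b$) and positive with respect to $P$ (it is unique). For $c\in\{\tfrac12,\tfrac32\}$ let $\mathfrak n_{c\alpha_r}$ be the sum of the root spaces $\mathfrak g_\beta$ over all roots $\beta$ of $(\mathfrak g,\mathfrak h)$ with $\beta|_{\mathfrak a}=c\,\alpha_r|_{\mathfrak a}$, and put $\mathfrak n^{\alpha_r}=\mathfrak n_{\frac12\alpha_r}\oplus\mathfrak n_{\frac32\alpha_r}$. Let $$\mathfrak p_{M_2}=\{X\in\mathfrak p_M : [X,\mathfrak g_{\alpha_r}]=0\},\qquad \mathfrak p_{M_2,-}=\mathfrak p_{M_2}\cap\mathfrak p_-,$$ and let $\mathfrak p_{M_1}$ be the orthocomplement of $\mathfrak p_{M_2}$ in $\mathfrak p_M$ with respect to $B$. Then $\mathfrak n^{\alpha_r}$, $\mathfrak p_-$, $\mathfrak p_{M_1}$ and $\mathfrak p_{M_2,-}$ are $K_M$-stable, and there is a $K_M$-stable subspace $\mathfrak n_-$ of $\mathfrak n^{\alpha_r}$ such that, as $K_M$-modules,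 $$\mathfrak n^{\alpha_r}\cong\mathfrak n_-\oplus\widetilde{\mathfrak n_-}\qquad\text{and}\qquad \mathfrak p_-\cong\mathbb C\oplus\mathfrak p_{M_1}\oplus\mathfrak p_{M_2,-}\oplus\mathfrak n_-,$$ where $\widetilde{\mathfrak n_-}$ is the contragredient of $\mathfrak n_-$ and $\mathbb C$ is the trivial module. -/

import Mathlib

open scoped Manifold ContDiff TensorProduct

noncomputable section

namespace HermitianLie

/-- A smooth Lie group has the finite order of smoothness at which Mathlib builds its
Lie algebra. -/
instance lieGroup_minSmoothness {n : ℕ} {G : Type*} [TopologicalSpace G]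
    [ChartedSpace (EuclideanSpace ℝ (Fin n)) G] [Group G] [LieGroup (𝓡 n) ∞ G] :
    LieGroup (𝓡 n) (minSmoothness ℝ 3) G :=
  LieGroup.of_le (n := ∞) (by rw [minSmoothness_of_isRCLikeNormedField]; exact WithTop.coe_le_coe.2 (le_top : (3 : ℕ∞) ≤ ⊤))

section Group

variable (n : ℕ) (G : Type*) [TopologicalSpace G] [ChartedSpace (EuclideanSpace ℝ (Fin n)) G]
  [Group G]

/-- The real Lie algebra `𝔤₀` of a Lie group `G` of dimension `n`. -/
abbrev RLie : Type := GroupLieAlgebra (𝓡 n) G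

/-- The complexified Lie algebra `𝔤 = ℂ ⊗ 𝔤₀`. -/
abbrev CLie : Type := ℂ ⊗[ℝ] RLie n G

variable {G}

/-- The differential at `1` of the conjugation `x ↦ g x g⁻¹`, as an endomorphism of `𝔤₀`
(note that `g 1 g⁻¹ = 1`). -/
def AdMap (g : G) : RLie n G →L[ℝ] RLie n G :=
  (mfderiv (𝓡 n) (𝓡 n) (fun x : G => g * x * g⁻¹) 1 :
    TangentSpace (𝓡 n) (1 : G) →L[ℝ] TangentSpace (𝓡 n) (g * 1 * g⁻¹))

lemma AdMap_one : AdMap n (1 : G) = ContinuousLinearMap.id ℝ _ := by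
  have h : (fun x : G => (1 : G) * x * (1 : G)⁻¹) = id := by ext x; simp
  unfold AdMap
  rw [h]
  exact mfderiv_id

variable [LieGroup (𝓡 n) ∞ G]

lemma mdifferentiable_conj (g : G) :
    MDifferentiable (𝓡 n) (𝓡 n) (fun x : G => g * x * g⁻¹) := by
  have h : ContMDiff (𝓡 n) (𝓡 n) ∞ (fun x : G => g * x * g⁻¹) :=
    (contMDiff_const.mul contMDiff_id).mul contMDiff_const
  exact h.mdifferentiable (by simp)

lemma AdMap_mul (g h : G) : AdMap n (g * h) = (AdMap n g).comp (AdMap n h) := by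
  have e : (fun x : G => (g * h) * x * (g * h)⁻¹)
      = (fun x : G => g * x * g⁻¹) ∘ (fun x : G => h * x * h⁻¹) := by
    ext x; simp [mul_assoc]
  have h1 : h * 1 * h⁻¹ = 1 := by simp
  have c := mfderiv_comp (I := 𝓡 n) (I' := 𝓡 n) (I'' := 𝓡 n) (1 : G)
    (mdifferentiable_conj n g (h * 1 * h⁻¹)) (mdifferentiable_conj n h 1)
  unfold AdMap
  rw [e]
  refine c.trans ?_
  rw [h1]
  rfl

variable (G)

/-- The adjoint representation of `G` on `𝔤₀`. -/
def Ad : Representation ℝ G (RLie n G) where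
  toFun g := (AdMap n g : RLie n G →ₗ[ℝ] RLie n G)
  map_one' := by rw [AdMap_one]; rfl
  map_mul' g h := by rw [AdMap_mul]; rfl

/-- The adjoint representation of `G` on `𝔤`. -/
def AdC : Representation ℂ G (CLie n G) where
  toFun g := (Ad n G g).baseChange ℂ
  map_one' := by rw [map_one]; exact LinearMap.baseChange_id
  map_mul' g h := by rw [map_mul]; exact LinearMap.baseChange_comp _ _

variable {G}

/-- The Lie algebra of a closed subgroup `K`: the velocities at `0` of the one-parameter subgroups
of `G` that stay in `K`. -/
def lieOf (K : Subgroup G) : Set (RLie n G) :=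
  {X | ∃ γ : Multiplicative ℝ →* G, (∀ t, γ t ∈ K) ∧
    HasMFDerivAt 𝓘(ℝ, ℝ) (𝓡 n) (fun t : ℝ => γ (Multiplicative.ofAdd t)) 0
      (ContinuousLinearMap.toSpanSingleton ℝ (X : EuclideanSpace ℝ (Fin n)))}

/-- `K` is a maximal compact subgroup of `G`. -/
def IsMaximalCompact {G : Type*} [TopologicalSpace G] [Group G] (K : Subgroup G) : Prop :=
  Maximal (fun L : Subgroup G => IsCompact (L : Set G)) K

variable (G) in
/-- The Killing form of `𝔤₀`. -/
abbrev kf : LinearMap.BilinForm ℝ (RLie n G) := killingForm ℝ (RLie n G)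

variable (θ : RLie n G ≃ₗ⁅ℝ⁆ RLie n G)

/-- `𝔨₀`, the fixed space of `θ`. -/
def kR : Submodule ℝ (RLie n G) :=
  Module.End.eigenspace (θ.toLinearEquiv : RLie n G →ₗ[ℝ] RLie n G) 1

/-- `𝔭₀`, the `(-1)`-eigenspace of `θ`. -/
def pR : Submodule ℝ (RLie n G) :=
  Module.End.eigenspace (θ.toLinearEquiv : RLie n G →ₗ[ℝ] RLie n G) (-1)

/-- `θ` is the Cartan involution of `𝔤₀` belonging to `K`: it is an involutive automorphism,
the form `-B(X, θ Y)` is positive definite for the Killing form `B`, and `𝔨₀ = Lie K`. -/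
structure IsCartanInvolution (K : Subgroup G) : Prop where
  involutive : ∀ X, θ (θ X) = X
  posDef : ∀ X, X ≠ 0 → 0 < -(kf n G X (θ X))
  lie_eq : (kR n θ : Set (RLie n G)) = lieOf n K

/-- A `G`-invariant complex structure on `X = G/K`, given on the tangent space `𝔭₀` at the base
point: a complex structure on the vector space `𝔭₀` that commutes with `Ad(K)`.
(On a symmetric space the almost complex structure so defined is always integrable, because its
Nijenhuis tensor is invariant under the geodesic symmetries.) -/
structure IsInvariantComplexStructure (K : Subgroup G) (J : pR n θ →ₗ[ℝ] pR n θ) : Prop where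
  sq : ∀ X, J (J X) = -X
  comm : ∀ k ∈ K, ∀ X Y : pR n θ, (Y : RLie n G) = Ad n G k X →
    (J Y : RLie n G) = Ad n G k (J X)

/-- `𝔭₋ ⊆ 𝔤`: the antiholomorphic part of the complexified tangent space of `G/K` at the base point,
that is, the `(-i)`-eigenspace of `J` on `𝔭 = ℂ ⊗ 𝔭₀`. -/
def pMinus (J : pR n θ →ₗ[ℝ] pR n θ) : Submodule ℂ (CLie n G) :=
  (Module.End.eigenspace (J.baseChange ℂ) (-Complex.I)).map ((pR n θ).subtype.baseChange ℂ)

/-! ### The Cartan subalgebra `𝔥₀ = 𝔞₀ ⊕ 𝔟₀`, its roots, and the Levi subgroup `MA` -/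

variable (𝔥 : LieSubalgebra ℝ (RLie n G))

/-- `𝔞₀ = 𝔥₀ ∩ 𝔭₀`, the Lie algebra of the connected split component `A` of the Cartan subgroup
`H = AB`, the centralizer of `𝔥₀` in `G`. -/
def aR : Submodule ℝ (RLie n G) := 𝔥.toSubmodule ⊓ pR n θ

/-- `𝔩₀`, the centralizer of `𝔞₀` in `𝔤₀`. -/
def leviR : Submodule ℝ (RLie n G) where
  carrier := {X | ∀ H ∈ aR n θ 𝔥, ⁅H, X⁆ = 0}
  add_mem' hX hY H hH := by rw [lie_add, hX H hH, hY H hH, add_zero]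
  zero_mem' H _ := lie_zero H
  smul_mem' c X hX H hH := by rw [lie_smul, hX H hH, smul_zero]

/-- `𝔪₀`, the orthocomplement of `𝔞₀` in `𝔩₀`. -/
def mR : Submodule ℝ (RLie n G) where
  carrier := {X | X ∈ leviR n θ 𝔥 ∧ ∀ H ∈ aR n θ 𝔥, kf n G X H = 0}
  add_mem' hX hY := ⟨add_mem hX.1 hY.1, fun H hH => by
    rw [map_add, LinearMap.add_apply, hX.2 H hH, hY.2 H hH, add_zero]⟩
  zero_mem' := ⟨zero_mem _, fun H _ => by rw [map_zero, LinearMap.zero_apply]⟩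
  smul_mem' c X hX := ⟨Submodule.smul_mem _ c hX.1, fun H hH => by
    rw [map_smul, LinearMap.smul_apply, hX.2 H hH, smul_zero]⟩

/-- The Levi subgroup `L = MA`, the centralizer of `𝔞₀` (equivalently, of `A`) in `G`. -/
def leviGroup : Subgroup G where
  carrier := {g | ∀ H ∈ aR n θ 𝔥, Ad n G g H = H}
  mul_mem' {g h} hg hh H hH := by
    rw [map_mul, Module.End.mul_apply, hh H hH, hg H hH]
  one_mem' H _ := by rw [map_one, Module.End.one_apply]
  inv_mem' {g} hg H hH := by
    conv_lhs => rw [← hg H hH]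
    rw [← Module.End.mul_apply, ← map_mul, inv_mul_cancel, map_one, Module.End.one_apply]

/-- The factor `M` of the Langlands decomposition `P = MAN`: the intersection of the kernels of
`|χ|` over all continuous characters `χ : L → ℝˣ` of the Levi subgroup `L = MA`. -/
def mGroup : Subgroup G :=
  Subgroup.map (leviGroup n θ 𝔥).subtype
    { carrier := {g | ∀ χ : leviGroup n θ 𝔥 →* ℝˣ, Continuous χ → |((χ g : ℝˣ) : ℝ)| = 1}
      mul_mem' := fun {g h} hg hh χ hχ => by
        rw [map_mul, Units.val_mul, abs_mul, hg χ hχ, hh χ hχ, one_mul]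
      one_mem' := fun χ _ => by simp
      inv_mem' := fun {g} hg χ hχ => by simp [abs_inv, hg χ hχ] }

/-- `K_M = K ∩ M`. -/
def kmGroup (K : Subgroup G) : Subgroup G := K ⊓ mGroup n θ 𝔥

/-- The adjoint representation of `K_M` on `𝔤`. -/
def kmRep (K : Subgroup G) : Representation ℂ (kmGroup n θ 𝔥 K) (CLie n G) :=
  (AdC n G).comp (kmGroup n θ 𝔥 K).subtype

variable {n 𝔥}

/-- The root space `𝔤_α = {X ∈ 𝔤 | [H, X] = α(H) X for all H ∈ 𝔥}`; as `𝔥 = ℂ ⊗ 𝔥₀`, a linear form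
on `𝔥` is the same as an `ℝ`-linear map `𝔥₀ → ℂ`, and it suffices to let `H` range over `𝔥₀`. -/
def rootSp (α : 𝔥 →ₗ[ℝ] ℂ) : Submodule ℂ (CLie n G) :=
  ⨅ H : 𝔥, Module.End.eigenspace
    (LieAlgebra.ad ℂ (CLie n G) ((1 : ℂ) ⊗ₜ[ℝ] (H : RLie n G))) (α H)

/-- `α ∈ Φ(𝔤, 𝔥)`. -/
def IsRoot (α : 𝔥 →ₗ[ℝ] ℂ) : Prop := α ≠ 0 ∧ rootSp α ≠ ⊥

/-- `α` is a real root: it annihilates `𝔟₀ = 𝔥₀ ∩ 𝔨₀`. -/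
def IsRealRoot (α : 𝔥 →ₗ[ℝ] ℂ) : Prop :=
  IsRoot α ∧ ∀ H : 𝔥, (H : RLie n G) ∈ kR n θ → α H = 0

/-- `𝔫_{cα}`: the sum of the root spaces `𝔤_β` over the roots `β` with `β|_𝔞 = c α|_𝔞`. -/
def nMult (α : 𝔥 →ₗ[ℝ] ℂ) (c : ℂ) : Submodule ℂ (CLie n G) :=
  ⨆ β : {β : 𝔥 →ₗ[ℝ] ℂ // IsRoot β ∧ ∀ H : 𝔥, (H : RLie n G) ∈ aR n θ 𝔥 → β H = c * α H},
    rootSp β.1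

/-- `𝔫^α = 𝔫_{α/2} ⊕ 𝔫_{3α/2}`. -/
def nUpper (α : 𝔥 →ₗ[ℝ] ℂ) : Submodule ℂ (CLie n G) :=
  nMult θ α (1 / 2) ⊔ nMult θ α (3 / 2)

variable (𝔥) in
/-- `𝔭_M = ℂ ⊗ (𝔪₀ ∩ 𝔭₀)`. -/
def pM : Submodule ℂ (CLie n G) := (mR n θ 𝔥 ⊓ pR n θ).baseChange ℂ

/-- `𝔭_{M₂} = {X ∈ 𝔭_M | [X, 𝔤_α] = 0}`. -/
def pM2 (α : 𝔥 →ₗ[ℝ] ℂ) : Submodule ℂ (CLie n G) where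
  carrier := {X | X ∈ pM θ 𝔥 ∧ ∀ Y ∈ rootSp α, ⁅X, Y⁆ = 0}
  add_mem' hX hY := ⟨add_mem hX.1 hY.1, fun Z hZ => by
    rw [add_lie, hX.2 Z hZ, hY.2 Z hZ, add_zero]⟩
  zero_mem' := ⟨zero_mem _, fun Z _ => zero_lie Z⟩
  smul_mem' c X hX := ⟨Submodule.smul_mem _ c hX.1, fun Z hZ => by
    rw [smul_lie, hX.2 Z hZ, smul_zero]⟩

/-- `𝔭_{M₁}`: the orthocomplement of `𝔭_{M₂}` in `𝔭_M` for the (complex bilinear) Killing form. -/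
def pM1 (α : 𝔥 →ₗ[ℝ] ℂ) : Submodule ℂ (CLie n G) where
  carrier := {X | X ∈ pM θ 𝔥 ∧ ∀ Y ∈ pM2 θ α, killingForm ℂ (CLie n G) X Y = 0}
  add_mem' hX hY := ⟨add_mem hX.1 hY.1, fun Z hZ => by
    rw [map_add, LinearMap.add_apply, hX.2 Z hZ, hY.2 Z hZ, add_zero]⟩
  zero_mem' := ⟨zero_mem _, fun Z _ => by rw [map_zero, LinearMap.zero_apply]⟩
  smul_mem' c X hX := ⟨Submodule.smul_mem _ c hX.1, fun Z hZ => by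
    rw [map_smul, LinearMap.smul_apply, hX.2 Z hZ, smul_zero]⟩

end Group

end HermitianLie

end

/-! Everything is read off from one element Z of 𝔨₀. A complex structure J on 𝔭₀ that commutes with
Ad(K) has the form X ↦ [Z, X] with Z central in 𝔨₀ (`IsCartanInv.exists_center_eq`,
`IsCartanInvolution.exists_center`), so 𝔭₋ is the (-i)-eigenspace of ad Z on 𝔤. Since Z centralizes
𝔟₀, and the centralizer of 𝔟₀ in 𝔤₀ is 𝔥₀ plus the lines through a real root vector e and θe
(`SplitRankOne.exists_decomp_centB`), Z = b + u(e + θe) with b ∈ 𝔟₀. Because J² = -1, e can be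
scaled so that e, f = -θe, h = [e, f] is an 𝔰𝔩₂-triple commuting with b and Z = b + (e - f)/2
(`SplitRankOne.exists_sl2`).

Two Cayley transforms built from e and f carry A = ad(-ib + h/2) and B = ad(-ib - h/2) to -i ad Z
(`exists_cayley`). As ad Z has eigenvalues 0, ±i, the commuting operators A and B are diagonalizable
with eigenvalues in {-1, 0, 1}. So 𝔤 is a sum of joint eigenspaces (p, q), on which ad h acts by p -
q and ad b by i(p + q)/2. The weight 3 does not occur, and 𝔫^{α_r} is the weight-one space (1, 0) ⊕
(0, -1). Take 𝔫₋ = (0, -1). Then ad f maps 𝔫₋ onto (-1, 0), which the Killing form pairs perfectly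
with (1, 0); so (1, 0) is the contragredient of 𝔫₋ (`HermitianTriple.exists_equiv_nMinus`).

The Cayley transform for B carries the eigenspace B = -1 onto 𝔭₋. That eigenspace is (1, -1) ⊕ (0,
-1) ⊕ (-1, -1), where (0, -1) = 𝔫₋, (-1, -1) = 𝔭_{M₂,-}, and (1, -1) = ℂe ⊕ [e, 𝔭_{M₁}] with ad e
injective on 𝔭_{M₁} (`HermitianTriple.exists_equiv_prod`).

Finally, K_M fixes h and commutes with ad Z, and e is an expression in h and Z (`root_vector_eq`).
Hence K_M fixes e and f and commutes with A, B and the Cayley transform used for 𝔭₋, so all these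
maps are K_M-equivariant. -/

open scoped Manifold ContDiff TensorProduct

noncomputable section

namespace HermitianLie

/-! ### Second-order calculus of conjugation in coordinates. -/

section Calculus

open Filter Topology VectorField

variable {E : Type*} [NormedAddCommGroup E] [NormedSpace ℝ E]

/-- If `m` is a multiplication in a chart and `F` the conjugation, then the derivative of the
adjoint action along a curve is the Lie bracket of invariant vector fields. -/
lemma fderiv_conjugation_eq_lieBracket {m F : E × E → E} {x₀ : E}
    (hm : ContDiffAt ℝ 2 m (x₀, x₀)) (hF : ContDiffAt ℝ 2 F (x₀, x₀))
    (hm1 : ∀ᶠ x in 𝓝 x₀, m (x, x₀) = x) (hm2 : ∀ᶠ y in 𝓝 x₀, m (x₀, y) = y)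
    (hF1 : ∀ᶠ x in 𝓝 x₀, F (x, x₀) = x₀)
    (hmF : ∀ᶠ p in 𝓝 (x₀, x₀), m (F p, p.1) = m p) (X Y : E) :
    DifferentiableAt ℝ (fun x => fderiv ℝ F (x, x₀) (0, Y)) x₀ ∧
    fderiv ℝ (fun x => fderiv ℝ F (x, x₀) (0, Y)) x₀ X =
      lieBracket ℝ (fun x => fderiv ℝ m (x, x₀) (0, X)) (fun x => fderiv ℝ m (x, x₀) (0, Y)) x₀ := by
  have i1 : HasFDerivAt (fun x : E => (x, x₀)) (ContinuousLinearMap.inl ℝ E E) x₀ :=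
    hasFDerivAt_prodMk_left x₀ x₀
  have i2 : HasFDerivAt (fun x : E => (x₀, x)) (ContinuousLinearMap.inr ℝ E E) x₀ :=
    hasFDerivAt_prodMk_right x₀ x₀
  have dm : HasFDerivAt (fderiv ℝ m) (fderiv ℝ (fderiv ℝ m) (x₀, x₀)) (x₀, x₀) :=
    ((hm.fderiv_right (m := 1) (by norm_num)).differentiableAt (by norm_num)).hasFDerivAt
  have dF : HasFDerivAt (fderiv ℝ F) (fderiv ℝ (fderiv ℝ F) (x₀, x₀)) (x₀, x₀) :=
    ((hF.fderiv_right (m := 1) (by norm_num)).differentiableAt (by norm_num)).hasFDerivAt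
  set M := fderiv ℝ (fderiv ℝ m) (x₀, x₀) with hM
  have symm : ∀ v w, M v w = M w v := fun v w =>
    (hm.isSymmSndFDerivAt (by simp)) v w
  have L1 : ∀ v : E × E, HasFDerivAt (fun x => fderiv ℝ m (x, x₀) v)
      (((ContinuousLinearMap.apply ℝ E v).comp M).comp (ContinuousLinearMap.inl ℝ E E)) x₀ := by
    intro v
    have := HasFDerivAt.comp (f := fun x : E => (x, x₀)) x₀ dm i1
    exact ((ContinuousLinearMap.apply ℝ E v).hasFDerivAt).comp x₀ this
  have L2 : HasFDerivAt (fun x => (fderiv ℝ m (x₀, x)).comp (ContinuousLinearMap.inl ℝ E E))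
      (((ContinuousLinearMap.compL ℝ E (E × E) E).flip (ContinuousLinearMap.inl ℝ E E)).comp
        (M.comp (ContinuousLinearMap.inr ℝ E E))) x₀ := by
    have := (dm.comp x₀ i2)
    exact (((ContinuousLinearMap.compL ℝ E (E × E) E).flip
      (ContinuousLinearMap.inl ℝ E E)).hasFDerivAt).comp x₀ this
  have hu : HasFDerivAt (fun x => fderiv ℝ F (x, x₀) (0, Y))
      (((ContinuousLinearMap.apply ℝ E ((0, Y) : E × E)).comp
        (fderiv ℝ (fderiv ℝ F) (x₀, x₀))).comp (ContinuousLinearMap.inl ℝ E E)) x₀ :=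
    ((ContinuousLinearMap.apply ℝ E ((0, Y) : E × E)).hasFDerivAt).comp x₀
      (HasFDerivAt.comp (f := fun x : E => (x, x₀)) x₀ dF i1)
  have c1 : Tendsto (fun x : E => (x, x₀)) (𝓝 x₀) (𝓝 (x₀, x₀)) := i1.continuousAt
  have c2 : Tendsto (fun x : E => (x₀, x)) (𝓝 x₀) (𝓝 (x₀, x₀)) := i2.continuousAt
  have em : ∀ᶠ p in 𝓝 (x₀, x₀), DifferentiableAt ℝ m p :=
    (hm.eventually (by simp)).mono fun p hp => hp.differentiableAt (by norm_num)
  have eF : ∀ᶠ p in 𝓝 (x₀, x₀), DifferentiableAt ℝ F p :=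
    (hF.eventually (by simp)).mono fun p hp => hp.differentiableAt (by norm_num)
  -- Differentiating m(F(x, y), x) = m(x, y) in y at x₀ gives D₁m(x₀, x) u(x) = D₂m(x, x₀) Y, where
  -- u(x) = D₂F(x, x₀) Y stands for Ad(x)Y.
  have chain : ∀ᶠ x in 𝓝 x₀, (fderiv ℝ m (x₀, x)).comp (ContinuousLinearMap.inl ℝ E E)
      (fderiv ℝ F (x, x₀) (0, Y)) = fderiv ℝ m (x, x₀) (0, Y) := by
    filter_upwards [c1.eventually em, c2.eventually em, c1.eventually eF,
      c1.eventually hmF.eventually_nhds, hF1] with x h1 h2 h3 h4 h5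
    have hp : HasFDerivAt (fun p : E × E => (F p, p.1))
        ((fderiv ℝ F (x, x₀)).prod (ContinuousLinearMap.fst ℝ E E)) (x, x₀) :=
      h3.hasFDerivAt.prodMk hasFDerivAt_fst
    have h2' : HasFDerivAt m (fderiv ℝ m (x₀, x)) ((fun p : E × E => (F p, p.1)) (x, x₀)) := by
      simpa [h5] using h2.hasFDerivAt
    have h6 := (h2'.comp (x, x₀) hp).congr_of_eventuallyEq
      (h4.mono fun p hp => hp.symm : m =ᶠ[𝓝 (x, x₀)] _)
    rw [h6.fderiv]
    simp
  have R0 : (fderiv ℝ m (x₀, x₀)).comp (ContinuousLinearMap.inl ℝ E E) = .id ℝ E := by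
    have h := HasFDerivAt.comp (f := fun x : E => (x, x₀)) x₀ em.self_of_nhds.hasFDerivAt i1
    exact h.unique ((hasFDerivAt_id x₀).congr_of_eventuallyEq hm1)
  have L0 : (fderiv ℝ m (x₀, x₀)).comp (ContinuousLinearMap.inr ℝ E E) = .id ℝ E := by
    have h := (em.self_of_nhds.hasFDerivAt).comp x₀ i2
    exact h.unique ((hasFDerivAt_id x₀).congr_of_eventuallyEq hm2)
  have L0' : ∀ v : E, fderiv ℝ m (x₀, x₀) (0, v) = v := fun v => by
    simpa using congrArg (fun T => T v) L0
  have u0 : fderiv ℝ F (x₀, x₀) (0, Y) = Y := by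
    have := chain.self_of_nhds
    rw [R0, L0'] at this
    simpa using this
  refine ⟨hu.differentiableAt, ?_⟩
  -- A derivative in x expresses u'(X) as a difference of two mixed second derivatives of m; their
  -- symmetry turns the difference into the bracket.
  have key := (L2.clm_apply hu).congr_of_eventuallyEq (chain.mono fun x hx => hx.symm)
  have key2 := congrArg (fun T => T X) (key.unique (L1 (0, Y)))
  simp only [R0, u0] at key2
  rw [hu.fderiv]
  have key3 : (fderiv ℝ (fderiv ℝ F) (x₀, x₀)) (X, 0) (0, Y) + M (0, X) (Y, 0) = M (X, 0) (0, Y) := by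
    simpa using key2
  simp only [lieBracket, (L1 _).fderiv, L0']
  have := symm (0, X) (Y, 0)
  simp
  rw [← key3, this]; abel

end Calculus

/-! ### The adjoint representation: its differential is ad, and each Ad g is an automorphism. -/

section Chart

open Filter Topology VectorField

variable (n : ℕ) (G : Type*) [TopologicalSpace G] [ChartedSpace (EuclideanSpace ℝ (Fin n)) G]
  [Group G]

/-- The multiplication in the chart at `1`. -/
def chartMul (p : EuclideanSpace ℝ (Fin n) × EuclideanSpace ℝ (Fin n)) : EuclideanSpace ℝ (Fin n) :=
  extChartAt (𝓡 n) (1 : G)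
    ((extChartAt (𝓡 n) (1 : G)).symm p.1 * (extChartAt (𝓡 n) (1 : G)).symm p.2)

/-- The conjugation in the chart at `1`. -/
def chartConj (p : EuclideanSpace ℝ (Fin n) × EuclideanSpace ℝ (Fin n)) :
    EuclideanSpace ℝ (Fin n) :=
  extChartAt (𝓡 n) (1 : G)
    ((extChartAt (𝓡 n) (1 : G)).symm p.1 * (extChartAt (𝓡 n) (1 : G)).symm p.2 *
      ((extChartAt (𝓡 n) (1 : G)).symm p.1)⁻¹)

/-- The coordinates of `1`. -/
def chartOne : EuclideanSpace ℝ (Fin n) := extChartAt (𝓡 n) (1 : G) 1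

lemma chart_symm_chartOne : (extChartAt (𝓡 n) (1 : G)).symm (chartOne n G) = 1 := by
  simp [chartOne]

variable [LieGroup (𝓡 n) ∞ G]

variable {G} in
lemma contMDiffAt_chart_symm {x : EuclideanSpace ℝ (Fin n)}
    (hx : x ∈ (extChartAt (𝓡 n) (1 : G)).target) :
    ContMDiffAt 𝓘(ℝ, EuclideanSpace ℝ (Fin n)) (𝓡 n) ∞ (extChartAt (𝓡 n) (1 : G)).symm x :=
  (contMDiffOn_extChartAt_symm (I := 𝓡 n) (n := ∞) (1 : G)).contMDiffAt
    ((isOpen_extChartAt_target (I := 𝓡 n) (1 : G)).mem_nhds hx)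

omit [LieGroup (𝓡 n) ∞ G] in
lemma chartOne_mem_target : chartOne n G ∈ (extChartAt (𝓡 n) (1 : G)).target :=
  mem_extChartAt_target (I := 𝓡 n) (1 : G)

lemma contMDiffAt_chart_fst :
    ContMDiffAt 𝓘(ℝ, EuclideanSpace ℝ (Fin n) × EuclideanSpace ℝ (Fin n)) (𝓡 n) ∞
      (fun p => (extChartAt (𝓡 n) (1 : G)).symm p.1) (chartOne n G, chartOne n G) :=
  ContMDiffAt.comp (I' := 𝓘(ℝ, EuclideanSpace ℝ (Fin n))) (chartOne n G, chartOne n G)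
    (g := (extChartAt (𝓡 n) (1 : G)).symm) (f := Prod.fst)
    (contMDiffAt_chart_symm n (chartOne_mem_target n G)) contDiff_fst.contMDiff.contMDiffAt

lemma contMDiffAt_chart_snd :
    ContMDiffAt 𝓘(ℝ, EuclideanSpace ℝ (Fin n) × EuclideanSpace ℝ (Fin n)) (𝓡 n) ∞
      (fun p => (extChartAt (𝓡 n) (1 : G)).symm p.2) (chartOne n G, chartOne n G) :=
  ContMDiffAt.comp (I' := 𝓘(ℝ, EuclideanSpace ℝ (Fin n))) (chartOne n G, chartOne n G)
    (g := (extChartAt (𝓡 n) (1 : G)).symm) (f := Prod.snd)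
    (contMDiffAt_chart_symm n (chartOne_mem_target n G)) contDiff_snd.contMDiff.contMDiffAt

lemma contDiffAt_chartMul : ContDiffAt ℝ ∞ (chartMul n G) (chartOne n G, chartOne n G) := by
  rw [← contMDiffAt_iff_contDiffAt]
  refine ContMDiffAt.comp (I' := 𝓡 n) (chartOne n G, chartOne n G)
    (g := extChartAt (𝓡 n) (1 : G)) ?_
    ((contMDiffAt_chart_fst n G).mul (contMDiffAt_chart_snd n G))
  simp only [chart_symm_chartOne, mul_one]
  exact contMDiffAt_extChartAt

lemma contDiffAt_chartConj : ContDiffAt ℝ ∞ (chartConj n G) (chartOne n G, chartOne n G) := by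
  rw [← contMDiffAt_iff_contDiffAt]
  refine ContMDiffAt.comp (I' := 𝓡 n) (chartOne n G, chartOne n G)
    (g := extChartAt (𝓡 n) (1 : G)) ?_
    (((contMDiffAt_chart_fst n G).mul (contMDiffAt_chart_snd n G)).mul
      (contMDiffAt_chart_fst n G).inv)
  simp only [chart_symm_chartOne, mul_one, inv_one]
  exact contMDiffAt_extChartAt

variable {G}

lemma AdMap_eq_fderiv (g : G) : AdMap n g =
    (fderiv ℝ (fun y => extChartAt (𝓡 n) (1 : G) (g * (extChartAt (𝓡 n) (1 : G)).symm y * g⁻¹))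
      (chartOne n G) : EuclideanSpace ℝ (Fin n) →L[ℝ] EuclideanSpace ℝ (Fin n)) := by
  unfold AdMap
  rw [(mdifferentiable_conj n g 1).mfderiv]
  have h : (fun x : G => g * x * g⁻¹) 1 = 1 := by simp
  have e : writtenInExtChartAt (𝓡 n) (𝓡 n) 1 (fun x : G => g * x * g⁻¹) =
      fun y => extChartAt (𝓡 n) (1 : G) (g * (extChartAt (𝓡 n) (1 : G)).symm y * g⁻¹) := by
    unfold writtenInExtChartAt
    rw [h]
    rfl
  rw [e]
  simp [chartOne]
  rfl

omit [LieGroup (𝓡 n) ∞ G] in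
lemma chart_tendsto_fst : Tendsto (fun x => (x, chartOne n G)) (𝓝 (chartOne n G))
    (𝓝 (chartOne n G, chartOne n G)) :=
  (Continuous.prodMk_left (chartOne n G)).continuousAt

lemma eventually_AdMap_chart_eq (Y : EuclideanSpace ℝ (Fin n)) :
    ∀ᶠ x in 𝓝 (chartOne n G), (AdMap n ((extChartAt (𝓡 n) (1 : G)).symm x) Y :
      EuclideanSpace ℝ (Fin n)) = fderiv ℝ (chartConj n G) (x, chartOne n G) (0, Y) := by
  have h1 := ((contDiffAt_chartConj n G).of_le (m := 2) (WithTop.coe_le_coe.2 (le_top : (2 : ℕ∞) ≤ ⊤))).eventually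
    (by simp)
  filter_upwards [(chart_tendsto_fst n).eventually h1] with x hx
  rw [AdMap_eq_fderiv]
  have h2 := HasFDerivAt.comp (f := fun y => (x, y)) (chartOne n G)
    (hx.differentiableAt (by norm_num)).hasFDerivAt (hasFDerivAt_prodMk_right x (chartOne n G))
  have h3 := h2.fderiv
  change fderiv ℝ (chartConj n G ∘ fun y => (x, y)) (chartOne n G) Y = _
  rw [h3]
  simp

/-- In the chart, left translation by the point with coordinates x is y ↦ m(x, y), so an invariant
field becomes a partial derivative of m. This is the form that `fderiv_conjugation_eq_lieBracket`
needs. -/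
lemma eventually_mpullback_chart_symm (X : RLie n G) :
    ∀ᶠ x in 𝓝 (chartOne n G),
      mpullback 𝓘(ℝ, EuclideanSpace ℝ (Fin n)) (𝓡 n) (extChartAt (𝓡 n) (1 : G)).symm
        (mulInvariantVectorField X) x = fderiv ℝ (chartMul n G) (x, chartOne n G) (0, X) := by
  have h1 := ((contDiffAt_chartMul n G).of_le (m := 2) (WithTop.coe_le_coe.2 (le_top : (2 : ℕ∞) ≤ ⊤))).eventually
    (by simp)
  filter_upwards [(chart_tendsto_fst n).eventually h1,
    (isOpen_extChartAt_target (I := 𝓡 n) (1 : G)).mem_nhds (chartOne_mem_target n G)] with x hx ht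
  have h2 := HasFDerivAt.comp (f := fun y => (x, y)) (chartOne n G)
    (hx.differentiableAt (by norm_num)).hasFDerivAt (hasFDerivAt_prodMk_right x (chartOne n G))
  have i1 := mfderiv_extChartAt_comp_mfderivWithin_extChartAt_symm (I := 𝓡 n) ht
  have i2 := mfderivWithin_extChartAt_symm_comp_mfderiv_extChartAt (I := 𝓡 n) ht
  simp only [modelWithCornersSelf_coe, Set.range_id, mfderivWithin_univ] at i1 i2
  rw [mpullback_apply, ContinuousLinearMap.inverse_eq i2 i1]
  set g := (extChartAt (𝓡 n) (1 : G)).symm x with hg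
  have hgs : g ∈ (chartAt (EuclideanSpace ℝ (Fin n)) (1 : G)).source := by
    rw [← extChartAt_source (I := 𝓡 n)]
    exact (extChartAt (𝓡 n) (1 : G)).map_target ht
  have d1 : MDifferentiableAt (𝓡 n) 𝓘(ℝ, EuclideanSpace ℝ (Fin n)) (extChartAt (𝓡 n) (1 : G))
      (g * 1) := by
    rw [mul_one]; exact mdifferentiableAt_extChartAt hgs
  have d2 : MDifferentiableAt (𝓡 n) (𝓡 n) (fun a : G => g * a) 1 :=
    (contMDiff_mul_left (I := 𝓡 n) (n := ∞) (a := g)).contMDiffAt.mdifferentiableAt (by simp)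
  have c := mfderiv_comp (1 : G) d1 d2
  have c2 : mfderiv (𝓡 n) 𝓘(ℝ, EuclideanSpace ℝ (Fin n))
      ((extChartAt (𝓡 n) (1 : G)) ∘ (fun a : G => g * a)) 1 =
      fderiv ℝ (chartMul n G ∘ fun y => (x, y)) (chartOne n G) := by
    rw [(d1.comp (1 : G) d2).mfderiv]
    simp [writtenInExtChartAt, chartOne]
    rfl
  rw [c2, h2.fderiv] at c
  have e1 : (mfderiv (𝓡 n) 𝓘(ℝ, EuclideanSpace ℝ (Fin n)) (extChartAt (𝓡 n) (1 : G)) (g * 1) :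
      EuclideanSpace ℝ (Fin n) →L[ℝ] EuclideanSpace ℝ (Fin n)) =
      mfderiv (𝓡 n) 𝓘(ℝ, EuclideanSpace ℝ (Fin n)) (extChartAt (𝓡 n) (1 : G)) g := by
    rw [mul_one]
  have c3 := congrArg (fun T : EuclideanSpace ℝ (Fin n) →L[ℝ] EuclideanSpace ℝ (Fin n) => T X) c
  have c4 := congrArg (fun T : EuclideanSpace ℝ (Fin n) →L[ℝ] EuclideanSpace ℝ (Fin n) =>
    T (mulInvariantVectorField X g)) e1
  have c5 : (fderiv ℝ (chartMul n G) (x, chartOne n G)).comp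
    (ContinuousLinearMap.inr ℝ _ _) X = fderiv ℝ (chartMul n G) (x, chartOne n G) (0, X) := rfl
  exact c4.symm.trans (c3.symm.trans c5)

/-- The tangent space at 1 is coordinatized by this very chart, so the derivative there is the
identity. The point g is kept variable so that g = 1 can be substituted in the dependent type of V.
-/
lemma mfderiv_chart_one_apply (V : Π g : G, TangentSpace (𝓡 n) g) {g : G} (hg : g = 1) :
    (mfderiv (𝓡 n) 𝓘(ℝ, EuclideanSpace ℝ (Fin n)) (extChartAt (𝓡 n) (1 : G)) g (V g) :
      EuclideanSpace ℝ (Fin n)) = V 1 := by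
  subst hg
  have h : mfderiv (𝓡 n) 𝓘(ℝ, EuclideanSpace ℝ (Fin n)) (extChartAt (𝓡 n) (1 : G)) 1 =
      ContinuousLinearMap.id ℝ (EuclideanSpace ℝ (Fin n)) := by
    rw [(mdifferentiableAt_extChartAt (mem_chart_source _ (1 : G))).mfderiv]
    have e : writtenInExtChartAt (𝓡 n) 𝓘(ℝ, EuclideanSpace ℝ (Fin n)) (1 : G)
        (extChartAt (𝓡 n) (1 : G)) =ᶠ[𝓝 (chartOne n G)] id := by
      filter_upwards [(isOpen_extChartAt_target (I := 𝓡 n) (1 : G)).mem_nhds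
        (chartOne_mem_target n G)] with x hx
      exact (extChartAt (𝓡 n) (1 : G)).right_inv hx
    simp only [modelWithCornersSelf_coe, Set.range_id, fderivWithin_univ]
    exact e.fderiv_eq.trans fderiv_id
  exact congrArg (fun T : EuclideanSpace ℝ (Fin n) →L[ℝ] EuclideanSpace ℝ (Fin n) => T (V 1)) h

lemma mlieBracket_eq_lieBracket {E : Type*} [NormedAddCommGroup E] [NormedSpace ℝ E]
    (V W : Π x : E, TangentSpace 𝓘(ℝ, E) x) (x : E) :
    mlieBracket 𝓘(ℝ, E) V W x = lieBracket ℝ (V : E → E) (W : E → E) x := by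
  rw [← mlieBracketWithin_univ, mlieBracketWithin_eq_lieBracketWithin]
  exact congrFun (lieBracketWithin_univ (𝕜 := ℝ) (V := (V : E → E)) (W := (W : E → E))) x

lemma bracket_eq_lieBracket_chart (X Y : RLie n G) :
    (⁅X, Y⁆ : RLie n G) = lieBracket ℝ (fun x => fderiv ℝ (chartMul n G) (x, chartOne n G) (0, X))
      (fun x => fderiv ℝ (chartMul n G) (x, chartOne n G) (0, Y)) (chartOne n G) := by
  have ht := chartOne_mem_target n G
  have i1 := mfderiv_extChartAt_comp_mfderivWithin_extChartAt_symm (I := 𝓡 n) ht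
  have i2 := mfderivWithin_extChartAt_symm_comp_mfderiv_extChartAt (I := 𝓡 n) ht
  simp only [modelWithCornersSelf_coe, Set.range_id, mfderivWithin_univ] at i1 i2
  have h := mpullback_mlieBracket (n := minSmoothness ℝ 3) (I := 𝓘(ℝ, EuclideanSpace ℝ (Fin n)))
    (I' := 𝓡 n) (f := (extChartAt (𝓡 n) (1 : G)).symm) (x₀ := chartOne n G)
    (V := mulInvariantVectorField X) (W := mulInvariantVectorField Y)
    (mdifferentiableAt_mulInvariantVectorField X) (mdifferentiableAt_mulInvariantVectorField Y)
    ((contMDiffAt_chart_symm n ht).of_le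
      (by rw [minSmoothness_of_isRCLikeNormedField]
          exact WithTop.coe_le_coe.2 (le_top : (3 : ℕ∞) ≤ ⊤)))
    (minSmoothness_monotone (by norm_cast))
  rw [mpullback_apply, ContinuousLinearMap.inverse_eq i2 i1] at h
  exact ((mfderiv_chart_one_apply n (mlieBracket (𝓡 n) (mulInvariantVectorField X)
    (mulInvariantVectorField Y)) (chart_symm_chartOne n G)).symm.trans h).trans
    ((mlieBracket_eq_lieBracket (E := EuclideanSpace ℝ (Fin n)) _ _ _).trans
      (Filter.EventuallyEq.lieBracket_vectorField_eq (E := EuclideanSpace ℝ (Fin n))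
        (eventually_mpullback_chart_symm n X)
        (eventually_mpullback_chart_symm n Y)))

omit [LieGroup (𝓡 n) ∞ G] in
lemma chartMul_chartOne_left :
    ∀ᶠ y in 𝓝 (chartOne n G), chartMul n G (chartOne n G, y) = y := by
  filter_upwards [(isOpen_extChartAt_target (I := 𝓡 n) (1 : G)).mem_nhds
    (chartOne_mem_target n G)] with x hx
  rw [chartMul, chart_symm_chartOne, one_mul, (extChartAt (𝓡 n) (1 : G)).right_inv hx]

omit [LieGroup (𝓡 n) ∞ G] in
lemma chartMul_chartOne_right :
    ∀ᶠ x in 𝓝 (chartOne n G), chartMul n G (x, chartOne n G) = x := by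
  filter_upwards [(isOpen_extChartAt_target (I := 𝓡 n) (1 : G)).mem_nhds
    (chartOne_mem_target n G)] with x hx
  rw [chartMul, chart_symm_chartOne, mul_one, (extChartAt (𝓡 n) (1 : G)).right_inv hx]

omit [LieGroup (𝓡 n) ∞ G] in
lemma chartConj_chartOne_right (x : EuclideanSpace ℝ (Fin n)) :
    chartConj n G (x, chartOne n G) = chartOne n G := by
  simp only [chartConj, chart_symm_chartOne, mul_one, mul_inv_cancel]
  rfl

lemma chartMul_chartConj : ∀ᶠ p in 𝓝 (chartOne n G, chartOne n G),
    chartMul n G (chartConj n G p, p.1) = chartMul n G p := by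
  have c : ContinuousAt (fun p : EuclideanSpace ℝ (Fin n) × EuclideanSpace ℝ (Fin n) =>
      (extChartAt (𝓡 n) (1 : G)).symm p.1 * (extChartAt (𝓡 n) (1 : G)).symm p.2 *
      ((extChartAt (𝓡 n) (1 : G)).symm p.1)⁻¹) (chartOne n G, chartOne n G) :=
    (((contMDiffAt_chart_fst n G).mul (contMDiffAt_chart_snd n G)).mul
      (contMDiffAt_chart_fst n G).inv).continuousAt
  have hs : (extChartAt (𝓡 n) (1 : G)).source ∈ 𝓝
      ((extChartAt (𝓡 n) (1 : G)).symm (chartOne n G) *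
        (extChartAt (𝓡 n) (1 : G)).symm (chartOne n G) *
        ((extChartAt (𝓡 n) (1 : G)).symm (chartOne n G))⁻¹) := by
    simp only [chart_symm_chartOne, mul_one, inv_one]
    exact extChartAt_source_mem_nhds (I := 𝓡 n) (1 : G)
  filter_upwards [c hs] with p hp
  simp only [chartMul, chartConj]
  rw [(extChartAt (𝓡 n) (1 : G)).left_inv hp, inv_mul_cancel_right]

/-- The differential of `Ad` at `1` is `ad`. -/
theorem hasFDerivAt_AdMap_chart (Y : RLie n G) :
    ∃ D : EuclideanSpace ℝ (Fin n) →L[ℝ] EuclideanSpace ℝ (Fin n),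
      HasFDerivAt (fun x => (AdMap n ((extChartAt (𝓡 n) (1 : G)).symm x) Y :
        EuclideanSpace ℝ (Fin n))) D (chartOne n G) ∧ ∀ X : RLie n G, D X = ⁅X, Y⁆ := by
  have key := fun X : EuclideanSpace ℝ (Fin n) => fderiv_conjugation_eq_lieBracket
    ((contDiffAt_chartMul n G).of_le (WithTop.coe_le_coe.2 (le_top : (2 : ℕ∞) ≤ ⊤)))
    ((contDiffAt_chartConj n G).of_le (WithTop.coe_le_coe.2 (le_top : (2 : ℕ∞) ≤ ⊤)))
    (chartMul_chartOne_right n) (chartMul_chartOne_left n)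
    (Eventually.of_forall (chartConj_chartOne_right n)) (chartMul_chartConj n) X Y
  refine ⟨_, ((key 0).1.hasFDerivAt).congr_of_eventuallyEq (eventually_AdMap_chart_eq n Y), ?_⟩
  intro X
  rw [bracket_eq_lieBracket_chart]
  exact (key X).2

/-- The derivative of the adjoint action along a curve through `1`. -/
theorem hasDerivAt_AdMap_comp {γ : ℝ → G} (h0 : γ 0 = 1) {X : RLie n G}
    (hγ : HasMFDerivAt 𝓘(ℝ, ℝ) (𝓡 n) γ 0
      (ContinuousLinearMap.toSpanSingleton ℝ (X : EuclideanSpace ℝ (Fin n)))) (Y : RLie n G) :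
    HasDerivAt (fun t => (AdMap n (γ t) Y : EuclideanSpace ℝ (Fin n))) ⁅X, Y⁆ 0 := by
  obtain ⟨D, hD, hDX⟩ := hasFDerivAt_AdMap_chart n Y
  have h1 : HasDerivAt (fun t => extChartAt (𝓡 n) (1 : G) (γ t)) X 0 := by
    have h := hγ.2
    have e : writtenInExtChartAt 𝓘(ℝ, ℝ) (𝓡 n) 0 γ = fun t => extChartAt (𝓡 n) (1 : G) (γ t) := by
      unfold writtenInExtChartAt
      rw [h0]
      rfl
    rw [e] at h
    simp only [modelWithCornersSelf_coe, Set.range_id] at h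
    have h' : HasFDerivWithinAt (fun t => extChartAt (𝓡 n) (1 : G) (γ t))
      (ContinuousLinearMap.toSpanSingleton ℝ (X : EuclideanSpace ℝ (Fin n))) Set.univ (0 : ℝ) := h
    have e1 : (ContinuousLinearMap.toSpanSingleton ℝ (X : EuclideanSpace ℝ (Fin n))) (1 : ℝ) = X :=
      one_smul ℝ (X : EuclideanSpace ℝ (Fin n))
    have h1 := (hasFDerivWithinAt_univ.1 h').hasDerivAt
    exact (congrArg (fun v : EuclideanSpace ℝ (Fin n) => HasDerivAt
      (fun t => extChartAt (𝓡 n) (1 : G) (γ t)) v 0) e1).mp h1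
  have h2 : HasFDerivAt (fun x => (AdMap n ((extChartAt (𝓡 n) (1 : G)).symm x) Y :
        EuclideanSpace ℝ (Fin n))) D (extChartAt (𝓡 n) (1 : G) (γ 0)) := by
    rw [h0]; exact hD
  have h3 := HasFDerivAt.comp_hasDerivAt (E := EuclideanSpace ℝ (Fin n))
    (F := EuclideanSpace ℝ (Fin n)) (0 : ℝ) h2 h1
  rw [hDX] at h3
  refine h3.congr_of_eventuallyEq ?_
  have hs : ∀ᶠ t in 𝓝 (0 : ℝ), γ t ∈ (extChartAt (𝓡 n) (1 : G)).source :=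
    hγ.1 (by rw [h0]; exact extChartAt_source_mem_nhds (I := 𝓡 n) (1 : G))
  filter_upwards [hs] with t ht
  simp only [Function.comp]
  rw [(extChartAt (𝓡 n) (1 : G)).left_inv ht]

/-- Conjugation by `g` as a diffeomorphism. -/
def conjDiffeomorph (g : G) : G ≃ₘ^∞⟮𝓡 n, 𝓡 n⟯ G where
  toEquiv := (MulAut.conj g).toEquiv
  contMDiff_toFun := (contMDiff_const.mul contMDiff_id).mul contMDiff_const
  contMDiff_invFun := (contMDiff_const.mul contMDiff_id).mul contMDiff_const

lemma isInvertible_mfderiv_conj (g h : G) :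
    (mfderiv (𝓡 n) (𝓡 n) (fun x : G => g * x * g⁻¹) h).IsInvertible :=
  ⟨(conjDiffeomorph n g).mfderivToContinuousLinearEquiv (by simp) h, rfl⟩

/-- Conjugation c satisfies c ∘ L_h = L_{ghg⁻¹} ∘ c; differentiate at 1. As pullback respects
brackets, this makes Ad g a Lie algebra map. -/
lemma mpullback_conj_mulInvariantVectorField (g : G) (X : RLie n G) :
    mpullback (𝓡 n) (𝓡 n) (fun x : G => g * x * g⁻¹) (mulInvariantVectorField (AdMap n g X)) =
      mulInvariantVectorField X := by
  ext1 h
  rw [mpullback_apply, (isInvertible_mfderiv_conj n g h).inverse_apply_eq]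
  have dl : ∀ a b : G, MDifferentiableAt (𝓡 n) (𝓡 n) (fun x : G => a * x) b := fun a b =>
    (contMDiff_mul_left (I := 𝓡 n) (n := ∞) (a := a)).contMDiffAt.mdifferentiableAt (by simp)
  have e : (fun x : G => g * x * g⁻¹) ∘ (fun x : G => h * x) =
      (fun x : G => (g * h * g⁻¹) * x) ∘ (fun x : G => g * x * g⁻¹) := by
    ext x; simp [mul_assoc]
  have c1 := mfderiv_comp (1 : G) (mdifferentiable_conj n g (h * 1)) (dl h 1)
  have c2 := mfderiv_comp (1 : G) (dl (g * h * g⁻¹) (g * 1 * g⁻¹)) (mdifferentiable_conj n g 1)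
  rw [e] at c1
  -- The base points h * 1 and h are equal only propositionally; reading all tangent spaces as the
  -- model space allows the transport.
  have t1 : ∀ a b : G, a = b → ∀ v : EuclideanSpace ℝ (Fin n),
      (mfderiv (𝓡 n) (𝓡 n) (fun x : G => g * x * g⁻¹) a v : EuclideanSpace ℝ (Fin n)) =
      mfderiv (𝓡 n) (𝓡 n) (fun x : G => g * x * g⁻¹) b v := by
    rintro a _ rfl v; rfl
  have t2 : ∀ a b : G, a = b → ∀ v : EuclideanSpace ℝ (Fin n),
      (mfderiv (𝓡 n) (𝓡 n) (fun x : G => (g * h * g⁻¹) * x) a v : EuclideanSpace ℝ (Fin n)) =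
      mfderiv (𝓡 n) (𝓡 n) (fun x : G => (g * h * g⁻¹) * x) b v := by
    rintro a _ rfl v; rfl
  have c3 : (mfderiv (𝓡 n) (𝓡 n) (fun x : G => (g * h * g⁻¹) * x) (g * 1 * g⁻¹)
      (mfderiv (𝓡 n) (𝓡 n) (fun x : G => g * x * g⁻¹) 1 X) : EuclideanSpace ℝ (Fin n)) =
      mfderiv (𝓡 n) (𝓡 n) (fun x : G => g * x * g⁻¹) (h * 1)
        (mfderiv (𝓡 n) (𝓡 n) (fun x : G => h * x) 1 X) :=
    (congrArg (fun T : EuclideanSpace ℝ (Fin n) →L[ℝ] EuclideanSpace ℝ (Fin n) => T X)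
      (c2.symm.trans c1))
  exact (t2 (g * 1 * g⁻¹) 1 (by simp) _).symm.trans (c3.trans (t1 _ _ (mul_one h) _))

/-- `Ad g` respects the bracket. -/
theorem AdMap_lie (g : G) (X Y : RLie n G) : AdMap n g ⁅X, Y⁆ = ⁅AdMap n g X, AdMap n g Y⁆ := by
  have h := mpullback_mlieBracket (n := minSmoothness ℝ 3) (I := 𝓡 n)
    (I' := 𝓡 n) (f := fun x : G => g * x * g⁻¹) (x₀ := (1 : G))
    (V := mulInvariantVectorField (AdMap n g X)) (W := mulInvariantVectorField (AdMap n g Y))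
    (mdifferentiableAt_mulInvariantVectorField _) (mdifferentiableAt_mulInvariantVectorField _)
    ((conjDiffeomorph n g).contMDiff.contMDiffAt.of_le
      (by rw [minSmoothness_of_isRCLikeNormedField]
          exact WithTop.coe_le_coe.2 (le_top : (3 : ℕ∞) ≤ ⊤)))
    (minSmoothness_monotone (by norm_cast))
  rw [mpullback_conj_mulInvariantVectorField, mpullback_conj_mulInvariantVectorField,
    mpullback_apply, (isInvertible_mfderiv_conj n g 1).inverse_apply_eq] at h
  have t : ∀ a b : G, a = b → ∀ V : Π x : G, TangentSpace (𝓡 n) x,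
      (V a : EuclideanSpace ℝ (Fin n)) = V b := by
    rintro a _ rfl V; rfl
  exact h.symm.trans (t (g * 1 * g⁻¹) 1 (by simp) _)

end Chart

/-! ### Invariant complex structures come from the center of 𝔨₀. -/

section RealAlgebra

variable {L : Type*} [LieRing L] [LieAlgebra ℝ L] [FiniteDimensional ℝ L]

/-- An endomorphism that is skew for a nondegenerate bilinear form has trace zero. -/
lemma trace_eq_zero_of_skew {V : Type*} [AddCommGroup V] [Module ℝ V] [FiniteDimensional ℝ V]
    {B : LinearMap.BilinForm ℝ V} (hB : ∀ X, (∀ Y, B X Y = 0) → X = 0) {T : Module.End ℝ V}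
    (hT : ∀ X Y, B (T X) Y = - B X (T Y)) : LinearMap.trace ℝ V T = 0 := by
  have hinj : Function.Injective (B : V →ₗ[ℝ] Module.Dual ℝ V) := by
    rw [injective_iff_map_eq_zero]
    intro X hX
    exact hB X fun Y => by rw [hX]; rfl
  let e : V ≃ₗ[ℝ] Module.Dual ℝ V :=
    LinearEquiv.ofInjectiveOfFinrankEq B hinj Subspace.dual_finrank_eq.symm
  -- The form identifies V with its dual, and skewness says that T becomes minus its transpose,
  -- which has the same trace as T up to sign.
  have h1 : e.conj T = - Module.Dual.transpose (R := ℝ) T := by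
    ext φ Y
    obtain ⟨X, rfl⟩ := e.surjective φ
    rw [LinearEquiv.conj_apply_apply, e.symm_apply_apply]
    exact hT X Y
  have h2 := LinearMap.trace_conj' T e
  have h3 := (LinearMap.trace ℝ (Module.Dual ℝ V)).map_neg (Module.Dual.transpose (R := ℝ) T)
  have h4 := LinearMap.trace_transpose' (R := ℝ) T
  rw [h1] at h2
  linarith [h2.symm.trans h3]

/-- The data of a Cartan involution on a finite-dimensional real Lie algebra. -/
structure IsCartanInv (θ : L ≃ₗ⁅ℝ⁆ L) : Prop where
  involutive : ∀ X, θ (θ X) = X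
  posDef : ∀ X, X ≠ 0 → 0 < -(killingForm ℝ L X (θ X))

namespace IsCartanInv

variable {θ : L ≃ₗ⁅ℝ⁆ L} (hθ : IsCartanInv θ)
include hθ

omit [FiniteDimensional ℝ L] in
lemma nondeg (X : L) (h : ∀ Y, killingForm ℝ L X Y = 0) : X = 0 := by
  by_contra hX
  have := hθ.posDef X hX
  rw [h] at this
  simp at this

omit [FiniteDimensional ℝ L] in
lemma pos_of_p {X : L} (hX : θ X = -X) (h0 : X ≠ 0) : 0 < killingForm ℝ L X X := by
  have := hθ.posDef X h0
  rw [hX] at this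
  simpa using this

omit [FiniteDimensional ℝ L] in
lemma nonneg_of_p {X : L} (hX : θ X = -X) : 0 ≤ killingForm ℝ L X X := by
  by_cases h : X = 0
  · simp [h]
  · exact (hθ.pos_of_p hX h).le

omit [FiniteDimensional ℝ L] in
lemma killing_theta_nonpos (X : L) : killingForm ℝ L X (θ X) ≤ 0 := by
  by_cases h : X = 0
  · simp [h]
  · have := hθ.posDef X h
    linarith

omit hθ [FiniteDimensional ℝ L] in
lemma killing_theta (X Y : L) : killingForm ℝ L (θ X) (θ Y) = killingForm ℝ L X Y :=
  LieAlgebra.killingForm_of_equiv_apply θ X Y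

omit [FiniteDimensional ℝ L] in
lemma killing_theta_left (X Y : L) : killingForm ℝ L (θ X) Y = killingForm ℝ L X (θ Y) := by
  rw [← killing_theta (θ := θ) X, hθ.involutive]

omit hθ [FiniteDimensional ℝ L] in
lemma killing_comm (X Y : L) : killingForm ℝ L X Y = killingForm ℝ L Y X :=
  LieModule.traceForm_comm ℝ L L X Y

omit hθ [FiniteDimensional ℝ L] in
lemma killing_lie (X Y V : L) : killingForm ℝ L ⁅X, Y⁆ V = killingForm ℝ L X ⁅Y, V⁆ :=
  LieModule.traceForm_apply_lie_apply ℝ L L X Y V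

omit hθ [FiniteDimensional ℝ L] in
lemma killing_lie' (X Y V : L) : killingForm ℝ L ⁅X, Y⁆ V = - killingForm ℝ L Y ⁅X, V⁆ := by
  rw [← lie_skew, map_neg, LinearMap.neg_apply, killing_lie]

/-- A vector in the dual of `L` is represented by the Killing form. -/
lemma exists_killing_eq (l : L →ₗ[ℝ] ℝ) : ∃ Z, ∀ V, killingForm ℝ L Z V = l V := by
  have hinj : Function.Injective (killingForm ℝ L : L →ₗ[ℝ] Module.Dual ℝ L) := by
    rw [injective_iff_map_eq_zero]
    intro X hX
    exact hθ.nondeg X fun Y => by rw [hX]; rfl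
  have hs := (LinearMap.injective_iff_surjective_of_finrank_eq_finrank
    (f := (killingForm ℝ L : L →ₗ[ℝ] Module.Dual ℝ L)) Subspace.dual_finrank_eq.symm).1 hinj
  obtain ⟨Z, hZ⟩ := hs l
  exact ⟨Z, fun V => by rw [hZ]⟩

omit [FiniteDimensional ℝ L] in
/-- Splitting into the `±1` eigenspaces of `θ`. -/
lemma exists_decomp (X : L) : ∃ U V, θ U = U ∧ θ V = -V ∧ X = U + V := by
  refine ⟨(1 / 2 : ℝ) • (X + θ X), (1 / 2 : ℝ) • (X - θ X), ?_, ?_, ?_⟩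
  · rw [map_smul, map_add, hθ.involutive, add_comm]
  · rw [map_smul, map_sub, hθ.involutive, ← smul_neg, neg_sub]
  · rw [← smul_add]; simp [← two_smul ℝ X, smul_smul]

/-- A complex structure on `𝔭₀` that commutes with `𝔨₀` is given by an element of the center
of `𝔨₀`. -/
theorem exists_center_eq {J : L →ₗ[ℝ] L} (hJk : ∀ X, θ X = X → J X = 0)
    (hJp : ∀ X, θ X = -X → θ (J X) = -J X) (hJJ : ∀ X, θ X = -X → J (J X) = -X)
    (hJW : ∀ W X, θ W = W → J ⁅W, X⁆ = ⁅W, J X⁆) :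
    ∃ Z, θ Z = Z ∧ ∀ X, ⁅Z, X⁆ = J X := by
  classical
  let a : L → Module.End ℝ L := fun X => LieAlgebra.ad ℝ L X
  let t : Module.End ℝ L := (θ.toLinearEquiv : L →ₗ[ℝ] L)
  let P : Module.End ℝ L := (1 / 2 : ℝ) • (1 - t)
  have tX : ∀ X, t X = θ X := fun X => rfl
  have aX : ∀ X Y, a X Y = ⁅X, Y⁆ := fun X Y => rfl
  have PX : ∀ X, P X = (1 / 2 : ℝ) • (X - θ X) := fun X => rfl
  have Pk : ∀ X, θ X = X → P X = 0 := fun X h => by rw [PX, h, sub_self, smul_zero]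
  have Pp : ∀ X, θ X = -X → P X = X := fun X h => by
    rw [PX, h, sub_neg_eq_add, ← two_smul ℝ X, smul_smul]; simp
  have ext : ∀ S T : Module.End ℝ L, (∀ X, θ X = X → S X = T X) → (∀ X, θ X = -X → S X = T X) →
      S = T := by
    intro S T h1 h2
    refine LinearMap.ext fun X => ?_
    obtain ⟨U, V, hU, hV, rfl⟩ := hθ.exists_decomp X
    rw [map_add, map_add, h1 U hU, h2 V hV]
  have pp : ∀ {X Y}, θ X = -X → θ Y = -Y → θ ⁅X, Y⁆ = ⁅X, Y⁆ := fun h1 h2 => by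
    rw [LieEquiv.map_lie, h1, h2, neg_lie, lie_neg, neg_neg]
  have pk : ∀ {X Y}, θ X = -X → θ Y = Y → θ ⁅X, Y⁆ = -⁅X, Y⁆ := fun h1 h2 => by
    rw [LieEquiv.map_lie, h1, h2, neg_lie]
  have kp : ∀ {X Y}, θ X = X → θ Y = -Y → θ ⁅X, Y⁆ = -⁅X, Y⁆ := fun h1 h2 => by
    rw [LieEquiv.map_lie, h1, h2, lie_neg]
  have kk : ∀ {X Y}, θ X = X → θ Y = Y → θ ⁅X, Y⁆ = ⁅X, Y⁆ := fun h1 h2 => by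
    rw [LieEquiv.map_lie, h1, h2]
  -- For Y in 𝔭₀, ad Y exchanges 𝔨₀ and 𝔭₀, hence interchanges the two projections.
  have aP : ∀ Y, θ Y = -Y → a Y * (1 - P) = P * a Y := fun Y hY => by
    refine ext _ _ (fun X hX => ?_) (fun X hX => ?_)
    · simp only [Module.End.mul_apply, LinearMap.sub_apply, Module.End.one_apply, Pk X hX, sub_zero]
      rw [aX, Pp _ (pk hY hX)]
    · simp only [Module.End.mul_apply, LinearMap.sub_apply, Module.End.one_apply, Pp X hX, sub_self,
        map_zero]
      rw [aX, Pk _ (pp hY hX)]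
  have JP : J * P = J := ext _ _ (fun X hX => by rw [Module.End.mul_apply, Pk X hX, map_zero, hJk X hX])
    (fun X hX => by rw [Module.End.mul_apply, Pp X hX])
  have PJ : P * J = J := ext _ _ (fun X hX => by rw [Module.End.mul_apply, hJk X hX, map_zero])
    (fun X hX => by rw [Module.End.mul_apply, Pp _ (hJp X hX)])
  have a_lie : ∀ X Y, a ⁅X, Y⁆ = a X * a Y - a Y * a X := fun X Y => by
    refine LinearMap.ext fun V => ?_
    simp only [LinearMap.sub_apply, Module.End.mul_apply, aX]
    rw [lie_lie]
  have tr0 : ∀ W, θ W = W → LinearMap.trace ℝ L (P * a W) = 0 := fun W hW => by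
    refine trace_eq_zero_of_skew (B := killingForm ℝ L) hθ.nondeg fun X Y => ?_
    simp only [Module.End.mul_apply, aX, PX, map_smul, map_sub, LinearMap.smul_apply,
      LinearMap.sub_apply]
    rw [hθ.killing_theta_left, LieEquiv.map_lie, hW, killing_lie', killing_lie' W X (θ Y)]
    simp only [smul_eq_mul]; ring
  -- The trace of ad X ad Y splits into a part on 𝔨₀ and a part on 𝔭₀; they differ by tr(P ad[X, Y])
  -- = 0, so each is half of B(X, Y).
  have B2 : ∀ X Y, θ X = -X → θ Y = -Y →
      killingForm ℝ L X Y = 2 * LinearMap.trace ℝ L (P * (a X * a Y)) := fun X Y hX hY => by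
    have h1 : killingForm ℝ L X Y = LinearMap.trace ℝ L (a X * a Y) :=
      LieModule.traceForm_apply_apply ℝ L L X Y
    have h2 : a X * a Y = (a X * a Y) * P + a X * (P * a Y) := by
      rw [← aP Y hY]; noncomm_ring
    have h3 : LinearMap.trace ℝ L (a X * (P * a Y)) = LinearMap.trace ℝ L (P * (a Y * a X)) := by
      rw [LinearMap.trace_mul_comm, mul_assoc]
    have h4 := tr0 ⁅X, Y⁆ (pp hX hY)
    rw [a_lie, mul_sub, map_sub] at h4
    have h5 := congrArg (LinearMap.trace ℝ L) h2
    rw [map_add, h3, LinearMap.trace_mul_comm ℝ (a X * a Y) P] at h5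
    linarith
  -- For V in 𝔭₀ the element [Y, V] lies in 𝔨₀, so J commutes with its adjoint action and [JX, [Y,
  -- V]] = J[X, [Y, V]].
  have BJ : ∀ X Y, θ X = -X → θ Y = -Y →
      killingForm ℝ L (J X) Y = 2 * LinearMap.trace ℝ L (J * (a X * a Y)) := fun X Y hX hY => by
    rw [B2 _ _ (hJp X hX) hY, LinearMap.trace_mul_comm]
    congr 2
    refine ext _ _ (fun V hV => ?_) (fun V hV => ?_)
    · simp only [Module.End.mul_apply, Pk V hV, map_zero, aX]
      rw [hJk _ (pp hX (pk hY hV))]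
    · simp only [Module.End.mul_apply, Pp V hV, aX]
      rw [← lie_skew, ← hJW _ _ (pp hY hV), ← map_neg, lie_skew]
  -- Z represents V ↦ tr(J ad V). Antisymmetrizing `BJ` in X and Y produces tr(J ad[X, Y]), so that
  -- J - Jᵗ = 2 ad Z on 𝔭₀ (`hZJ`). It remains to see that J is skew, that is, S = J + Jᵗ vanishes.
  obtain ⟨Z, hZ⟩ := hθ.exists_killing_eq
    (LinearMap.trace ℝ L ∘ₗ LinearMap.mulLeft ℝ J ∘ₗ (LieAlgebra.ad ℝ L : L →ₗ[ℝ] Module.End ℝ L))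
  replace hZ : ∀ V, killingForm ℝ L Z V = LinearMap.trace ℝ L (J * a V) := hZ
  have Zp : ∀ V, θ V = -V → killingForm ℝ L Z V = 0 := fun V hV => by
    have h1 : a V * P = (1 - P) * a V := by
      have := aP V hV
      rw [mul_sub, mul_one] at this
      rw [sub_mul, one_mul, ← this]; abel
    rw [hZ, ← PJ, mul_assoc, LinearMap.trace_mul_comm, mul_assoc, h1, ← mul_assoc, mul_sub, JP,
      mul_one, sub_self, zero_mul, map_zero]
  have hZk : θ Z = Z := by
    rw [← sub_eq_zero]
    refine hθ.nondeg _ fun V => ?_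
    obtain ⟨U, V, hU, hV, rfl⟩ := hθ.exists_decomp V
    simp only [map_sub, LinearMap.sub_apply, hθ.killing_theta_left, map_add, hU, hV, map_neg, Zp V hV]
    ring
  have hZc : ∀ W, θ W = W → ⁅Z, W⁆ = 0 := fun W hW => by
    refine hθ.nondeg _ fun V => ?_
    have h1 : J * a W = a W * J := LinearMap.ext fun X => hJW W X hW
    rw [killing_lie, hZ, a_lie, mul_sub, map_sub, ← mul_assoc, h1, mul_assoc,
      LinearMap.trace_mul_comm, mul_assoc, sub_self]
  have hZJ : ∀ X Y, θ X = -X → θ Y = -Y →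
      killingForm ℝ L (J X) Y - killingForm ℝ L (J Y) X = 2 * killingForm ℝ L ⁅Z, X⁆ Y := by
    intro X Y hX hY
    rw [BJ X Y hX hY, BJ Y X hY hX, killing_lie, hZ, a_lie, mul_sub, map_sub]
    ring
  refine ⟨Z, hZk, fun X => ?_⟩
  obtain ⟨U, X, hU, hX, rfl⟩ := hθ.exists_decomp X
  rw [lie_add, hZc U hU, map_add, hJk U hU, zero_add, zero_add]
  -- `S = 2 J - A` with `A = 2 ad Z`
  let A : Module.End ℝ L := (2 : ℝ) • a Z
  let S : Module.End ℝ L := (2 : ℝ) • J - A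
  have hA : ∀ X, A X = (2 : ℝ) • ⁅Z, X⁆ := fun X => rfl
  have hS : ∀ X, S X = (2 : ℝ) • J X - A X := fun X => rfl
  have Ap : ∀ X, θ X = -X → θ (A X) = -A X := fun X hX => by
    rw [hA, map_smul, kp hZk hX, smul_neg]
  have Sp : ∀ X, θ X = -X → θ (S X) = -S X := fun X hX => by
    rw [hS, map_sub, map_smul, hJp X hX, Ap X hX, smul_neg]; abel
  have JA : ∀ X, J (A X) = A (J X) := fun X => by rw [hA, hA, map_smul, hJW _ _ hZk]
  have SA : ∀ X, S (A X) = A (S X) := fun X => by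
    rw [hS, hS, map_sub, map_smul, JA]
  have Ssym : ∀ X Y, θ X = -X → θ Y = -Y → killingForm ℝ L (S X) Y = killingForm ℝ L (S Y) X := by
    intro X Y hX hY
    have h1 := hZJ X Y hX hY
    have h2 := hZJ Y X hY hX
    simp only [hS, hA, map_sub, map_smul, LinearMap.sub_apply, LinearMap.smul_apply, smul_eq_mul]
    linarith
  have Askew : ∀ X Y, killingForm ℝ L (A X) Y = - killingForm ℝ L (A Y) X := by
    intro X Y
    simp only [hA, map_smul, LinearMap.smul_apply, smul_eq_mul]
    rw [killing_lie', killing_comm X]; ring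
  have S2 : ∀ X, θ X = -X → S (S X) = -(4 : ℝ) • X - (4 : ℝ) • J (A X) + A (A X) := fun X hX => by
    rw [hS (S X), hS X, map_sub, map_sub, map_smul, map_smul, hJJ X hX, JA]
    module
  have SA' : ∀ X, θ X = -X → S (A X) = -(2 : ℝ) • X - (1 / 2 : ℝ) • A (A X) - (1 / 2 : ℝ) • S (S X) := by
    intro X hX
    rw [S2 X hX, hS]
    module
  -- S is symmetric, A is skew and they commute, so SA is skew. But (S + A)² = 4J² = -4 expresses SA
  -- through 1, A² and S², which are symmetric. Hence SA = 0.
  have SA0 : ∀ X, θ X = -X → S (A X) = 0 := by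
    intro X hX
    have hp := Sp _ (Ap X hX)
    by_contra h0
    have h1 := hθ.pos_of_p hp h0
    have sk : ∀ Y, θ Y = -Y → killingForm ℝ L (S (A X)) Y = - killingForm ℝ L (S (A Y)) X := by
      intro Y hY
      rw [Ssym _ _ (Ap X hX) hY, killing_comm, Askew, ← SA]
    have sy : ∀ Y, θ Y = -Y → killingForm ℝ L (S (A X)) Y = killingForm ℝ L (S (A Y)) X := by
      intro Y hY
      rw [SA' X hX, SA' Y hY]
      have e1 := Ssym (S X) Y (Sp X hX) hY
      have e2 := Ssym (S Y) X (Sp Y hY) hX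
      have e3 := killing_comm (S X) (S Y)
      have e4 := Askew (A X) Y
      have e5 := Askew (A Y) X
      have e6 := killing_comm (A X) (A Y)
      have e7 := killing_comm X Y
      simp only [map_sub, map_smul, LinearMap.sub_apply, LinearMap.smul_apply, smul_eq_mul]
      linarith
    have := sk _ hp
    have := sy _ hp
    linarith
  -- Now S² = -4 - A² and so S³ = -4S. Pairing with SX gives B(S²X, S²X) = -4 B(SX, SX), impossible
  -- for SX ≠ 0 because B is positive on 𝔭₀.
  have SX : S X = 0 := by
    by_contra h0
    have h1 := hθ.pos_of_p (Sp X hX) h0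
    have h2 := hθ.nonneg_of_p (Sp _ (Sp X hX))
    have h3 : S (S (S X)) = -(4 : ℝ) • S X := by
      have e1 := SA0 X hX
      have e2 : (2 : ℝ) • J (A X) = A (A X) := by
        have := hS (A X); rw [e1] at this; exact (sub_eq_zero.1 this.symm)
      have e3 : S (S X) = -(4 : ℝ) • X - A (A X) := by
        rw [S2 X hX, ← e2]; module
      rw [e3, map_sub, map_smul, SA0 _ (Ap X hX), sub_zero]
    have h4 := Ssym (S (S X)) (S X) (Sp _ (Sp X hX)) (Sp X hX)
    rw [h3] at h4
    simp only [map_smul, LinearMap.smul_apply, smul_eq_mul] at h4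
    linarith
  rw [hS, hA, ← smul_sub, smul_eq_zero] at SX
  exact (sub_eq_zero.1 (SX.resolve_left two_ne_zero)).symm

end IsCartanInv

end RealAlgebra

/-! ### The real root: the centralizer of 𝔟₀ and its 𝔰𝔩₂-triple. -/

section RealAlgebra

/-- The spectral theorem for an endomorphism that is symmetric for a positive definite form. -/
lemma iSup_eigenspace_eq_top_of_symm {V : Type*} [AddCommGroup V] [Module ℝ V]
    [FiniteDimensional ℝ V] (β : LinearMap.BilinForm ℝ V) (hsymm : ∀ X Y, β X Y = β Y X)
    (hpos : ∀ X, X ≠ 0 → 0 < β X X) {T : Module.End ℝ V} (hT : ∀ X Y, β (T X) Y = β X (T Y)) :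
    ⨆ μ : ℝ, Module.End.eigenspace T μ = ⊤ := by
  let core : InnerProductSpace.Core ℝ V :=
    { inner := fun X Y => β X Y
      conj_inner_symm := fun X Y => by simpa using hsymm Y X
      re_inner_nonneg := fun X => by
        by_cases h : X = 0
        · simp [h]
        · simpa using (hpos X h).le
      add_left := fun X Y Z => by simp
      smul_left := fun X Y r => by simp
      definite := fun X h => by
        by_contra h0
        exact (hpos X h0).ne' h }
  let _ : NormedAddCommGroup V := core.toNormedAddCommGroup
  let _ : InnerProductSpace ℝ V := InnerProductSpace.ofCore core.toCore
  have hs : T.IsSymmetric := fun X Y => hT X Y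
  have h := hs.orthogonalComplement_iSup_eigenspaces_eq_bot
  exact (Submodule.orthogonal_eq_bot_iff).1 h

variable {L : Type*} [LieRing L] [LieAlgebra ℝ L] [FiniteDimensional ℝ L]

/-- `𝔥` is a `θ`-stable maximal toral subalgebra with split part `ℝ H₀`. -/
structure SplitRankOne (θ : L ≃ₗ⁅ℝ⁆ L) (𝔥 : LieSubalgebra ℝ L) (H₀ : L) : Prop where
  abelian : ∀ H ∈ 𝔥, ∀ H' ∈ 𝔥, ⁅H, H'⁆ = 0
  self_centralizing : ∀ X, (∀ H ∈ 𝔥, ⁅H, X⁆ = 0) → X ∈ 𝔥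
  stable : ∀ H ∈ 𝔥, θ H ∈ 𝔥
  mem : H₀ ∈ 𝔥
  theta : θ H₀ = -H₀
  ne_zero : H₀ ≠ 0
  rank_one : ∀ H ∈ 𝔥, θ H = -H → ∃ c : ℝ, H = c • H₀

namespace SplitRankOne

variable {θ : L ≃ₗ⁅ℝ⁆ L} (hθ : IsCartanInv θ)

-- Definiteness of B(X, θX) makes the Killing form nondegenerate, so the Cartan subalgebra is
-- abelian; it contains its centralizer because it is self-normalizing.
omit [FiniteDimensional ℝ L] in
include hθ in
lemma of_cartan [FiniteDimensional ℝ L] {𝔥 : LieSubalgebra ℝ L} [𝔥.IsCartanSubalgebra] {H₀ : L}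
    (hst : ∀ H ∈ 𝔥, θ H ∈ 𝔥) (hmem : H₀ ∈ 𝔥) (hH : θ H₀ = -H₀) (h0 : H₀ ≠ 0)
    (hone : ∀ H ∈ 𝔥, θ H = -H → ∃ c : ℝ, H = c • H₀) : SplitRankOne θ 𝔥 H₀ := by
  have : LieAlgebra.IsKilling ℝ L := ⟨by
    rw [eq_bot_iff]
    intro X hX
    rw [LieIdeal.mem_killingCompl] at hX
    refine (LieSubmodule.mem_bot _).2 (hθ.nondeg X fun Y => ?_)
    rw [IsCartanInv.killing_comm]
    exact hX Y (LieSubmodule.mem_top _)⟩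
  refine ⟨fun H hH H' hH' => ?_, fun X hX => ?_, hst, hmem, hH, h0, hone⟩
  · have := trivial_lie_zero 𝔥 𝔥 ⟨H, hH⟩ ⟨H', hH'⟩
    exact congrArg Subtype.val this
  · rw [← LieSubalgebra.IsCartanSubalgebra.self_normalizing (H := 𝔥),
      LieSubalgebra.mem_normalizer_iff']
    intro Y hY
    rw [hX Y hY]
    exact zero_mem _

variable {𝔥 : LieSubalgebra ℝ L} {H₀ : L} (h𝔥 : SplitRankOne θ 𝔥 H₀)

variable (θ 𝔥) in
/-- The centralizer of `𝔟₀`. -/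
def centB : Submodule ℝ L where
  carrier := {X | ∀ b ∈ 𝔥, θ b = b → ⁅b, X⁆ = 0}
  add_mem' hX hY b hb hb' := by rw [lie_add, hX b hb hb', hY b hb hb', add_zero]
  zero_mem' b _ _ := lie_zero b
  smul_mem' c X hX b hb hb' := by rw [lie_smul, hX b hb hb', smul_zero]

omit [FiniteDimensional ℝ L] in
lemma centB_lie {X Y : L} (hX : X ∈ centB θ 𝔥) (hY : Y ∈ centB θ 𝔥) : ⁅X, Y⁆ ∈ centB θ 𝔥 := by
  intro b hb hb'
  rw [leibniz_lie, hX b hb hb', hY b hb hb', zero_lie, lie_zero, add_zero]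

omit [FiniteDimensional ℝ L] in
lemma centB_theta {X : L} (hX : X ∈ centB θ 𝔥) : θ X ∈ centB θ 𝔥 := by
  intro b hb hb'
  rw [← hb', ← LieEquiv.map_lie, hX b hb hb', map_zero]

include h𝔥

omit [FiniteDimensional ℝ L] in
lemma mem_centB : H₀ ∈ centB θ 𝔥 := fun b hb _ => h𝔥.abelian b hb H₀ h𝔥.mem

-- By rank one, 𝔥₀ = 𝔟₀ ⊕ ℝH₀, so X centralizes all of 𝔥₀.
omit [FiniteDimensional ℝ L] in
include hθ in
lemma mem_of_centB {X : L} (hX : X ∈ centB θ 𝔥) (h0 : ⁅H₀, X⁆ = 0) : X ∈ 𝔥 := by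
  refine h𝔥.self_centralizing X fun H hH => ?_
  have hp : θ ((1 / 2 : ℝ) • (H - θ H)) = -((1 / 2 : ℝ) • (H - θ H)) := by
    rw [map_smul, map_sub, hθ.involutive, ← smul_neg, neg_sub]
  have hk : θ ((1 / 2 : ℝ) • (H + θ H)) = (1 / 2 : ℝ) • (H + θ H) := by
    rw [map_smul, map_add, hθ.involutive, add_comm]
  obtain ⟨c, hc⟩ := h𝔥.rank_one _ (𝔥.smul_mem _ (sub_mem hH (h𝔥.stable H hH))) hp
  have e : H = (1 / 2 : ℝ) • (H + θ H) + c • H₀ := by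
    rw [← hc]; module
  rw [e, add_lie, hX _ (𝔥.smul_mem _ (add_mem hH (h𝔥.stable H hH))) hk, smul_lie, h0, smul_zero,
    add_zero]

omit [FiniteDimensional ℝ L] in
include hθ in
lemma killing_pos : 0 < killingForm ℝ L H₀ H₀ := hθ.pos_of_p h𝔥.theta h𝔥.ne_zero

omit [FiniteDimensional ℝ L] in
lemma lie_theta {X : L} {l : ℝ} (hX : ⁅H₀, X⁆ = l • X) : ⁅H₀, θ X⁆ = (-l) • θ X := by
  have : ⁅θ H₀, θ X⁆ = l • θ X := by rw [← LieEquiv.map_lie, hX, map_smul]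
  rw [h𝔥.theta, neg_lie] at this
  rw [neg_smul, ← this, neg_neg]

omit h𝔥 [FiniteDimensional ℝ L] in
lemma lie_lie_weight {X Y : L} {l m : ℝ} (hX : ⁅H₀, X⁆ = l • X) (hY : ⁅H₀, Y⁆ = m • Y) :
    ⁅H₀, ⁅X, Y⁆⁆ = (l + m) • ⁅X, Y⁆ := by
  rw [leibniz_lie, hX, hY, smul_lie, lie_smul, add_smul]

omit [FiniteDimensional ℝ L] in
lemma orthogonal_of_ne {X Y : L} {l m : ℝ} (hX : ⁅H₀, X⁆ = l • X) (hY : ⁅H₀, Y⁆ = m • Y)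
    (hlm : l ≠ m) : killingForm ℝ L X (θ Y) = 0 := by
  have h1 := h𝔥.lie_theta hY
  have h2 := IsCartanInv.killing_lie' H₀ X (θ Y)
  rw [hX, h1] at h2
  simp only [map_smul, LinearMap.smul_apply, smul_eq_mul] at h2
  have : (l - m) * killingForm ℝ L X (θ Y) = 0 := by linarith
  exact (mul_eq_zero.1 this).resolve_left (sub_ne_zero.2 hlm)

omit [FiniteDimensional ℝ L] in
include hθ in
/-- For two vectors of the same weight in the centralizer of `𝔟₀`, the bracket `[u, θ v]` is
determined by the Killing form. -/
lemma exists_lie_theta {u v : L} {l : ℝ} (hu : u ∈ centB θ 𝔥) (hv : v ∈ centB θ 𝔥)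
    (hu' : ⁅H₀, u⁆ = l • u) (hv' : ⁅H₀, v⁆ = l • v) :
    ∃ c : ℝ, ⁅u, θ v⁆ = c • H₀ ∧ c * killingForm ℝ L H₀ H₀ = l * killingForm ℝ L u (θ v) := by
  have hw : ⁅u, θ v⁆ ∈ 𝔥 := by
    refine h𝔥.mem_of_centB hθ (centB_lie hu (centB_theta hv)) ?_
    rw [lie_lie_weight hu' (h𝔥.lie_theta hv'), add_neg_cancel, zero_smul]
  set w := ⁅u, θ v⁆ with hwdef
  have hk : θ (w + θ w) = w + θ w := by rw [map_add, hθ.involutive, add_comm]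
  have hkm : w + θ w ∈ 𝔥 := add_mem hw (h𝔥.stable w hw)
  -- B(w, b) = B(u, [θv, b]) = 0 for b in 𝔟₀. Applied to b = w + θw, definiteness on 𝔨₀ leaves w
  -- only a component in 𝔞₀.
  have h1 : killingForm ℝ L w (w + θ w) = 0 := by
    rw [hwdef, IsCartanInv.killing_lie, ← lie_skew, centB_theta hv _ hkm hk, neg_zero, map_zero]
  have h2 : w + θ w = 0 := by
    by_contra h0
    have := hθ.posDef _ h0
    rw [hk] at this
    rw [LinearMap.map_add₂, hθ.killing_theta_left w, hk, h1] at this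
    simp at this
  obtain ⟨c, hc⟩ := h𝔥.rank_one w hw (by rw [eq_neg_iff_add_eq_zero, add_comm]; exact h2)
  refine ⟨c, hc, ?_⟩
  have h3 : killingForm ℝ L w H₀ = l * killingForm ℝ L u (θ v) := by
    rw [hwdef, IsCartanInv.killing_lie, ← lie_skew, h𝔥.lie_theta hv']
    simp
  rw [← h3, hc]; simp

-- If the bracket vanished, the Jacobi identity would give B([[u, θu], v], θv) = B([u, v], θ[u, v])
-- ≤ 0. But [u, θu] is a negative multiple of H₀, which makes the left side positive.
omit [FiniteDimensional ℝ L] in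
include hθ in
lemma lie_ne_zero {u v : L} {l m : ℝ} (hl : 0 < l) (hm : 0 < m) (hu : u ∈ centB θ 𝔥)
    (hu' : ⁅H₀, u⁆ = l • u) (hv' : ⁅H₀, v⁆ = m • v) (hu0 : u ≠ 0) (hv0 : v ≠ 0) :
    ⁅u, ⁅θ u, v⁆⁆ ≠ 0 := by
  intro h
  obtain ⟨c, hc, hc'⟩ := h𝔥.exists_lie_theta hθ hu hu hu' hu'
  have hpos := h𝔥.killing_pos hθ
  have h1 := hθ.posDef u hu0
  have h2 := hθ.posDef v hv0
  have hcneg : c < 0 := by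
    by_contra hcn
    have : 0 ≤ c * killingForm ℝ L H₀ H₀ := mul_nonneg (not_lt.1 hcn) hpos.le
    have : l * killingForm ℝ L u (θ u) < 0 := mul_neg_of_pos_of_neg hl (by linarith)
    linarith
  have h3 : killingForm ℝ L ⁅⁅u, θ u⁆, v⁆ (θ v) = killingForm ℝ L ⁅u, v⁆ (θ ⁅u, v⁆) := by
    rw [lie_lie, h, zero_sub, map_neg, LinearMap.neg_apply, IsCartanInv.killing_lie', neg_neg,
      LieEquiv.map_lie]
  have h4 := hθ.killing_theta_nonpos ⁅u, v⁆
  rw [hc, smul_lie, hv'] at h3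
  simp only [map_smul, LinearMap.smul_apply, smul_eq_mul] at h3
  have : 0 < c * (m * killingForm ℝ L v (θ v)) :=
    mul_pos_of_neg_of_neg hcneg (mul_neg_of_pos_of_neg hm (by linarith))
  linarith

omit h𝔥 in
lemma finite_weights (H₀ : L) : {l : ℝ | ∃ u : L, u ≠ 0 ∧ ⁅H₀, u⁆ = l • u}.Finite := by
  refine (Module.End.finite_hasEigenvalue (LieAlgebra.ad ℝ L H₀)).subset ?_
  rintro l ⟨u, hu0, hu⟩
  exact Module.End.hasEigenvalue_of_hasEigenvector (x := u)
    ⟨Module.End.mem_eigenspace_iff.2 hu, hu0⟩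

include hθ in
/-- The positive weight space of the centralizer of `𝔟₀` is at most one-dimensional. -/
theorem exists_smul_eq {e v : L} {r m : ℝ} (hr : 0 < r) (he : e ∈ centB θ 𝔥) (he0 : e ≠ 0)
    (he' : ⁅H₀, e⁆ = r • e) (hm : 0 < m) (hv : v ∈ centB θ 𝔥) (hv' : ⁅H₀, v⁆ = m • v) :
    ∃ t : ℝ, v = t • e := by
  -- a vector `u` of the smallest positive weight
  obtain ⟨l, ⟨hl, u, hu, hu0, hu'⟩, hmin⟩ := Set.exists_min_image
    {l : ℝ | 0 < l ∧ ∃ u ∈ centB θ 𝔥, u ≠ 0 ∧ ⁅H₀, u⁆ = l • u} id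
    ((finite_weights H₀).subset fun l hl => ⟨hl.2.choose, hl.2.choose_spec.2⟩)
    ⟨r, hr, e, he, he0, he'⟩
  have huu : killingForm ℝ L u (θ u) ≠ 0 := by
    have := hθ.posDef u hu0
    intro h; rw [h] at this; simp at this
  have hsub : ∀ w ∈ centB θ 𝔥, ∀ k : ℝ, ⁅H₀, w⁆ = k • w → (∀ x ∈ centB θ 𝔥, x ≠ 0 →
      ⁅H₀, x⁆ = k • x → killingForm ℝ L x (θ u) ≠ 0) → ∃ t : ℝ, w = t • u := by
    intro w hw k hw' hx
    by_cases h0 : killingForm ℝ L w (θ u) = 0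
    · refine ⟨0, ?_⟩
      by_contra hne
      rw [zero_smul] at hne
      exact hx w hw hne hw' h0
    · have hkl : k = l := by
        by_contra hkl
        exact h0 (h𝔥.orthogonal_of_ne hw' hu' hkl)
      refine ⟨killingForm ℝ L w (θ u) / killingForm ℝ L u (θ u), ?_⟩
      rw [← sub_eq_zero]
      by_contra hne
      refine hx _ (sub_mem hw (Submodule.smul_mem _ _ hu)) hne ?_ ?_
      · rw [lie_sub, lie_smul, hw', hu', hkl, smul_sub, smul_comm]
      · rw [map_sub, map_smul, LinearMap.sub_apply, LinearMap.smul_apply, smul_eq_mul,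
          div_mul_cancel₀ _ huu, sub_self]
  -- Let x be a counterexample of least weight. Then [u, [θu, x]] = 0, against `lie_ne_zero`: if x
  -- has the weight of u, then [θu, x] = 0 by orthogonality; otherwise [θu, x] has a smaller
  -- positive weight, so by minimality it is a multiple of u.
  have hempty : ∀ k : ℝ, 0 < k → ∀ x ∈ centB θ 𝔥, x ≠ 0 → ⁅H₀, x⁆ = k • x →
      killingForm ℝ L x (θ u) ≠ 0 := by
    by_contra! hex
    obtain ⟨k₀, hk₀, x₀, hx₀, hx₀0, hx₀', hx₀u⟩ := hex
    obtain ⟨k, ⟨hk, x, hx, hx0, hx', hxu⟩, hkmin⟩ := Set.exists_min_image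
      {l : ℝ | 0 < l ∧ ∃ u' ∈ centB θ 𝔥, u' ≠ 0 ∧ ⁅H₀, u'⁆ = l • u' ∧
        killingForm ℝ L u' (θ u) = 0} id
      ((finite_weights H₀).subset fun l hl =>
        ⟨hl.2.choose, hl.2.choose_spec.2.1, hl.2.choose_spec.2.2.1⟩)
      ⟨k₀, hk₀, x₀, hx₀, hx₀0, hx₀', hx₀u⟩
    refine h𝔥.lie_ne_zero hθ hl hk hu hu' hx' hu0 hx0 ?_
    have hlk : l ≤ k := hmin k ⟨hk, x, hx, hx0, hx'⟩
    have hy' : ⁅H₀, ⁅θ u, x⁆⁆ = (-l + k) • ⁅θ u, x⁆ := lie_lie_weight (h𝔥.lie_theta hu') hx'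
    rcases hlk.eq_or_lt with hlk | hlk
    · subst hlk
      obtain ⟨c, hc, hc'⟩ := h𝔥.exists_lie_theta hθ hx hu hx' hu'
      rw [hxu, mul_zero] at hc'
      have hc0 : c = 0 := (mul_eq_zero.1 hc').resolve_right (h𝔥.killing_pos hθ).ne'
      rw [← lie_skew (θ u) x, hc, hc0, zero_smul, neg_zero, lie_zero]
    · obtain ⟨t, ht⟩ := hsub _ (centB_lie (centB_theta hu) hx) _ hy' (by
        intro z hz hz0 hz' hzu
        have := hkmin _ ⟨by linarith, z, hz, hz0, hz', hzu⟩
        simp only [id] at this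
        linarith)
      rw [ht, lie_smul, lie_self, smul_zero]
  obtain ⟨t, ht⟩ := hsub v hv m hv' (hempty m hm)
  obtain ⟨s, hs⟩ := hsub e he r he' (hempty r hr)
  have hs0 : s ≠ 0 := by
    rintro rfl
    exact he0 (by rw [hs, zero_smul])
  refine ⟨t / s, ?_⟩
  rw [ht, hs, smul_smul, div_mul_cancel₀ _ hs0]

include hθ in
/-- The centralizer of `𝔟₀` is spanned by `𝔥₀` and the real root spaces. -/
theorem exists_decomp_centB {e : L} {r : ℝ} (hr : 0 < r) (he : e ∈ centB θ 𝔥) (he0 : e ≠ 0)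
    (he' : ⁅H₀, e⁆ = r • e) {X : L} (hX : X ∈ centB θ 𝔥) :
    ∃ H ∈ 𝔥, ∃ s t : ℝ, X = H + s • e + t • θ e := by
  let C := centB θ 𝔥
  let T : Module.End ℝ C := (LieAlgebra.ad ℝ L H₀ : Module.End ℝ L).restrict
    (fun X hX => centB_lie h𝔥.mem_centB hX)
  have hTX : ∀ X : C, ((T X : C) : L) = ⁅H₀, (X : L)⁆ := fun X => rfl
  let β : LinearMap.BilinForm ℝ C :=
    -((killingForm ℝ L).compl₁₂ C.subtype ((θ.toLinearEquiv : L →ₗ[ℝ] L) ∘ₗ C.subtype))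
  have hβ : ∀ X Y : C, β X Y = -(killingForm ℝ L (X : L) (θ Y)) := fun X Y => rfl
  -- ad H₀ is symmetric for the positive definite form -B(X, θY), so the centralizer is spanned by
  -- weight vectors. Weight zero lies in 𝔥₀, positive weights on the line of e, and θ reverses the
  -- sign.
  have htop := iSup_eigenspace_eq_top_of_symm β
    (fun X Y => by rw [hβ, hβ, ← hθ.killing_theta_left, IsCartanInv.killing_comm])
    (fun X hX => by
      rw [hβ]; exact hθ.posDef _ (fun h => hX (Subtype.ext h)))
    (T := T) (fun X Y => by
      rw [hβ, hβ, hTX, hTX, IsCartanInv.killing_lie', LieEquiv.map_lie, h𝔥.theta, neg_lie, map_neg])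
  let W : Submodule ℝ L := 𝔥.toSubmodule ⊔ (ℝ ∙ e) ⊔ (ℝ ∙ (θ e))
  have hle : ∀ μ : ℝ, (Module.End.eigenspace T μ) ≤ W.comap C.subtype := by
    intro μ Y hY
    have hY' : ⁅H₀, (Y : L)⁆ = μ • (Y : L) := by
      rw [Module.End.mem_eigenspace_iff] at hY
      rw [← hTX, hY]; rfl
    rw [Submodule.mem_comap]
    rcases lt_trichotomy μ 0 with h | h | h
    · obtain ⟨t, ht⟩ := h𝔥.exists_smul_eq hθ hr he he0 he' (neg_pos.2 h) (centB_theta Y.2)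
        (h𝔥.lie_theta hY')
      have : (Y : L) = t • θ e := by rw [← map_smul, ← ht, hθ.involutive]
      rw [Submodule.subtype_apply, this]
      exact Submodule.mem_sup_right (Submodule.smul_mem _ _ (Submodule.mem_span_singleton_self _))
    · rw [h, zero_smul] at hY'
      exact Submodule.mem_sup_left (Submodule.mem_sup_left (h𝔥.mem_of_centB hθ Y.2 hY'))
    · obtain ⟨t, ht⟩ := h𝔥.exists_smul_eq hθ hr he he0 he' h Y.2 hY'
      rw [Submodule.subtype_apply, ht]
      exact Submodule.mem_sup_left (Submodule.mem_sup_right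
        (Submodule.smul_mem _ _ (Submodule.mem_span_singleton_self _)))
  have hmem : (⟨X, hX⟩ : C) ∈ W.comap C.subtype := by
    have : (⟨X, hX⟩ : C) ∈ ⨆ μ : ℝ, Module.End.eigenspace T μ := by rw [htop]; trivial
    exact (iSup_le hle) this
  have hXW : X ∈ W := hmem
  obtain ⟨Y, hY, Z, hZ, rfl⟩ := Submodule.mem_sup.1 hXW
  obtain ⟨H, hH, Y', hY', rfl⟩ := Submodule.mem_sup.1 hY
  obtain ⟨s, rfl⟩ := Submodule.mem_span_singleton.1 hY'
  obtain ⟨t, rfl⟩ := Submodule.mem_span_singleton.1 hZ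
  exact ⟨H, hH, s, t, rfl⟩

include hθ in
/-- The `𝔰𝔩₂`-triple of the real root, and the position of the complex structure `Z`. -/
theorem exists_sl2 {Z : L} (hZ : θ Z = Z) (hZk : ∀ W, θ W = W → ⁅Z, W⁆ = 0)
    (hZp : ∀ X, θ X = -X → ⁅Z, ⁅Z, X⁆⁆ = -X) {e₀ : L} {r : ℝ} (hr : 0 < r)
    (he : e₀ ∈ centB θ 𝔥) (he0 : e₀ ≠ 0) (he' : ⁅H₀, e₀⁆ = r • e₀) :
    ∃ e b : L, ∃ c : ℝ, c ≠ 0 ∧ (∃ a : ℝ, e = a • e₀ ∧ a ≠ 0) ∧ c * r = 2 ∧ b ∈ 𝔥 ∧ θ b = b ∧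
      ⁅e, -θ e⁆ = c • H₀ ∧ ⁅c • H₀, e⁆ = (2 : ℝ) • e ∧ ⁅b, e⁆ = 0 ∧ ⁅b, θ e⁆ = 0 ∧
      Z = b + (1 / 2 : ℝ) • (e + θ e) := by
  obtain ⟨c₀, hc₀, hc₀'⟩ := h𝔥.exists_lie_theta hθ he he he' he'
  have hpos := h𝔥.killing_pos hθ
  have h1 := hθ.posDef e₀ he0
  have hcneg : c₀ < 0 := by
    by_contra hcn
    have : 0 ≤ c₀ * killingForm ℝ L H₀ H₀ := mul_nonneg (not_lt.1 hcn) hpos.le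
    have : r * killingForm ℝ L e₀ (θ e₀) < 0 := mul_neg_of_pos_of_neg hr (by linarith)
    linarith
  have hZC : Z ∈ centB θ 𝔥 := fun b hb hb' => by rw [← lie_skew, hZk b hb', neg_zero]
  obtain ⟨H, hH, s, t, hZe⟩ := h𝔥.exists_decomp_centB hθ hr he he0 he' hZC
  set b := (1 / 2 : ℝ) • (H + θ H) with hb
  have hbm : b ∈ 𝔥 := 𝔥.smul_mem _ (add_mem hH (h𝔥.stable H hH))
  have hbt : θ b = b := by rw [hb, map_smul, map_add, hθ.involutive, add_comm]
  set u := (s + t) / 2 with hu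
  have hZ2 : Z = b + u • (e₀ + θ e₀) := by
    have h2 : Z = (1 / 2 : ℝ) • (Z + θ Z) := by rw [hZ]; module
    rw [h2, hZe]
    simp only [map_add, map_smul, hθ.involutive]
    rw [hb, hu]; module
  have hbe : ⁅b, e₀⁆ = 0 := he b hbm hbt
  have hbf : ⁅b, θ e₀⁆ = 0 := centB_theta he b hbm hbt
  have hbH : ⁅b, H₀⁆ = 0 := h𝔥.abelian b hbm H₀ h𝔥.mem
  have hf' := h𝔥.lie_theta he'
  have heH : ⁅e₀, H₀⁆ = (-r) • e₀ := by rw [← lie_skew, he', neg_smul]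
  have hfH : ⁅θ e₀, H₀⁆ = r • θ e₀ := by rw [← lie_skew, hf', neg_smul, neg_neg]
  have hfe : ⁅θ e₀, e₀⁆ = -(c₀ • H₀) := by rw [← lie_skew, hc₀]
  -- The relation [Z, [Z, H₀]] = -H₀ determines u², and in particular u ≠ 0.
  have hu2 : u * u * (2 * r * -c₀) = 1 := by
    have h3 := hZp H₀ h𝔥.theta
    rw [hZ2] at h3
    simp only [add_lie, smul_lie, lie_add, lie_smul, hbe, hbf, hbH, heH, hfH, hc₀, hfe, lie_self,
      zero_add, add_zero] at h3
    have h4 : (u * u * (2 * r * -c₀) - 1) • H₀ = 0 := by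
      have h5 : (u * u * (2 * r * -c₀)) • H₀ = H₀ := by
        rw [← neg_eq_iff_eq_neg] at h3
        conv_rhs => rw [← h3]
        module
      rw [sub_smul, h5, one_smul, sub_self]
    have := (smul_eq_zero.1 h4).resolve_right h𝔥.ne_zero
    linarith
  -- The factor 2u turns u(e₀ + θe₀) into (e + θe)/2; then [e, -θe] = -(2u)²c₀ H₀, and `hu2` is the
  -- normalization c r = 2.
  refine ⟨(2 * u) • e₀, b, 2 * u * (2 * u) * -c₀, ?_, ⟨2 * u, rfl, ?_⟩, by linarith, hbm, hbt, ?_, ?_,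
    ?_, ?_, ?_⟩
  · rintro h
    have : u * u * (2 * r * -c₀) = 2 * u * (2 * u) * -c₀ * r / 2 := by ring
    rw [this, h] at hu2
    norm_num at hu2
  · intro h
    have : u = 0 := by linarith
    rw [this] at hu2
    norm_num at hu2
  · rw [map_smul, lie_neg, smul_lie, lie_smul, hc₀]; module
  · rw [smul_lie, lie_smul, he', smul_smul, smul_smul, smul_smul]
    congr 1
    linear_combination (4 * u) * hu2
  · rw [lie_smul, hbe, smul_zero]
  · rw [map_smul, lie_smul, hbf, smul_zero]
  · rw [hZ2, map_smul]; module

end SplitRankOne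

end RealAlgebra

/-! ### Cayley transforms and the joint eigenspaces. -/

section ComplexAlgebra

open Complex

/-- If `[D, E] = c E` with `c ≠ 0` then `E` is nilpotent. -/
lemma isNilpotent_of_commutator {V : Type*} [AddCommGroup V] [Module ℂ V] [FiniteDimensional ℂ V]
    {D E : Module.End ℂ V} {c : ℂ} (hc : c ≠ 0) (h : D * E - E * D = c • E) : IsNilpotent E := by
  by_contra hn
  -- Each E ^ k is an eigenvector of [D, ·] for kc. Were no power zero, there would be infinitely
  -- many eigenvalues.
  have hk : ∀ k : ℕ, D * E ^ k - E ^ k * D = (k * c) • E ^ k := by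
    intro k
    induction k with
    | zero => simp
    | succ k ih =>
      have : D * E ^ (k + 1) - E ^ (k + 1) * D =
          (D * E ^ k - E ^ k * D) * E + E ^ k * (D * E - E * D) := by
        rw [pow_succ]; noncomm_ring
      rw [this, ih, h, smul_mul_assoc, mul_smul_comm, ← pow_succ, ← add_smul]
      push_cast; ring_nf
  let T : Module.End ℂ (Module.End ℂ V) := LinearMap.mulLeft ℂ D - LinearMap.mulRight ℂ D
  have hinf : Set.Infinite {μ | T.HasEigenvalue μ} := by
    refine Set.infinite_of_injective_forall_mem (f := fun k : ℕ => (k : ℂ) * c) ?_ fun k => ?_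
    · intro k l hkl
      exact_mod_cast mul_right_cancel₀ hc hkl
    · refine Module.End.hasEigenvalue_of_hasEigenvector (x := E ^ k)
        ⟨Module.End.mem_eigenspace_iff.2 (hk k), fun h0 => hn ⟨k, h0⟩⟩
  exact hinf T.finite_hasEigenvalue

variable {𝔤 : Type*} [LieRing 𝔤] [LieAlgebra ℂ 𝔤]

/-- The exponential of a nilpotent inner derivation. -/
lemma exists_exp_ad {x : 𝔤} (hx : IsNilpotent (LieAlgebra.ad ℂ 𝔤 x)) :
    ∃ φ : 𝔤 ≃ₗ⁅ℂ⁆ 𝔤, (∀ y, ⁅x, y⁆ = 0 → φ y = y) ∧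
      (∀ y, ⁅x, ⁅x, y⁆⁆ = 0 → φ y = y + ⁅x, y⁆) ∧
      (∀ y, ⁅x, ⁅x, ⁅x, y⁆⁆⁆ = 0 → φ y = y + ⁅x, y⁆ + (1 / 2 : ℂ) • ⁅x, ⁅x, y⁆⁆) ∧
      ∀ T : Module.End ℂ 𝔤, (∀ y, T ⁅x, y⁆ = ⁅x, T y⁆) → ∀ y, φ (T y) = T (φ y) := by
  -- The exponential of a nilpotent derivation is taken over ℚ, so 𝔤 gets the rational structure
  -- inherited from ℂ.
  let _ : Module ℚ 𝔤 := Module.compHom 𝔤 (algebraMap ℚ ℂ)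
  let _ : LieAlgebra ℚ 𝔤 := { lie_smul := fun t y z => lie_smul (algebraMap ℚ ℂ t) y z }
  have hq : ∀ (q : ℚ) (y : 𝔤), q • y = (q : ℂ) • y := fun q y => rfl
  have hD : (LieDerivation.ad ℂ 𝔤 x).toLinearMap = LieAlgebra.ad ℂ 𝔤 x :=
    LinearMap.ext fun y => by simp
  have hn : IsNilpotent (LieDerivation.ad ℂ 𝔤 x).toLinearMap := by rw [hD]; exact hx
  have hφ : ∀ y, LieDerivation.exp _ hn y = IsNilpotent.exp (LieAlgebra.ad ℂ 𝔤 x) y := fun y => by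
    rw [← hD]; rfl
  have hsum : ∀ (k : ℕ) (y : 𝔤), ((LieAlgebra.ad ℂ 𝔤 x) ^ k) y = 0 → LieDerivation.exp _ hn y =
      ∑ i ∈ Finset.range k, (i.factorial : ℚ)⁻¹ • ((LieAlgebra.ad ℂ 𝔤 x) ^ i) y := by
    intro k y hy
    rw [hφ]
    exact IsNilpotent.exp_smul_eq_sum (A := Module.End ℂ 𝔤) hy hx
  refine ⟨LieDerivation.exp _ hn, fun y hy => ?_, fun y hy => ?_, fun y hy => ?_, fun T hT y => ?_⟩
  · rw [hsum 1 y (by simpa using hy)]; simp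
  · rw [hsum 2 y (by simpa [pow_succ] using hy)]; simp [Finset.sum_range_succ]
  · rw [hsum 3 y (by simpa [pow_succ] using hy)]; simp [Finset.sum_range_succ, pow_succ, hq]
  · rw [hφ, hφ]
    have hc : Commute T (LieAlgebra.ad ℂ 𝔤 x) := LinearMap.ext fun y => hT y
    obtain ⟨k, hk⟩ := hx
    rw [IsNilpotent.exp_eq_sum hk]
    simp only [LinearMap.sum_apply, map_sum]
    refine Finset.sum_congr rfl fun i _ => ?_
    have := congrArg (fun S : Module.End ℂ 𝔤 => S y) (hc.pow_right i).eq
    simp only [Module.End.mul_apply] at this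
    simp only [LinearMap.smul_apply, hq, map_smul]
    rw [← this]

variable [FiniteDimensional ℂ 𝔤]

/-- The Cayley transform of an `𝔰𝔩₂`-triple. -/
lemma exists_cayley {e f h : 𝔤} (hef : ⁅e, f⁆ = h) (he : ⁅h, e⁆ = (2 : ℂ) • e)
    (hf : ⁅h, f⁆ = -(2 : ℂ) • f) {x : ℂ} (hx : x * x = -1) :
    ∃ c : 𝔤 ≃ₗ⁅ℂ⁆ 𝔤, c h = -x • (e - f) ∧ (∀ y, ⁅e, y⁆ = 0 → ⁅f, y⁆ = 0 → c y = y) ∧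
      ∀ T : Module.End ℂ 𝔤, (∀ y, T ⁅e, y⁆ = ⁅e, T y⁆) → (∀ y, T ⁅f, y⁆ = ⁅f, T y⁆) →
        ∀ y, c (T y) = T (c y) := by
  have hne : IsNilpotent (LieAlgebra.ad ℂ 𝔤 e) := by
    refine isNilpotent_of_commutator (D := LieAlgebra.ad ℂ 𝔤 h) two_ne_zero ?_
    refine LinearMap.ext fun y => ?_
    simp only [LinearMap.sub_apply, Module.End.mul_apply, LieAlgebra.ad_apply, LinearMap.smul_apply]
    rw [← lie_lie, he, smul_lie]
  have hnf : IsNilpotent (LieAlgebra.ad ℂ 𝔤 f) := by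
    refine isNilpotent_of_commutator (D := LieAlgebra.ad ℂ 𝔤 h) (neg_ne_zero.2 two_ne_zero) ?_
    refine LinearMap.ext fun y => ?_
    simp only [LinearMap.sub_apply, Module.End.mul_apply, LieAlgebra.ad_apply, LinearMap.smul_apply]
    rw [← lie_lie, hf, smul_lie]
  have hnxe : IsNilpotent (LieAlgebra.ad ℂ 𝔤 (x • e)) := by rw [map_smul]; exact hne.smul x
  have hnyf : IsNilpotent (LieAlgebra.ad ℂ 𝔤 ((x / 2) • f)) := by rw [map_smul]; exact hnf.smul _
  obtain ⟨φ, φ0, φ1, φ2, φT⟩ := exists_exp_ad hnxe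
  obtain ⟨ψ, ψ0, ψ1, -, ψT⟩ := exists_exp_ad hnyf
  have hfh : ⁅f, h⁆ = (2 : ℂ) • f := by rw [← lie_skew, hf]; module
  have heh : ⁅e, h⁆ = -(2 : ℂ) • e := by rw [← lie_skew, he]; module
  -- First exp((x/2) ad f) takes h to h + xf; then exp(x ad e) contributes x²h = -h from the term
  -- xf, which cancels h and leaves x(f - e).
  refine ⟨ψ.trans φ, ?_, fun y h1 h2 => ?_, fun T h1 h2 y => ?_⟩
  · rw [LieEquiv.trans_apply, ψ1 h (by simp [hfh])]
    have e1 : ⁅(x / 2) • f, h⁆ = x • f := by rw [smul_lie, hfh]; module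
    rw [e1, map_add, map_smul, φ1 h (by simp [heh]), φ2 f (by simp [hef, heh])]
    simp only [smul_lie, lie_smul, hef, heh]
    have e2 : x • x • x • (e : 𝔤) = -x • e := by rw [smul_smul, smul_smul, hx]; simp
    have e3 : x • x • (h : 𝔤) = -h := by rw [smul_smul, hx]; simp
    have e4 : h + x • -(2 : ℂ) • e + x • (f + x • h + (1 / 2 : ℂ) • x • x • -(2 : ℂ) • e) =
      h + x • -(2 : ℂ) • e + x • f + x • x • h - x • x • x • e := by module
    rw [e4, e2, e3]; module
  · rw [LieEquiv.trans_apply, ψ0 y (by rw [smul_lie, h2, smul_zero]),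
      φ0 y (by rw [smul_lie, h1, smul_zero])]
  · rw [LieEquiv.trans_apply, LieEquiv.trans_apply,
      ψT T (fun y => by rw [smul_lie, smul_lie, map_smul, h2]),
      φT T (fun y => by rw [smul_lie, smul_lie, map_smul, h1])]

omit [LieAlgebra ℂ 𝔤] [FiniteDimensional ℂ 𝔤] in
/-- Eigenspace decomposition of an endomorphism with `A³ = A`. -/
lemma exists_eigen_decomp [Module ℂ 𝔤] {A : Module.End ℂ 𝔤} (hA : ∀ x, A (A (A x)) = A x) (x : 𝔤) :
    ∃ x₁ x₀ x₂, A x₁ = x₁ ∧ A x₀ = 0 ∧ A x₂ = -x₂ ∧ x = x₁ + x₀ + x₂ ∧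
      ∀ (T : Module.End ℂ 𝔤) (w : ℂ), (∀ y, T (A y) = A (T y)) → T x = w • x →
        T x₁ = w • x₁ ∧ T x₀ = w • x₀ ∧ T x₂ = w • x₂ := by
  -- The components are polynomials in A applied to x, so an operator that commutes with A keeps its
  -- eigenvalue on each of them.
  refine ⟨(1 / 2 : ℂ) • (A (A x) + A x), x - A (A x), (1 / 2 : ℂ) • (A (A x) - A x), ?_, ?_, ?_, ?_,
    fun T w hT hx => ⟨?_, ?_, ?_⟩⟩
  · rw [map_smul, map_add, hA, add_comm]
  · rw [map_sub, hA, sub_self]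
  · rw [map_smul, map_sub, hA, ← smul_neg, neg_sub]
  · module
  · rw [map_smul, map_add, hT, hT, hx]; simp only [map_smul]; module
  · rw [map_sub, hT, hT, hx]; simp only [map_smul]; module
  · rw [map_smul, map_sub, hT, hT, hx]; simp only [map_smul]; module

/-- An `𝔰𝔩₂`-triple `e, f, h` in a complex Lie algebra, and an element `b` that commutes with it,
such that `Z = b + (e - f) / 2` acts with eigenvalues `0, ± i`. -/
structure HermitianTriple (e f h b : 𝔤) : Prop where
  ef : ⁅e, f⁆ = h
  he : ⁅h, e⁆ = (2 : ℂ) • e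
  hf : ⁅h, f⁆ = -(2 : ℂ) • f
  be : ⁅b, e⁆ = 0
  bf : ⁅b, f⁆ = 0
  cube : ∀ x : 𝔤, ⁅b + (1 / 2 : ℂ) • (e - f), ⁅b + (1 / 2 : ℂ) • (e - f),
    ⁅b + (1 / 2 : ℂ) • (e - f), x⁆⁆⁆ = -⁅b + (1 / 2 : ℂ) • (e - f), x⁆

namespace HermitianTriple

variable {e f h b : 𝔤} (t : HermitianTriple e f h b)

variable (h b) in
/-- The operator whose eigenvalues are `w / 2 + μ`, where `w` is the `h`-weight and `i μ` the
`b`-weight. -/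
def opA : Module.End ℂ 𝔤 := LieAlgebra.ad ℂ 𝔤 (-I • b + (1 / 2 : ℂ) • h)

variable (h b) in
/-- The operator whose eigenvalues are `μ - w / 2`. -/
def opB : Module.End ℂ 𝔤 := LieAlgebra.ad ℂ 𝔤 (-I • b - (1 / 2 : ℂ) • h)

omit [FiniteDimensional ℂ 𝔤] in
lemma opA_apply (x : 𝔤) : opA h b x = -I • ⁅b, x⁆ + (1 / 2 : ℂ) • ⁅h, x⁆ := by
  simp [opA]

omit [FiniteDimensional ℂ 𝔤] in
lemma opB_apply (x : 𝔤) : opB h b x = -I • ⁅b, x⁆ - (1 / 2 : ℂ) • ⁅h, x⁆ := by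
  simp [opB]

omit [FiniteDimensional ℂ 𝔤] in
lemma opA_sub_opB (x : 𝔤) : opA h b x - opB h b x = ⁅h, x⁆ := by
  rw [opA_apply, opB_apply]; module

omit [FiniteDimensional ℂ 𝔤] in
lemma lie_b (x : 𝔤) : ⁅b, x⁆ = (I / 2) • (opA h b x + opB h b x) := by
  rw [opA_apply, opB_apply]
  have : (I / 2) • (-I • ⁅b, x⁆ + (1 / 2 : ℂ) • ⁅h, x⁆ + (-I • ⁅b, x⁆ - (1 / 2 : ℂ) • ⁅h, x⁆)) =
    (-(I * I)) • ⁅b, x⁆ := by module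
  rw [this, I_mul_I]; simp

include t

omit [FiniteDimensional ℂ 𝔤] in
lemma bh : ⁅b, h⁆ = 0 := by rw [← t.ef, leibniz_lie, t.be, t.bf, zero_lie, lie_zero, add_zero]

omit [FiniteDimensional ℂ 𝔤] in
lemma lie_b_lie_h (x : 𝔤) : ⁅b, ⁅h, x⁆⁆ = ⁅h, ⁅b, x⁆⁆ := by
  rw [leibniz_lie, t.bh, zero_lie, zero_add]

omit [FiniteDimensional ℂ 𝔤] in
lemma lie_h_opA (x : 𝔤) : ⁅h, opA h b x⁆ = opA h b ⁅h, x⁆ := by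
  simp only [opA_apply, lie_add, lie_smul, t.lie_b_lie_h]

omit [FiniteDimensional ℂ 𝔤] in
lemma lie_b_opA (x : 𝔤) : ⁅b, opA h b x⁆ = opA h b ⁅b, x⁆ := by
  simp only [opA_apply, lie_add, lie_smul, t.lie_b_lie_h]

omit [FiniteDimensional ℂ 𝔤] in
lemma opA_opB (x : 𝔤) : opA h b (opB h b x) = opB h b (opA h b x) := by
  rw [opB_apply, opB_apply, t.lie_h_opA, t.lie_b_opA, map_sub, map_smul, map_smul]

/-- For x = i the Cayley transform fixes b and sends h/2 to -i(e - f)/2, so -ib + h/2 goes to -iZ.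
-/
lemma exists_cayley_opA : ∃ c : 𝔤 ≃ₗ⁅ℂ⁆ 𝔤, (∀ x, c (opA h b x) =
    -I • ⁅b + (1 / 2 : ℂ) • (e - f), c x⁆) := by
  obtain ⟨c, ch, cb, -⟩ := exists_cayley t.ef t.he t.hf (x := I) (by simp)
  refine ⟨c, fun x => ?_⟩
  have h1 : c b = b := cb b (by rw [← lie_skew, t.be, neg_zero]) (by rw [← lie_skew, t.bf, neg_zero])
  rw [opA, LieAlgebra.ad_apply, LieEquiv.map_lie, map_add, map_smul, map_smul, h1, ch, ← smul_lie]
  congr 1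
  module

/-- The other root x = -i compensates the sign of h/2. The clause on T later makes this transform
K_M-equivariant. -/
lemma exists_cayley_opB : ∃ c : 𝔤 ≃ₗ⁅ℂ⁆ 𝔤, (∀ x, c (opB h b x) =
    -I • ⁅b + (1 / 2 : ℂ) • (e - f), c x⁆) ∧
    ∀ T : Module.End ℂ 𝔤, (∀ y, T ⁅e, y⁆ = ⁅e, T y⁆) → (∀ y, T ⁅f, y⁆ = ⁅f, T y⁆) →
        ∀ y, c (T y) = T (c y) := by
  obtain ⟨c, ch, cb, cT⟩ := exists_cayley t.ef t.he t.hf (x := -I) (by simp)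
  refine ⟨c, fun x => ?_, cT⟩
  have h1 : c b = b := cb b (by rw [← lie_skew, t.be, neg_zero]) (by rw [← lie_skew, t.bf, neg_zero])
  rw [opB, LieAlgebra.ad_apply, LieEquiv.map_lie, map_sub, map_smul, map_smul, h1, ch, ← smul_lie]
  congr 1
  module

omit [FiniteDimensional ℂ 𝔤] in
lemma cube_neg_I (x : 𝔤) : -I • ⁅b + (1 / 2 : ℂ) • (e - f), -I • ⁅b + (1 / 2 : ℂ) • (e - f),
    -I • ⁅b + (1 / 2 : ℂ) • (e - f), x⁆⁆⁆ = -I • ⁅b + (1 / 2 : ℂ) • (e - f), x⁆ := by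
  rw [lie_smul, lie_smul, lie_smul, t.cube, smul_neg, ← neg_smul, smul_smul, smul_smul]
  congr 1
  simp

lemma opA_cube (x : 𝔤) : opA h b (opA h b (opA h b x)) = opA h b x := by
  obtain ⟨c, hc⟩ := t.exists_cayley_opA
  refine c.injective ?_
  change c _ = c _
  rw [hc, hc, hc, t.cube_neg_I]

lemma opB_cube (x : 𝔤) : opB h b (opB h b (opB h b x)) = opB h b x := by
  obtain ⟨c, hc, -⟩ := t.exists_cayley_opB
  refine c.injective ?_
  change c _ = c _
  rw [hc, hc, hc, t.cube_neg_I]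

lemma eq_zero_of_opB {x : 𝔤} {s : ℂ} (hx : opB h b x = s • x) (hs : s * s * s ≠ s) : x = 0 := by
  have h1 := t.opB_cube x
  simp only [hx, map_smul, smul_smul] at h1
  rw [← sub_eq_zero, ← sub_smul] at h1
  exact (smul_eq_zero.1 h1).resolve_left (sub_ne_zero.2 hs)

/-- Decomposition of a weight vector for `h`. -/
lemma exists_weight_decomp {x : 𝔤} {w : ℂ} (hx : ⁅h, x⁆ = w • x) : ∃ x₁ x₀ x₂,
    (opA h b x₁ = (1 : ℂ) • x₁ ∧ opB h b x₁ = (1 - w) • x₁) ∧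
    (opA h b x₀ = (0 : ℂ) • x₀ ∧ opB h b x₀ = (0 - w) • x₀) ∧
    (opA h b x₂ = (-1 : ℂ) • x₂ ∧ opB h b x₂ = (-1 - w) • x₂) ∧ x = x₁ + x₀ + x₂ := by
  obtain ⟨x₁, x₀, x₂, h1, h0, h2, rfl, hT⟩ := exists_eigen_decomp t.opA_cube x
  obtain ⟨w1, w0, w2⟩ := hT (LieAlgebra.ad ℂ 𝔤 h) w t.lie_h_opA hx
  simp only [LieAlgebra.ad_apply] at w1 w0 w2
  have hB : ∀ y : 𝔤, opB h b y = opA h b y - ⁅h, y⁆ := fun y => by rw [← opA_sub_opB (b := b)]; abel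
  refine ⟨x₁, x₀, x₂, ⟨by rw [h1, one_smul], ?_⟩, ⟨by rw [h0, zero_smul], ?_⟩,
    ⟨by rw [h2, neg_one_smul], ?_⟩, rfl⟩
  · rw [hB, h1, w1]; module
  · rw [hB, h0, w0]; module
  · rw [hB, h2, w2]; module

/-- A weight w of h is a difference of eigenvalues of `opA` and `opB`. The hypotheses say that a - w
is not in {0, ±1} for a = 1, 0, -1; this kills the weights ±3 and ±4. -/
lemma eq_zero_of_weight {x : 𝔤} {w : ℂ} (hx : ⁅h, x⁆ = w • x)
    (h1 : (1 - w) * (1 - w) * (1 - w) ≠ 1 - w) (h0 : (0 - w) * (0 - w) * (0 - w) ≠ 0 - w)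
    (h2 : (-1 - w) * (-1 - w) * (-1 - w) ≠ -1 - w) : x = 0 := by
  obtain ⟨x₁, x₀, x₂, w1, w0, w2, rfl⟩ := t.exists_weight_decomp hx
  rw [t.eq_zero_of_opB w1.2 h1, t.eq_zero_of_opB w0.2 h0, t.eq_zero_of_opB w2.2 h2, add_zero,
    add_zero]

/-- 2 = 1 - (-1) is the only way to write 2 as such a difference. -/
lemma opA_of_weight_two {x : 𝔤} (hx : ⁅h, x⁆ = (2 : ℂ) • x) :
    opA h b x = (1 : ℂ) • x ∧ opB h b x = (-1 : ℂ) • x := by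
  obtain ⟨x₁, x₀, x₂, w1, w0, w2, rfl⟩ := t.exists_weight_decomp hx
  rw [t.eq_zero_of_opB w0.2 (by norm_num), t.eq_zero_of_opB w2.2 (by norm_num), add_zero, add_zero]
  exact ⟨w1.1, by rw [w1.2]; norm_num⟩

omit [FiniteDimensional ℂ 𝔤] in
lemma lie_h_lie_e {x : 𝔤} {w : ℂ} (hx : ⁅h, x⁆ = w • x) : ⁅h, ⁅e, x⁆⁆ = (2 + w) • ⁅e, x⁆ := by
  rw [leibniz_lie, t.he, hx, smul_lie, lie_smul, add_smul]

omit [FiniteDimensional ℂ 𝔤] in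
lemma lie_h_lie_f {x : 𝔤} {w : ℂ} (hx : ⁅h, x⁆ = w • x) : ⁅h, ⁅f, x⁆⁆ = (-2 + w) • ⁅f, x⁆ := by
  rw [leibniz_lie, t.hf, hx, smul_lie, lie_smul, add_smul]

omit [FiniteDimensional ℂ 𝔤] in
lemma lie_e_lie_f (x : 𝔤) : ⁅e, ⁅f, x⁆⁆ = ⁅h, x⁆ + ⁅f, ⁅e, x⁆⁆ := by rw [leibniz_lie, t.ef]

/-- A vector of weight 0 killed by e spans a trivial 𝔰𝔩₂-module: [f, [f, x]] has the impossible
weight -4, and applying e to it leaves -2[f, x]. -/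
lemma lie_f_eq_zero {x : 𝔤} (hx : ⁅h, x⁆ = 0) (hex : ⁅e, x⁆ = 0) : ⁅f, x⁆ = 0 := by
  have h0 : ⁅h, x⁆ = (0 : ℂ) • x := by rw [hx, zero_smul]
  have h1 := t.lie_h_lie_f h0
  have h2 : ⁅f, ⁅f, x⁆⁆ = 0 :=
    t.eq_zero_of_weight (t.lie_h_lie_f h1) (by norm_num) (by norm_num) (by norm_num)
  have h3 := t.lie_e_lie_f ⁅f, x⁆
  have h4 : ⁅e, ⁅f, x⁆⁆ = 0 := by rw [t.lie_e_lie_f, hx, hex, lie_zero, add_zero]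
  rw [h2, h4, h1, lie_zero, lie_zero, add_zero] at h3
  exact (smul_eq_zero.1 h3.symm).resolve_left (by norm_num)

omit [FiniteDimensional ℂ 𝔤] in
lemma opA_lie_e (x : 𝔤) : opA h b ⁅e, x⁆ = ⁅e, x⁆ + ⁅e, opA h b x⁆ := by
  have e1 : ⁅b, ⁅e, x⁆⁆ = ⁅e, ⁅b, x⁆⁆ := by rw [leibniz_lie, t.be, zero_lie, zero_add]
  have e2 : ⁅h, ⁅e, x⁆⁆ = (2 : ℂ) • ⁅e, x⁆ + ⁅e, ⁅h, x⁆⁆ := by rw [leibniz_lie, t.he, smul_lie]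
  rw [opA_apply, opA_apply, e1, e2, lie_add, lie_smul, lie_smul]; module

omit [FiniteDimensional ℂ 𝔤] in
lemma opB_lie_e (x : 𝔤) : opB h b ⁅e, x⁆ = -⁅e, x⁆ + ⁅e, opB h b x⁆ := by
  have e1 : ⁅b, ⁅e, x⁆⁆ = ⁅e, ⁅b, x⁆⁆ := by rw [leibniz_lie, t.be, zero_lie, zero_add]
  have e2 : ⁅h, ⁅e, x⁆⁆ = (2 : ℂ) • ⁅e, x⁆ + ⁅e, ⁅h, x⁆⁆ := by rw [leibniz_lie, t.he, smul_lie]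
  rw [opB_apply, opB_apply, e1, e2, lie_sub, lie_smul, lie_smul]; module

omit [FiniteDimensional ℂ 𝔤] in
lemma opA_lie_f (x : 𝔤) : opA h b ⁅f, x⁆ = -⁅f, x⁆ + ⁅f, opA h b x⁆ := by
  have e1 : ⁅b, ⁅f, x⁆⁆ = ⁅f, ⁅b, x⁆⁆ := by rw [leibniz_lie, t.bf, zero_lie, zero_add]
  have e2 : ⁅h, ⁅f, x⁆⁆ = -(2 : ℂ) • ⁅f, x⁆ + ⁅f, ⁅h, x⁆⁆ := by rw [leibniz_lie, t.hf, smul_lie]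
  rw [opA_apply, opA_apply, e1, e2, lie_add, lie_smul, lie_smul]; module

omit [FiniteDimensional ℂ 𝔤] in
lemma opB_lie_f (x : 𝔤) : opB h b ⁅f, x⁆ = ⁅f, x⁆ + ⁅f, opB h b x⁆ := by
  have e1 : ⁅b, ⁅f, x⁆⁆ = ⁅f, ⁅b, x⁆⁆ := by rw [leibniz_lie, t.bf, zero_lie, zero_add]
  have e2 : ⁅h, ⁅f, x⁆⁆ = -(2 : ℂ) • ⁅f, x⁆ + ⁅f, ⁅h, x⁆⁆ := by rw [leibniz_lie, t.hf, smul_lie]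
  rw [opB_apply, opB_apply, e1, e2, lie_sub, lie_smul, lie_smul]; module

/-- The Killing form pairs the weight spaces of opposite weights. -/
lemma eq_zero_of_pairing (hκ : ∀ x : 𝔤, (∀ y, killingForm ℂ 𝔤 x y = 0) → x = 0) {u : 𝔤} {p q : ℂ}
    (hA : opA h b u = p • u) (hB : opB h b u = q • u)
    (hu : ∀ y, opA h b y = -p • y → opB h b y = -q • y → killingForm ℂ 𝔤 u y = 0) : u = 0 := by
  have skew : ∀ (z y : 𝔤), killingForm ℂ 𝔤 (LieAlgebra.ad ℂ 𝔤 z u) y =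
      - killingForm ℂ 𝔤 u (LieAlgebra.ad ℂ 𝔤 z y) := fun z y => by
    rw [LieAlgebra.ad_apply, LieAlgebra.ad_apply, ← lie_skew, map_neg, LinearMap.neg_apply]
    rw [LieModule.traceForm_apply_lie_apply ℂ 𝔤 𝔤 u z y]
  have orth : ∀ {y : 𝔤} {s r : ℂ}, opA h b y = s • y → opB h b y = r • y →
      killingForm ℂ 𝔤 u y = 0 := by
    intro y s r h1 h2
    have k1 := skew (-I • b + (1 / 2 : ℂ) • h) y
    have k2 := skew (-I • b - (1 / 2 : ℂ) • h) y
    change killingForm ℂ 𝔤 (opA h b u) y = -killingForm ℂ 𝔤 u (opA h b y) at k1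
    change killingForm ℂ 𝔤 (opB h b u) y = -killingForm ℂ 𝔤 u (opB h b y) at k2
    rw [hA, h1] at k1
    rw [hB, h2] at k2
    simp only [map_smul, LinearMap.smul_apply, smul_eq_mul] at k1 k2
    by_cases hs : s = -p
    · by_cases hr : r = -q
      · subst hs hr; exact hu y h1 h2
      · have : (q + r) * killingForm ℂ 𝔤 u y = 0 := by linear_combination k2
        exact (mul_eq_zero.1 this).resolve_left fun h => hr (by linear_combination h)
    · have : (p + s) * killingForm ℂ 𝔤 u y = 0 := by linear_combination k1
      exact (mul_eq_zero.1 this).resolve_left fun h => hs (by linear_combination h)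
  have orthA : ∀ {y : 𝔤} {s : ℂ}, opA h b y = s • y → killingForm ℂ 𝔤 u y = 0 := by
    intro y s h1
    obtain ⟨y₁, y₀, y₂, b1, b0, b2, rfl, hT⟩ := exists_eigen_decomp t.opB_cube y
    obtain ⟨a1, a0, a2⟩ := hT (opA h b) s t.opA_opB h1
    rw [map_add, map_add, orth a1 (r := 1) (by rw [b1, one_smul]),
      orth a0 (r := 0) (by rw [b0, zero_smul]), orth a2 (r := -1) (by rw [b2, neg_one_smul]),
      add_zero, add_zero]
  refine hκ u fun y => ?_
  obtain ⟨y₁, y₀, y₂, b1, b0, b2, rfl, -⟩ := exists_eigen_decomp t.opA_cube y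
  rw [map_add, map_add, orthA (s := 1) (by rw [b1, one_smul]),
      orthA (s := 0) (by rw [b0, zero_smul]), orthA (s := -1) (by rw [b2, neg_one_smul]),
      add_zero, add_zero]

end HermitianTriple

end ComplexAlgebra

/-! ### The decompositions of 𝔫^{α_r} and 𝔭₋. -/

section ComplexModules

open Complex HermitianTriple

variable {𝔤 : Type*} [LieRing 𝔤] [LieAlgebra ℂ 𝔤]

lemma killingForm_lie_left (x y z : 𝔤) :
    killingForm ℂ 𝔤 ⁅x, y⁆ z = killingForm ℂ 𝔤 x ⁅y, z⁆ :=
  LieModule.traceForm_apply_lie_apply ℂ 𝔤 𝔤 x y z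

/-- The joint eigenspace of weight `(0, -1)` for `opA`, `opB`. -/
def nMinus (h b : 𝔤) : Submodule ℂ 𝔤 where
  carrier := {x | ⁅h, x⁆ = x ∧ opA h b x = 0}
  add_mem' hx hy := ⟨by rw [lie_add, hx.1, hy.1], by rw [map_add, hx.2, hy.2, add_zero]⟩
  zero_mem' := ⟨lie_zero h, map_zero _⟩
  smul_mem' c x hx := ⟨by rw [lie_smul, hx.1], by rw [map_smul, hx.2, smul_zero]⟩

/-- The joint eigenspace of weight `(1, 0)` for `opA`, `opB`. -/
def nPlus (h b : 𝔤) : Submodule ℂ 𝔤 where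
  carrier := {x | ⁅h, x⁆ = x ∧ opA h b x = x}
  add_mem' hx hy := ⟨by rw [lie_add, hx.1, hy.1], by rw [map_add, hx.2, hy.2]⟩
  zero_mem' := ⟨lie_zero h, map_zero _⟩
  smul_mem' c x hx := ⟨by rw [lie_smul, hx.1], by rw [map_smul, hx.2]⟩

namespace HermitianTriple

variable {e f h b : 𝔤} (t : HermitianTriple e f h b)

lemma opB_of_mem_nMinus {x : 𝔤} (hx : x ∈ nMinus h b) : opB h b x = (-1 : ℂ) • x := by
  have := opA_sub_opB (h := h) (b := b) x
  rw [hx.1, hx.2, zero_sub] at this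
  rw [neg_one_smul, ← neg_eq_iff_eq_neg, this]

lemma opB_of_mem_nPlus {x : 𝔤} (hx : x ∈ nPlus h b) : opB h b x = (0 : ℂ) • x := by
  have := opA_sub_opB (h := h) (b := b) x
  rw [hx.1, hx.2, sub_eq_self] at this
  rw [this, zero_smul]

include t

lemma lie_Z_lie_Z_h : ⁅b + (1 / 2 : ℂ) • (e - f), ⁅b + (1 / 2 : ℂ) • (e - f), h⁆⁆ = -h := by
  have heh : ⁅e, h⁆ = -(2 : ℂ) • e := by rw [← lie_skew, t.he]; module
  have hfh : ⁅f, h⁆ = (2 : ℂ) • f := by rw [← lie_skew, t.hf]; module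
  have hfe : ⁅f, e⁆ = -h := by rw [← lie_skew, t.ef]
  simp only [add_lie, smul_lie, sub_lie, t.bh, heh, hfh, lie_add, lie_smul, lie_sub, t.be, t.bf,
    lie_self, t.ef, hfe, lie_zero]
  module

variable [FiniteDimensional ℂ 𝔤]

lemma lie_e_lie_f_of_mem_nMinus {y : 𝔤} (hy : y ∈ nMinus h b) : ⁅e, ⁅f, y⁆⁆ = y := by
  have h1 : ⁅h, y⁆ = (1 : ℂ) • y := by rw [hy.1, one_smul]
  rw [t.lie_e_lie_f, t.eq_zero_of_weight (t.lie_h_lie_e h1) (by norm_num) (by norm_num)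
    (by norm_num), lie_zero, add_zero, hy.1]

/-- The elements of weight `(-1, -1)`. -/
lemma mem_iff_lie_Z {x : 𝔤} : (opA h b x = (-1 : ℂ) • x ∧ opB h b x = (-1 : ℂ) • x) ↔
    (⁅h, x⁆ = 0 ∧ ⁅e, x⁆ = 0) ∧ ⁅b + (1 / 2 : ℂ) • (e - f), x⁆ = -I • x := by
  constructor
  · rintro ⟨hA, hB⟩
    -- ad e lowers the eigenvalue of `opB` by one, here to -2, which does not occur.
    have he : ⁅e, x⁆ = 0 := by
      refine t.eq_zero_of_opB (s := -2) ?_ (by norm_num)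
      rw [t.opB_lie_e, hB, lie_smul]; module
    have hh : ⁅h, x⁆ = 0 := by rw [← opA_sub_opB (b := b), hA, hB, sub_self]
    refine ⟨⟨hh, he⟩, ?_⟩
    rw [add_lie, smul_lie, sub_lie, he, t.lie_f_eq_zero hh he, sub_zero, smul_zero, add_zero,
      lie_b (h := h), hA, hB]
    module
  · rintro ⟨⟨hh, he⟩, hZ⟩
    rw [add_lie, smul_lie, sub_lie, he, t.lie_f_eq_zero hh he, sub_zero, smul_zero, add_zero] at hZ
    rw [opA_apply, opB_apply, hZ, hh, smul_smul, smul_zero, sub_zero, add_zero]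
    simp

variable {Γ : Type*} [Group Γ] (ρ : Representation ℂ Γ 𝔤)

/-- The modules that occur in the decomposition of `𝔫` and `𝔭₋`. -/
theorem exists_equiv_nMinus (hκ : ∀ x : 𝔤, (∀ y, killingForm ℂ 𝔤 x y = 0) → x = 0)
    (hρκ : ∀ k x y, killingForm ℂ 𝔤 (ρ k x) (ρ k y) = killingForm ℂ 𝔤 x y)
    (hρf : ∀ k x, ρ k ⁅f, x⁆ = ⁅f, ρ k x⁆)
    (hρA : ∀ k x, ρ k (opA h b x) = opA h b (ρ k x))
    (N N' : Subrepresentation ρ) (hN : ∀ x, x ∈ N.toSubmodule ↔ ⁅h, x⁆ = x)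
    (hN' : N'.toSubmodule = nMinus h b) :
    Nonempty (N.toRepresentation.Equiv (N'.toRepresentation.prod N'.toRepresentation.dual)) := by
  have hmem : ∀ x, x ∈ N'.toSubmodule ↔ x ∈ nMinus h b := fun x => by rw [hN']
  -- the pairing
  let pr : 𝔤 →ₗ[ℂ] N'.toSubmodule →ₗ[ℂ] ℂ :=
    (killingForm ℂ 𝔤).compl₂ ((LieAlgebra.ad ℂ 𝔤 f).comp N'.toSubmodule.subtype)
  have hpr : ∀ x (y : N'.toSubmodule), pr x y = killingForm ℂ 𝔤 x ⁅f, (y : 𝔤)⁆ := fun x y => rfl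
  let p : nPlus h b →ₗ[ℂ] N'.toSubmodule →ₗ[ℂ] ℂ := pr.comp (nPlus h b).subtype
  -- The Killing form pairs (1, 0) with (-1, 0), and each y in (-1, 0) equals [f, [e, y]] with [e,
  -- y] in `nMinus`. So a zero pairing makes x orthogonal to everything.
  have hpi : ∀ x ∈ nPlus h b, pr x = 0 → x = 0 := by
    intro x hx h0
    refine t.eq_zero_of_pairing hκ (p := 1) (q := 0) (by rw [hx.2, one_smul])
      (opB_of_mem_nPlus hx) fun y hA hB => ?_
    have hhy : ⁅h, y⁆ = (-1 : ℂ) • y := by rw [← opA_sub_opB (b := b), hA, hB]; module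
    have hA' : opA h b ⁅e, y⁆ = 0 := by rw [t.opA_lie_e, hA, lie_smul]; module
    have hey : ⁅e, y⁆ ∈ nMinus h b := ⟨by rw [t.lie_h_lie_e hhy]; norm_num, hA'⟩
    have hfy : ⁅f, y⁆ = 0 :=
      t.eq_zero_of_weight (t.lie_h_lie_f hhy) (by norm_num) (by norm_num) (by norm_num)
    have h1 := t.lie_e_lie_f y
    rw [hfy, lie_zero, hhy] at h1
    have h2 : ⁅f, ⁅e, y⁆⁆ = y := by rw [neg_one_smul] at h1; exact (neg_add_eq_zero.1 h1.symm).symm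
    have h3 := hpr x ⟨⁅e, y⁆, (hmem _).2 hey⟩
    rw [h0, h2] at h3
    exact h3.symm
  have hp1 : Function.Injective p := by
    rw [injective_iff_map_eq_zero]
    exact fun x hx => Subtype.ext (hpi x x.2 hx)
  have hp2 : Function.Injective p.flip := by
    rw [injective_iff_map_eq_zero]
    rintro ⟨y, hy⟩ h0
    have hy' := (hmem y).1 hy
    have hB := opB_of_mem_nMinus hy'
    have : ⁅f, y⁆ = 0 := by
      refine t.eq_zero_of_pairing hκ (p := -1) (q := 0) ?_ ?_ fun x hA hB' => ?_
      · rw [t.opA_lie_f, hy'.2, lie_zero]; module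
      · rw [t.opB_lie_f, hB, lie_smul]; module
      · have hx : x ∈ nPlus h b := by
          have hA' : opA h b x = x := by rw [hA]; module
          refine ⟨?_, hA'⟩
          rw [← opA_sub_opB (b := b), hA', hB']; module
        have h3 := congrArg (fun φ => φ ⟨x, hx⟩) h0
        rw [LieModule.traceForm_comm]
        exact h3
    refine Subtype.ext ?_
    change y = 0
    rw [← t.lie_e_lie_f_of_mem_nMinus hy', this, lie_zero]
  have hperf : p.IsPerfPair := .of_injective hp1 hp2
  have hAA : ∀ x ∈ N.toSubmodule, opA h b (opA h b x) = opA h b x := by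
    intro x hx
    obtain ⟨x₁, x₀, x₂, w1, w0, w2, rfl⟩ :=
      t.exists_weight_decomp (w := 1) (by rw [(hN x).1 hx, one_smul])
    rw [t.eq_zero_of_opB w2.2 (by norm_num)]
    simp [w1.1, w0.1]
  have hminus : ∀ x ∈ N.toSubmodule, ((1 : Module.End ℂ 𝔤) - opA h b) x ∈ N'.toSubmodule := by
    intro x hx
    rw [hmem]
    refine ⟨?_, ?_⟩
    · simp only [LinearMap.sub_apply, Module.End.one_apply, lie_sub, t.lie_h_opA, (hN x).1 hx]
    · simp only [LinearMap.sub_apply, Module.End.one_apply, map_sub, hAA x hx, sub_self]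
  -- On weight one `opA` is a projection with kernel `nMinus`. The second component pairs all of x,
  -- not only its `nPlus` part; Φ is then triangular, and surjectivity corrects by `pr v`.
  let Φ : N.toSubmodule →ₗ[ℂ] N'.toSubmodule × Module.Dual ℂ N'.toSubmodule :=
    (((1 : Module.End ℂ 𝔤) - opA h b).restrict hminus).prod (pr.comp N.toSubmodule.subtype)
  have hΦ1 : ∀ x, ((Φ x).1 : 𝔤) = x - opA h b x := fun x => rfl
  have hΦ2 : ∀ x, (Φ x).2 = pr x := fun x => rfl
  have hbij : Function.Bijective Φ := by
    constructor
    · rw [injective_iff_map_eq_zero]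
      intro x hx
      have h1 := hΦ1 x
      have h2 := hΦ2 x
      rw [hx] at h1 h2
      exact Subtype.ext (hpi x ⟨(hN x).1 x.2, (sub_eq_zero.1 h1.symm).symm⟩ h2.symm)
    · rintro ⟨v, ψ⟩
      obtain ⟨u, hu⟩ := hperf.bijective_left.2 (ψ - pr v)
      have hu' : pr u = ψ - pr v := hu
      have hv := (hmem v).1 v.2
      refine ⟨⟨u + v, (hN _).2 (by rw [lie_add, u.2.1, hv.1])⟩, Prod.ext (Subtype.ext ?_) ?_⟩
      · rw [hΦ1]
        simp [u.2.2, hv.2]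
      · rw [hΦ2, map_add, hu', sub_add_cancel]
  let F : N.toRepresentation.IntertwiningMap (N'.toRepresentation.prod N'.toRepresentation.dual) :=
    { Φ with
      isIntertwining' := fun k => by
        refine LinearMap.ext fun x => Prod.ext (Subtype.ext ?_) (LinearMap.ext fun y => ?_)
        · change ρ k x - opA h b (ρ k x) = ρ k (x - opA h b x)
          rw [map_sub, hρA]
        · change killingForm ℂ 𝔤 (ρ k x) ⁅f, (y : 𝔤)⁆ = killingForm ℂ 𝔤 x ⁅f, ρ k⁻¹ y⁆
          rw [← hρκ k x, hρf, ← Module.End.mul_apply (ρ k), ← map_mul, mul_inv_cancel, map_one,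
            Module.End.one_apply] }
  exact ⟨F.ofBijective hbij⟩

/-- The decomposition of `𝔭₋`. -/
theorem exists_equiv_prod (hh : killingForm ℂ 𝔤 h h ≠ 0)
    (hρe : ∀ k x, ρ k ⁅e, x⁆ = ⁅e, ρ k x⁆) (hρf : ∀ k x, ρ k ⁅f, x⁆ = ⁅f, ρ k x⁆)
    (hρ : ∀ k, ρ k e = e) {P P₂ : Submodule ℂ 𝔤}
    (hP : ∀ x, x ∈ P ↔ ⁅h, x⁆ = 0 ∧
      ⁅b + (1 / 2 : ℂ) • (e - f), ⁅b + (1 / 2 : ℂ) • (e - f), x⁆⁆ = -x ∧ killingForm ℂ 𝔤 x h = 0)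
    (hP₂ : ∀ x, x ∈ P₂ ↔ x ∈ P ∧ ⁅e, x⁆ = 0)
    (Q P₁ P₂' N' : Subrepresentation ρ)
    (hQ : ∀ x, x ∈ Q.toSubmodule ↔ ⁅b + (1 / 2 : ℂ) • (e - f), x⁆ = -I • x)
    (hP₁ : ∀ x, x ∈ P₁.toSubmodule ↔ x ∈ P ∧ ∀ y ∈ P₂, killingForm ℂ 𝔤 x y = 0)
    (hP₁₂ : ∀ x ∈ P₁.toSubmodule, x ∈ P₂ → x = 0)
    (hP₂' : P₂'.toSubmodule = P₂ ⊓ Q.toSubmodule)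
    (hN' : N'.toSubmodule = nMinus h b) :
    Nonempty (Q.toRepresentation.Equiv ((Representation.trivial ℂ Γ ℂ).prod
      (P₁.toRepresentation.prod (P₂'.toRepresentation.prod N'.toRepresentation)))) := by
  have heh : ⁅e, h⁆ = -(2 : ℂ) • e := by rw [← lie_skew, t.he]; module
  have hmem2 : ∀ x, x ∈ P₂'.toSubmodule ↔
      (opA h b x = (-1 : ℂ) • x ∧ opB h b x = (-1 : ℂ) • x) := by
    intro x
    rw [hP₂', Submodule.mem_inf, hP₂, hQ, hP, t.mem_iff_lie_Z]
    refine ⟨fun H => ⟨⟨H.1.1.1, H.1.2⟩, H.2⟩, fun H => ⟨⟨⟨H.1.1, ?_, ?_⟩, H.1.2⟩, H.2⟩⟩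
    · rw [H.2, lie_smul, H.2, smul_smul]; simp
    · rw [← t.ef, ← killingForm_lie_left, ← lie_skew, H.1.2, neg_zero, map_zero,
        LinearMap.zero_apply]
  have hmemN : ∀ x, x ∈ N'.toSubmodule ↔ x ∈ nMinus h b := fun x => by rw [hN']
  obtain ⟨c, hc, hcT⟩ := t.exists_cayley_opB
  have hQc : ∀ x, c x ∈ Q.toSubmodule ↔ opB h b x = (-1 : ℂ) • x := by
    intro x
    rw [hQ]
    have h1 := hc x
    constructor
    · intro h2
      rw [h2, smul_smul] at h1
      refine c.injective (h1.trans ?_)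
      change _ = c _
      rw [map_smul]
      congr 1
      simp
    · intro h2
      rw [h2, map_smul] at h1
      have h3 := congrArg (fun z => I • z) h1
      simp only [smul_smul] at h3
      simpa using h3.symm
  -- The line of e and [e, P₁] lie in the joint eigenspace (1, -1), P₂' in (-1, -1), N' in (0, -1);
  -- together they should fill the eigenspace -1 of `opB`.
  let Ψ : ℂ × P₁.toSubmodule × P₂'.toSubmodule × N'.toSubmodule →ₗ[ℂ] 𝔤 :=
    (LinearMap.toSpanSingleton ℂ 𝔤 e).coprod
      (((LieAlgebra.ad ℂ 𝔤 e).comp P₁.toSubmodule.subtype).coprod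
        (P₂'.toSubmodule.subtype.coprod N'.toSubmodule.subtype))
  have hΨ : ∀ z, Ψ z = z.1 • e + (⁅e, (z.2.1 : 𝔤)⁆ + ((z.2.2.1 : 𝔤) + (z.2.2.2 : 𝔤))) :=
    fun z => rfl
  have he2 := t.opA_of_weight_two t.he
  have hey : ∀ y ∈ P₁.toSubmodule, opA h b ⁅e, y⁆ = (1 : ℂ) • ⁅e, y⁆ ∧
      opB h b ⁅e, y⁆ = (-1 : ℂ) • ⁅e, y⁆ := by
    intro y hy
    refine t.opA_of_weight_two ?_
    have h0 : ⁅h, y⁆ = (0 : ℂ) • y := by rw [((hP y).1 ((hP₁ y).1 hy).1).1, zero_smul]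
    rw [t.lie_h_lie_e h0, add_zero]
  have hΨB : ∀ z, opB h b (Ψ z) = (-1 : ℂ) • Ψ z := by
    rintro ⟨s, y, v, w⟩
    rw [hΨ]
    dsimp only
    rw [map_add, map_add, map_add, map_smul, he2.2, (hey y y.2).2, ((hmem2 v).1 v.2).2,
      opB_of_mem_nMinus ((hmemN w).1 w.2)]
    module
  have hinj : ∀ z, Ψ z = 0 → z = 0 := by
    rintro ⟨s, y, v, w⟩ hz
    rw [hΨ] at hz
    dsimp only at hz
    have hw : opA h b (w : 𝔤) = 0 := ((hmemN w).1 w.2).2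
    -- Applying `opA` twice separates its eigenvalues 1, -1 and 0.
    have e1 := congrArg (opA h b) hz
    simp only [map_add, map_smul, he2.1, (hey y y.2).1, ((hmem2 v).1 v.2).1, hw, map_zero] at e1
    have e2 := congrArg (opA h b) e1
    simp only [map_add, map_smul, he2.1, (hey y y.2).1, ((hmem2 v).1 v.2).1, map_zero] at e2
    have hv : (v : 𝔤) = 0 := by
      have : (v : 𝔤) = (1 / 2 : ℂ) • ((s • (1 : ℂ) • e + ((1 : ℂ) • ⁅e, (y : 𝔤)⁆ + ((-1 : ℂ) • (-1 : ℂ) • (v : 𝔤) + 0)))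
        - (s • (1 : ℂ) • e + ((1 : ℂ) • ⁅e, (y : 𝔤)⁆ + ((-1 : ℂ) • (v : 𝔤) + 0)))) := by module
      rw [this]
      simp only [one_smul] at e1 e2 ⊢
      rw [e1, e2, sub_zero, smul_zero]
    rw [hv] at e1 hz
    simp only [one_smul, smul_zero, add_zero, zero_add] at e1 hz
    have hw0 : (w : 𝔤) = 0 := by rwa [← add_assoc, e1, zero_add] at hz
    obtain ⟨hyP, hyP₂⟩ := (hP₁ y).1 y.2
    obtain ⟨hy1, hy2, hy3⟩ := (hP _).1 hyP
    -- As [e, h] = -2e, the relation says that e kills y - (s/2)h. Invariance makes this vector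
    -- orthogonal to h = [e, f]; since y is orthogonal to h already, s = 0.
    have hu1 : ⁅e, (y : 𝔤) - (s / 2) • h⁆ = 0 := by
      rw [lie_sub, lie_smul, heh, ← e1]; module
    have hs : s = 0 := by
      have h1 : killingForm ℂ 𝔤 ((y : 𝔤) - (s / 2) • h) h = 0 := by
        rw [← t.ef, ← killingForm_lie_left, t.ef, ← lie_skew, hu1, neg_zero, map_zero,
          LinearMap.zero_apply]
      rw [map_sub, LinearMap.sub_apply, hy3, map_smul, LinearMap.smul_apply, smul_eq_mul, zero_sub,
        neg_eq_zero] at h1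
      simpa using (mul_eq_zero.1 h1).resolve_right hh
    rw [hs, zero_smul, zero_add] at e1
    have hy0 : (y : 𝔤) = 0 := hP₁₂ y y.2 ((hP₂ y).2 ⟨hyP, e1⟩)
    refine Prod.ext hs (Prod.ext (Subtype.ext hy0) (Prod.ext (Subtype.ext hv) (Subtype.ext hw0)))
  have hsurj : ∀ x, opB h b x = (-1 : ℂ) • x → ∃ z, Ψ z = x := by
    intro x hx
    obtain ⟨x₁, x₀, x₂, a1, a0, a2, rfl, hT⟩ := exists_eigen_decomp t.opA_cube x
    obtain ⟨b1, b0, b2⟩ := hT (opB h b) (-1) (fun y => (t.opA_opB y).symm) hx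
    have hx₂ : x₂ ∈ P₂'.toSubmodule := (hmem2 _).2 ⟨by rw [a2, neg_one_smul], b2⟩
    have hx₀ : x₀ ∈ N'.toSubmodule := by
      refine (hmemN _).2 ⟨?_, a0⟩
      rw [← opA_sub_opB (b := b), a0, b0]; module
    have hh1 : ⁅h, x₁⁆ = (2 : ℂ) • x₁ := by
      rw [← opA_sub_opB (b := b), a1, b1]; module
    have hb1 : ⁅b, x₁⁆ = 0 := by rw [lie_b (h := h), a1, b1]; module
    have he1 : ⁅e, x₁⁆ = 0 :=
      t.eq_zero_of_weight (t.lie_h_lie_e hh1) (by norm_num) (by norm_num) (by norm_num)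
    -- A preimage of x₁ under ad e: [e, [f, x₁]] = [h, x₁] = 2x₁, because [e, x₁] would have weight
    -- 4.
    obtain ⟨y, hy⟩ : ∃ y : 𝔤, y = (1 / 2 : ℂ) • ⁅f, x₁⁆ := ⟨_, rfl⟩
    have hhy : ⁅h, y⁆ = 0 := by rw [hy, lie_smul, t.lie_h_lie_f hh1]; norm_num
    have heyx : ⁅e, y⁆ = x₁ := by
      rw [hy, lie_smul, t.lie_e_lie_f, hh1, he1, lie_zero]; module
    have hby : ⁅b, y⁆ = 0 := by
      rw [hy, lie_smul, leibniz_lie, t.bf, hb1, zero_lie, lie_zero, add_zero, smul_zero]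
    have hbx : ∀ z : 𝔤, ⁅b, z⁆ = 0 → ⁅b, ⁅f, z⁆⁆ = 0 := fun z hz => by
      rw [leibniz_lie, t.bf, hz, zero_lie, lie_zero, add_zero]
    have hfx : ⁅f, x₁⁆ = (2 : ℂ) • y := by rw [hy]; module
    have hffy : ⁅f, ⁅f, y⁆⁆ = 0 := by
      have h0 : ⁅h, y⁆ = (0 : ℂ) • y := by rw [hhy, zero_smul]
      exact t.eq_zero_of_weight (t.lie_h_lie_f (t.lie_h_lie_f h0)) (by norm_num) (by norm_num)
        (by norm_num)
    have hefy : ⁅e, ⁅f, y⁆⁆ = (2 : ℂ) • y := by rw [t.lie_e_lie_f, hhy, heyx, hfx, zero_add]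
    have hZZ : ⁅b + (1 / 2 : ℂ) • (e - f), ⁅b + (1 / 2 : ℂ) • (e - f), y⁆⁆ = -y := by
      simp only [add_lie, smul_lie, sub_lie, hby, heyx, lie_add, lie_smul, lie_sub, hb1, he1,
        hfx, hffy, hefy, hbx y hby, lie_zero]
      module
    -- Removing the component of y along h puts it in P. The removed part reappears as -2s e, since
    -- [e, h] = -2e.
    set s : ℂ := killingForm ℂ 𝔤 y h / killingForm ℂ 𝔤 h h with hs
    have hyP : y - s • h ∈ P := by
      refine (hP _).2 ⟨?_, ?_, ?_⟩
      · rw [lie_sub, lie_smul, lie_self, hhy, smul_zero, sub_zero]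
      · rw [lie_sub, lie_sub, hZZ, lie_smul, lie_smul, t.lie_Z_lie_Z_h]; module
      · rw [map_sub, LinearMap.sub_apply, map_smul, LinearMap.smul_apply, smul_eq_mul, hs,
          div_mul_cancel₀ _ hh, sub_self]
    have hyP₁ : y - s • h ∈ P₁.toSubmodule := by
      refine (hP₁ _).2 ⟨hyP, fun v hv => ?_⟩
      obtain ⟨hvP, hev⟩ := (hP₂ v).1 hv
      obtain ⟨hv1, hv2, hv3⟩ := (hP v).1 hvP
      have hfv := t.lie_f_eq_zero hv1 hev
      rw [map_sub, LinearMap.sub_apply, map_smul, LinearMap.smul_apply, LieModule.traceForm_comm ℂ 𝔤 𝔤 h v,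
        hv3, smul_zero, sub_zero, hy, map_smul, LinearMap.smul_apply, ← lie_skew, map_neg,
        LinearMap.neg_apply, killingForm_lie_left, hfv, map_zero, neg_zero, smul_zero]
    refine ⟨⟨-(2 : ℂ) * s, ⟨_, hyP₁⟩, ⟨_, hx₂⟩, ⟨_, hx₀⟩⟩, ?_⟩
    rw [hΨ]
    dsimp only
    rw [lie_sub, lie_smul, heyx, heh]
    module
  let Φ : ℂ × P₁.toSubmodule × P₂'.toSubmodule × N'.toSubmodule →ₗ[ℂ] Q.toSubmodule :=
    ((c.toLinearEquiv : 𝔤 →ₗ[ℂ] 𝔤).comp Ψ).codRestrict _ fun z => (hQc _).2 (hΨB z)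
  have hΦ : ∀ z, (Φ z : 𝔤) = c (Ψ z) := fun z => rfl
  have hbij : Function.Bijective Φ := by
    constructor
    · rw [injective_iff_map_eq_zero]
      intro z hz
      refine hinj z (c.injective ?_)
      change c _ = c _
      rw [← hΦ, hz, map_zero]; rfl
    · rintro ⟨x, hx⟩
      have hx' : c (c.symm x) = x := c.apply_symm_apply x
      rw [← hx', hQc] at hx
      obtain ⟨z, hz⟩ := hsurj _ hx
      exact ⟨z, Subtype.ext (by rw [hΦ, hz, hx'])⟩
  let F : ((Representation.trivial ℂ Γ ℂ).prod (P₁.toRepresentation.prod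
      (P₂'.toRepresentation.prod N'.toRepresentation))).IntertwiningMap Q.toRepresentation :=
    { Φ with
      isIntertwining' := fun k => by
        refine LinearMap.ext fun z => Subtype.ext ?_
        change c (z.1 • e + (⁅e, ρ k (z.2.1 : 𝔤)⁆ + (ρ k (z.2.2.1 : 𝔤) + ρ k (z.2.2.2 : 𝔤)))) =
          ρ k (c (z.1 • e + (⁅e, (z.2.1 : 𝔤)⁆ + ((z.2.2.1 : 𝔤) + (z.2.2.2 : 𝔤)))))
        rw [← hcT (ρ k) (hρe k) (hρf k)]
        simp only [map_add, map_smul, hρ, hρe] }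
  exact ⟨(F.ofBijective hbij).symm⟩

end HermitianTriple

end ComplexModules

/-! ### The action of K: compatibility with θ and with Z. -/

section GroupAction

variable {n : ℕ} {G : Type*} [TopologicalSpace G] [ChartedSpace (EuclideanSpace ℝ (Fin n)) G]
  [Group G]

instance : FiniteDimensional ℝ (RLie n G) :=
  inferInstanceAs (FiniteDimensional ℝ (EuclideanSpace ℝ (Fin n)))

variable [LieGroup (𝓡 n) ∞ G]

variable (n) in
/-- `Ad g` as an automorphism of the Lie algebra. -/
def AdEquiv (g : G) : RLie n G ≃ₗ⁅ℝ⁆ RLie n G where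
  toFun := Ad n G g
  map_add' := map_add _
  map_smul' := map_smul _
  map_lie' := AdMap_lie n g _ _
  invFun := Ad n G g⁻¹
  left_inv X := by
    rw [← Module.End.mul_apply, ← map_mul, inv_mul_cancel, map_one, Module.End.one_apply]
  right_inv X := by
    rw [← Module.End.mul_apply, ← map_mul, mul_inv_cancel, map_one, Module.End.one_apply]

lemma Ad_lie (g : G) (X Y : RLie n G) : Ad n G g ⁅X, Y⁆ = ⁅Ad n G g X, Ad n G g Y⁆ :=
  AdMap_lie n g X Y

lemma killing_Ad (g : G) (X Y : RLie n G) : kf n G (Ad n G g X) (Ad n G g Y) = kf n G X Y :=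
  LieAlgebra.killingForm_of_equiv_apply (AdEquiv n g) X Y

lemma Ad_mem_lieOf {K : Subgroup G} {k : G} (hk : k ∈ K) {X : RLie n G} (hX : X ∈ lieOf n K) :
    Ad n G k X ∈ lieOf n K := by
  obtain ⟨γ, hγ, hd⟩ := hX
  refine ⟨(MulAut.conj k).toMonoidHom.comp γ, fun t => K.mul_mem (K.mul_mem hk (hγ t))
    (K.inv_mem hk), ?_⟩
  have key : ∀ g : G, g = 1 → HasMFDerivAt (𝓡 n) (𝓡 n) (fun x : G => k * x * k⁻¹) g
      (AdMap n k : EuclideanSpace ℝ (Fin n) →L[ℝ] EuclideanSpace ℝ (Fin n)) := by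
    rintro _ rfl
    exact (mdifferentiable_conj n k 1).hasMFDerivAt
  have h1 := (key (γ (Multiplicative.ofAdd 0)) (map_one γ)).comp (0 : ℝ) hd
  have h2 : (AdMap n k : EuclideanSpace ℝ (Fin n) →L[ℝ] EuclideanSpace ℝ (Fin n)).comp
      (ContinuousLinearMap.toSpanSingleton ℝ (X : EuclideanSpace ℝ (Fin n))) =
      ContinuousLinearMap.toSpanSingleton ℝ (AdMap n k X : EuclideanSpace ℝ (Fin n)) := by
    ext
    simp
  exact h1.congr_mfderiv h2

variable {θ : RLie n G ≃ₗ⁅ℝ⁆ RLie n G} {K : Subgroup G}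

lemma mem_kR {X : RLie n G} : X ∈ kR n θ ↔ θ X = X := by
  rw [kR, Module.End.mem_eigenspace_iff, one_smul]; rfl

lemma mem_pR {X : RLie n G} : X ∈ pR n θ ↔ θ X = -X := by
  rw [pR, Module.End.mem_eigenspace_iff, neg_one_smul]; rfl

namespace IsCartanInvolution

variable (hθ : IsCartanInvolution n θ K)
include hθ

lemma isCartanInv : IsCartanInv θ := ⟨hθ.involutive, hθ.posDef⟩

/-- Ad(k) preserves 𝔨₀ = Lie K and the Killing form, hence also 𝔭₀, the orthocomplement of 𝔨₀. -/
lemma Ad_theta {k : G} (hk : k ∈ K) (X : RLie n G) : Ad n G k (θ X) = θ (Ad n G k X) := by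
  have hI := hθ.isCartanInv
  have hkk : ∀ g ∈ K, ∀ X : RLie n G, θ X = X → θ (Ad n G g X) = Ad n G g X := by
    intro g hg X hX
    rw [← mem_kR, ← SetLike.mem_coe, hθ.lie_eq]
    refine Ad_mem_lieOf hg ?_
    rw [← hθ.lie_eq, SetLike.mem_coe, mem_kR]
    exact hX
  have hpp : ∀ X : RLie n G, θ X = -X → θ (Ad n G k X) = -Ad n G k X := by
    intro X hX
    obtain ⟨U, V, hU, hV, hUV⟩ := hI.exists_decomp (Ad n G k X)
    have h1 : kf n G (Ad n G k X) U = 0 := by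
      have h2 : Ad n G k (Ad n G k⁻¹ U) = U := by
        rw [← Module.End.mul_apply, ← map_mul, mul_inv_cancel, map_one, Module.End.one_apply]
      rw [← h2, killing_Ad]
      have h3 := hI.killing_theta_left X (Ad n G k⁻¹ U)
      rw [hX, hkk _ (K.inv_mem hk) U hU, map_neg, LinearMap.neg_apply] at h3
      change -(kf n G X _) = kf n G X _ at h3
      linarith
    have h4 := hI.killing_theta_left V U
    rw [hV, hU, map_neg, LinearMap.neg_apply] at h4
    have h5 : killingForm ℝ (RLie n G) U (θ U) = 0 := by
      rw [hU]
      rw [hUV] at h1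
      change killingForm ℝ (RLie n G) (U + V) U = 0 at h1
      rw [map_add, LinearMap.add_apply] at h1
      linarith
    have h6 : U = 0 := by
      by_contra h0
      have := hθ.posDef U h0
      change 0 < -(killingForm ℝ (RLie n G) U (θ U)) at this
      linarith
    rw [hUV, h6, zero_add, hV]
  obtain ⟨U, V, hU, hV, rfl⟩ := hI.exists_decomp X
  rw [map_add, map_add, map_add, map_add, hU, hV, hkk k hk U hU, hpp V hV, map_neg]

/-- An invariant complex structure on `G/K` is the action of an element of the center of `𝔨₀`
that commutes with `Ad(K)`. -/
theorem exists_center {J : pR n θ →ₗ[ℝ] pR n θ} (hJ : IsInvariantComplexStructure n θ K J) :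
    ∃ Z : RLie n G, θ Z = Z ∧ (∀ W, θ W = W → ⁅Z, W⁆ = 0) ∧
      (∀ X : pR n θ, ⁅Z, (X : RLie n G)⁆ = J X) ∧
      ∀ k ∈ K, ∀ X, Ad n G k ⁅Z, X⁆ = ⁅Z, Ad n G k X⁆ := by
  have hI := hθ.isCartanInv
  let P : RLie n G →ₗ[ℝ] pR n θ :=
    ((1 / 2 : ℝ) • (LinearMap.id - (θ.toLinearEquiv : RLie n G →ₗ[ℝ] RLie n G))).codRestrict _
      fun X => by
        rw [mem_pR]
        change θ ((1 / 2 : ℝ) • (X - θ X)) = -((1 / 2 : ℝ) • (X - θ X))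
        rw [map_smul, map_sub, hθ.involutive]
        module
  have hP : ∀ X, (P X : RLie n G) = (1 / 2 : ℝ) • (X - θ X) := fun X => rfl
  let J' : RLie n G →ₗ[ℝ] RLie n G := (pR n θ).subtype ∘ₗ J ∘ₗ P
  have hJ' : ∀ X, J' X = J (P X) := fun X => rfl
  have hPp : ∀ X : pR n θ, P X = X := fun X => Subtype.ext (by
    rw [hP, mem_pR.1 X.2]; module)
  have hJAd : ∀ k ∈ K, ∀ X, J' (Ad n G k X) = Ad n G k (J' X) := by
    intro k hk X
    refine hJ.comm k hk (P X) (P (Ad n G k X)) ?_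
    rw [hP, hP, map_smul, map_sub, hθ.Ad_theta hk]
  -- Differentiate J Ad(γ(t))X = Ad(γ(t))JX at t = 0 along a one-parameter subgroup of K with
  -- velocity W.
  have hJW : ∀ W X, θ W = W → J' ⁅W, X⁆ = ⁅W, J' X⁆ := by
    intro W X hW
    have hWK : W ∈ lieOf n K := by
      rw [← hθ.lie_eq]
      exact mem_kR.2 hW
    obtain ⟨γ, hγ, hd⟩ := hWK
    have h1 := hasDerivAt_AdMap_comp n (map_one γ) hd X
    have h2 := hasDerivAt_AdMap_comp n (map_one γ) hd (J' X)
    let J'' : EuclideanSpace ℝ (Fin n) →L[ℝ] EuclideanSpace ℝ (Fin n) :=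
      LinearMap.toContinuousLinearMap (E := EuclideanSpace ℝ (Fin n)) J'
    have h3 := J''.hasFDerivAt.comp_hasDerivAt (0 : ℝ) h1
    have h4 : HasDerivAt (fun t : ℝ =>
        (AdMap n (γ (Multiplicative.ofAdd t)) (J' X) : EuclideanSpace ℝ (Fin n))) (J' ⁅W, X⁆) 0 :=
      h3.congr_of_eventuallyEq (.of_forall fun t => (hJAd _ (hγ t) X).symm)
    exact HasDerivAt.unique (F := EuclideanSpace ℝ (Fin n)) h4 h2
  have hJk : ∀ X, θ X = X → J' X = 0 := by
    intro X hX
    have : P X = 0 := Subtype.ext (by rw [hP, hX, sub_self, smul_zero]; rfl)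
    rw [hJ', this, map_zero]; rfl
  have hJJ : ∀ X, θ X = -X → J' (J' X) = -X := by
    intro X hX
    rw [hJ', hJ', hPp, hJ.sq, Submodule.coe_neg, hPp ⟨X, mem_pR.2 hX⟩]
  obtain ⟨Z, hZ, hZJ⟩ := hI.exists_center_eq (J := J') hJk
    (fun X _ => mem_pR.1 (J (P X)).2) hJJ hJW
  refine ⟨Z, hZ, fun W hW => ?_, fun X => ?_, fun k hk X => ?_⟩
  · rw [hZJ, hJk W hW]
  · rw [hZJ, hJ', hPp]
  · rw [hZJ, hZJ, hJAd k hk]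

end IsCartanInvolution

end GroupAction

/-! ### Complexification, and a definite Hermitian form on 𝔤. -/

section Complexification

open Complex

section Module

variable {V : Type*} [AddCommGroup V] [Module ℝ V]

/-- The element `x + i y` of the complexification. -/
def cx (x y : V) : ℂ ⊗[ℝ] V := (1 : ℂ) ⊗ₜ[ℝ] x + I ⊗ₜ[ℝ] y

lemma exists_cx (z : ℂ ⊗[ℝ] V) : ∃ x y : V, z = cx x y := by
  induction z with
  | zero => exact ⟨0, 0, by simp [cx]⟩
  | tmul c x =>
    refine ⟨c.re • x, c.im • x, ?_⟩
    rw [cx, ← TensorProduct.smul_tmul, ← TensorProduct.smul_tmul, ← TensorProduct.add_tmul]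
    congr 1
    simp
  | add z w hz hw =>
    obtain ⟨x, y, rfl⟩ := hz
    obtain ⟨x', y', rfl⟩ := hw
    exact ⟨x + x', y + y', by simp only [cx, TensorProduct.tmul_add]; abel⟩

lemma cx_inj {x y x' y' : V} : cx x y = cx x' y' ↔ x = x' ∧ y = y' := by
  refine ⟨fun h => ⟨?_, ?_⟩, fun h => by rw [h.1, h.2]⟩
  · simpa [cx] using congrArg
      ((TensorProduct.lid ℝ V).toLinearMap ∘ₗ TensorProduct.map Complex.reLm LinearMap.id) h
  · simpa [cx] using congrArg
      ((TensorProduct.lid ℝ V).toLinearMap ∘ₗ TensorProduct.map Complex.imLm LinearMap.id) h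

lemma one_tmul_eq_cx (x : V) : (1 : ℂ) ⊗ₜ[ℝ] x = cx x 0 := by simp [cx]

lemma neg_cx (x y : V) : -cx x y = cx (-x) (-y) := by
  simp only [cx, TensorProduct.tmul_neg]; abel

lemma smul_cx (c : ℂ) (x y : V) :
    c • cx x y = cx (c.re • x - c.im • y) (c.im • x + c.re • y) := by
  have h1 : (c : ℂ) ⊗ₜ[ℝ] x = cx (c.re • x) (c.im • x) := by
    rw [cx, ← TensorProduct.smul_tmul, ← TensorProduct.smul_tmul, ← TensorProduct.add_tmul]
    congr 1
    simp
  have h2 : (c * I : ℂ) ⊗ₜ[ℝ] y = cx (-(c.im • y)) (c.re • y) := by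
    rw [cx, ← neg_smul, ← TensorProduct.smul_tmul, ← TensorProduct.smul_tmul,
      ← TensorProduct.add_tmul]
    congr 1
    apply Complex.ext <;> simp
  rw [cx, smul_add, TensorProduct.smul_tmul', TensorProduct.smul_tmul', smul_eq_mul, smul_eq_mul,
    mul_one, h1, h2]
  simp only [cx, TensorProduct.tmul_add, TensorProduct.tmul_sub, TensorProduct.tmul_neg]
  abel

lemma neg_I_smul_cx (x y : V) : -I • cx x y = cx y (-x) := by
  rw [smul_cx]; simp

lemma cx_mem_baseChange {S : Submodule ℝ V} {x y : V} :
    cx x y ∈ S.baseChange ℂ ↔ x ∈ S ∧ y ∈ S := by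
  constructor
  · intro h
    have key : ∀ z ∈ S.baseChange ℂ, ∃ x ∈ S, ∃ y ∈ S, z = cx x y := by
      intro z hz
      rw [Submodule.baseChange_eq_span] at hz
      induction hz using Submodule.span_induction with
      | mem z hz =>
        obtain ⟨x, hx, rfl⟩ := hz
        exact ⟨x, hx, 0, S.zero_mem, one_tmul_eq_cx x⟩
      | zero => exact ⟨0, S.zero_mem, 0, S.zero_mem, by simp [cx]⟩
      | add z w _ _ hz hw =>
        obtain ⟨x, hx, y, hy, rfl⟩ := hz
        obtain ⟨x', hx', y', hy', rfl⟩ := hw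
        exact ⟨x + x', S.add_mem hx hx', y + y', S.add_mem hy hy', by
          simp only [cx, TensorProduct.tmul_add]; abel⟩
      | smul c z _ hz =>
        obtain ⟨x, hx, y, hy, rfl⟩ := hz
        exact ⟨_, S.sub_mem (S.smul_mem _ hx) (S.smul_mem _ hy), _,
          S.add_mem (S.smul_mem _ hx) (S.smul_mem _ hy), smul_cx c x y⟩
    obtain ⟨x', hx', y', hy', e⟩ := key _ h
    obtain ⟨rfl, rfl⟩ := cx_inj.1 e
    exact ⟨hx', hy'⟩
  · exact fun h => add_mem (Submodule.tmul_mem_baseChange_of_mem _ h.1)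
      (Submodule.tmul_mem_baseChange_of_mem _ h.2)

end Module

variable {L : Type*} [LieRing L] [LieAlgebra ℝ L]

/-- The bracket of the complexification, in the form in which the lemmas on Lie rings apply. -/
local instance bracketComplex : Bracket (ℂ ⊗[ℝ] L) (ℂ ⊗[ℝ] L) :=
  LieRingModule.toBracket (self := lieRingSelfModule)

lemma lie_tmul (s t : ℂ) (x y : L) :
    ⁅(s ⊗ₜ[ℝ] x : ℂ ⊗[ℝ] L), (t ⊗ₜ[ℝ] y : ℂ ⊗[ℝ] L)⁆ = (s * t) ⊗ₜ[ℝ] ⁅x, y⁆ := rfl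

lemma one_tmul_lie_one_tmul (x y : L) :
    ⁅((1 : ℂ) ⊗ₜ[ℝ] x : ℂ ⊗[ℝ] L), ((1 : ℂ) ⊗ₜ[ℝ] y : ℂ ⊗[ℝ] L)⁆ = (1 : ℂ) ⊗ₜ[ℝ] ⁅x, y⁆ := by
  rw [lie_tmul, one_mul]

lemma one_tmul_lie_cx (w x y : L) :
    ⁅((1 : ℂ) ⊗ₜ[ℝ] w : ℂ ⊗[ℝ] L), cx x y⁆ = cx ⁅w, x⁆ ⁅w, y⁆ := by
  rw [cx, lie_add, lie_tmul, lie_tmul, one_mul, one_mul, cx]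

/-- A Lie algebra endomorphism acts on brackets in the complexification. -/
lemma baseChange_lie {T S T' : L →ₗ[ℝ] L} {w : L} (h : ∀ x, T ⁅w, x⁆ = ⁅S w, T' x⁆)
    (z : ℂ ⊗[ℝ] L) :
    T.baseChange ℂ ⁅((1 : ℂ) ⊗ₜ[ℝ] w : ℂ ⊗[ℝ] L), z⁆ =
      ⁅((1 : ℂ) ⊗ₜ[ℝ] S w : ℂ ⊗[ℝ] L), T'.baseChange ℂ z⁆ := by
  induction z with
  | zero => simp
  | tmul c x => rw [lie_tmul, LinearMap.baseChange_tmul, LinearMap.baseChange_tmul, lie_tmul, h]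
  | add z w hz hw => rw [lie_add, map_add, map_add, lie_add, hz, hw]

variable [FiniteDimensional ℝ L]

lemma killingForm_tmul (s t : ℂ) (x y : L) :
    killingForm ℂ (ℂ ⊗[ℝ] L) (s ⊗ₜ[ℝ] x) (t ⊗ₜ[ℝ] y) = s * t * (killingForm ℝ L x y : ℝ) := by
  have h1 : ∀ (c : ℂ) (x : L), c ⊗ₜ[ℝ] x = c • ((1 : ℂ) ⊗ₜ[ℝ] x) := fun c x => by
    rw [TensorProduct.smul_tmul', smul_eq_mul, mul_one]
  have h2 : ∀ x : L, LieAlgebra.ad ℂ (ℂ ⊗[ℝ] L) ((1 : ℂ) ⊗ₜ[ℝ] x) =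
      (LieAlgebra.ad ℝ L x).baseChange ℂ := fun x => LieModule.toEnd_baseChange (R := ℝ) (A := ℂ) (L := L) (M := L) x
  have h3 : killingForm ℂ (ℂ ⊗[ℝ] L) ((1 : ℂ) ⊗ₜ[ℝ] x) ((1 : ℂ) ⊗ₜ[ℝ] y) =
      (killingForm ℝ L x y : ℝ) := by
    rw [killingForm_apply_apply, killingForm_apply_apply, h2, h2, ← LinearMap.baseChange_comp,
      LinearMap.trace_baseChange]
    rfl
  rw [h1 s, h1 t, map_smul, map_smul, LinearMap.smul_apply, h3]
  simp only [smul_eq_mul]; ring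

lemma killingForm_cx_one_tmul (x y w : L) :
    killingForm ℂ (ℂ ⊗[ℝ] L) (cx x y) ((1 : ℂ) ⊗ₜ[ℝ] w) =
      (killingForm ℝ L x w : ℝ) + (killingForm ℝ L y w : ℝ) * I := by
  rw [cx, map_add, LinearMap.add_apply, killingForm_tmul, killingForm_tmul]; ring

lemma killingForm_cx_one_tmul_eq_zero {x y w : L} :
    killingForm ℂ (ℂ ⊗[ℝ] L) (cx x y) ((1 : ℂ) ⊗ₜ[ℝ] w) = 0 ↔
      killingForm ℝ L x w = 0 ∧ killingForm ℝ L y w = 0 := by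
  rw [killingForm_cx_one_tmul, Complex.ext_iff]; simp

namespace IsCartanInv

variable {θ : L ≃ₗ⁅ℝ⁆ L} (hθ : IsCartanInv θ)
include hθ

lemma nondeg_complex (z : ℂ ⊗[ℝ] L) (h : ∀ w, killingForm ℂ (ℂ ⊗[ℝ] L) z w = 0) : z = 0 := by
  obtain ⟨x, y, rfl⟩ := exists_cx z
  have h1 := fun w : L => killingForm_cx_one_tmul_eq_zero.1 (h ((1 : ℂ) ⊗ₜ[ℝ] w))
  rw [hθ.nondeg x fun w => (h1 w).1, hθ.nondeg y fun w => (h1 w).2]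
  simp [cx]

omit hθ in
variable (θ) in
/-- The conjugate linear extension of `θ`. -/
def conjTheta : ℂ ⊗[ℝ] L →ₗ[ℝ] ℂ ⊗[ℝ] L :=
  TensorProduct.map (Complex.conjAe : ℂ ≃ₐ[ℝ] ℂ).toLinearMap (θ.toLinearEquiv : L →ₗ[ℝ] L)

omit hθ [FiniteDimensional ℝ L] in
lemma conjTheta_tmul (c : ℂ) (x : L) :
    conjTheta θ (c ⊗ₜ[ℝ] x) = (starRingEnd ℂ c) ⊗ₜ[ℝ] θ x := rfl

omit hθ [FiniteDimensional ℝ L] in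
lemma conjTheta_smul (c : ℂ) (z : ℂ ⊗[ℝ] L) :
    conjTheta θ (c • z) = (starRingEnd ℂ c) • conjTheta θ z := by
  induction z with
  | zero => simp
  | tmul d x =>
    rw [TensorProduct.smul_tmul', conjTheta_tmul, conjTheta_tmul, TensorProduct.smul_tmul',
      smul_eq_mul, smul_eq_mul, map_mul]
  | add z w hz hw => rw [smul_add, map_add, hz, hw, map_add, smul_add]

omit [FiniteDimensional ℝ L] in
lemma lie_conjTheta (H : L) (z : ℂ ⊗[ℝ] L) :
    ⁅((1 : ℂ) ⊗ₜ[ℝ] H : ℂ ⊗[ℝ] L), conjTheta θ z⁆ =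
      conjTheta θ ⁅((1 : ℂ) ⊗ₜ[ℝ] θ H : ℂ ⊗[ℝ] L), z⁆ := by
  induction z with
  | zero => simp
  | tmul d x =>
    rw [conjTheta_tmul, lie_tmul, lie_tmul, conjTheta_tmul, LieEquiv.map_lie, hθ.involutive,
      one_mul, one_mul]
  | add z w hz hw => rw [map_add, lie_add, hz, hw, lie_add, map_add]

/-- For z = x + iy the value is B(x, θx) + B(y, θy), so this Hermitian form is definite. -/
lemma eq_zero_of_killing_conjTheta {z : ℂ ⊗[ℝ] L}
    (h : killingForm ℂ (ℂ ⊗[ℝ] L) z (conjTheta θ z) = 0) : z = 0 := by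
  obtain ⟨x, y, rfl⟩ := exists_cx z
  have h1 : killingForm ℂ (ℂ ⊗[ℝ] L) (cx x y) (conjTheta θ (cx x y)) =
      ((killingForm ℝ L x (θ x) + killingForm ℝ L y (θ y) : ℝ) : ℂ) := by
    have h2 : killingForm ℝ L y (θ x) = killingForm ℝ L x (θ y) := by
      rw [← hθ.killing_theta_left, killing_comm]
    have h3 : I * I = -1 := I_mul_I
    simp only [cx, map_add, LinearMap.add_apply, conjTheta_tmul, killingForm_tmul, map_one, conj_I,
      h2]
    push_cast
    linear_combination (-(killingForm ℝ L y (θ y) : ℂ)) * h3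
  rw [h1, ofReal_eq_zero] at h
  have hx := hθ.killing_theta_nonpos x
  have hy := hθ.killing_theta_nonpos y
  have hx0 : x = 0 := by
    by_contra h0
    have := hθ.posDef x h0
    linarith
  have hy0 : y = 0 := by
    by_contra h0
    have := hθ.posDef y h0
    linarith
  rw [hx0, hy0]
  simp [cx]

-- For the Hermitian form of `conjTheta`, the adjoint of ad H - μ is minus (ad θH + conj μ).
omit [FiniteDimensional ℝ L] in
lemma killing_sub_conjTheta (H : L) (μ : ℂ) (u w : ℂ ⊗[ℝ] L) :
    killingForm ℂ (ℂ ⊗[ℝ] L) (⁅((1 : ℂ) ⊗ₜ[ℝ] H : ℂ ⊗[ℝ] L), u⁆ - μ • u) (conjTheta θ w) =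
      -killingForm ℂ (ℂ ⊗[ℝ] L) u
        (conjTheta θ (⁅((1 : ℂ) ⊗ₜ[ℝ] θ H : ℂ ⊗[ℝ] L), w⁆ + (starRingEnd ℂ μ) • w)) := by
  have h1 : killingForm ℂ (ℂ ⊗[ℝ] L) ⁅((1 : ℂ) ⊗ₜ[ℝ] H : ℂ ⊗[ℝ] L), u⁆ (conjTheta θ w) =
      -killingForm ℂ (ℂ ⊗[ℝ] L) u ⁅((1 : ℂ) ⊗ₜ[ℝ] H : ℂ ⊗[ℝ] L), conjTheta θ w⁆ := by
    rw [← lie_skew, map_neg, LinearMap.neg_apply, killingForm_lie_left]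
  rw [map_sub, LinearMap.sub_apply, h1, map_add, map_add, hθ.lie_conjTheta, conjTheta_smul,
    Complex.conj_conj, map_smul, map_smul, LinearMap.smul_apply]
  ring

/-- The elements of a `θ`-stable Cartan subalgebra act semisimply. -/
lemma sub_eq_zero_of_sub_sub {H : L} (hH : ⁅H, θ H⁆ = 0) {μ : ℂ} {y z : ℂ ⊗[ℝ] L}
    (hy : y = ⁅((1 : ℂ) ⊗ₜ[ℝ] H : ℂ ⊗[ℝ] L), z⁆ - μ • z)
    (h : ⁅((1 : ℂ) ⊗ₜ[ℝ] H : ℂ ⊗[ℝ] L), y⁆ - μ • y = 0) : y = 0 := by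
  have hcomm : ⁅((1 : ℂ) ⊗ₜ[ℝ] H : ℂ ⊗[ℝ] L), ⁅((1 : ℂ) ⊗ₜ[ℝ] θ H : ℂ ⊗[ℝ] L), y⁆⁆ =
      ⁅((1 : ℂ) ⊗ₜ[ℝ] θ H : ℂ ⊗[ℝ] L), ⁅((1 : ℂ) ⊗ₜ[ℝ] H : ℂ ⊗[ℝ] L), y⁆⁆ := by
    rw [leibniz_lie, one_tmul_lie_one_tmul, hH, TensorProduct.tmul_zero, zero_lie, zero_add]
  -- The operator T = ad H - μ is normal because H and θH commute. So Ty = 0 forces its adjoint to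
  -- kill y, and y = Tz is then orthogonal to itself.
  have hw : ⁅((1 : ℂ) ⊗ₜ[ℝ] θ H : ℂ ⊗[ℝ] L), y⁆ + (starRingEnd ℂ μ) • y = 0 := by
    refine hθ.eq_zero_of_killing_conjTheta ?_
    have h1 := hθ.killing_sub_conjTheta (θ H) (-(starRingEnd ℂ μ)) y
      (⁅((1 : ℂ) ⊗ₜ[ℝ] θ H : ℂ ⊗[ℝ] L), y⁆ + (starRingEnd ℂ μ) • y)
    rw [neg_smul, sub_neg_eq_add] at h1
    rw [h1, hθ.involutive, map_neg, Complex.conj_conj, lie_add, lie_smul, hcomm, sub_eq_zero.1 h,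
      lie_smul]
    have h2 : μ • ⁅((1 : ℂ) ⊗ₜ[ℝ] θ H : ℂ ⊗[ℝ] L), y⁆ + (starRingEnd ℂ μ) • μ • y +
        -μ • (⁅((1 : ℂ) ⊗ₜ[ℝ] θ H : ℂ ⊗[ℝ] L), y⁆ + (starRingEnd ℂ μ) • y) = 0 := by module
    rw [h2, map_zero, map_zero, neg_zero]
  refine hθ.eq_zero_of_killing_conjTheta ?_
  conv_lhs => rw [hy]
  have h3 := hθ.killing_sub_conjTheta H μ z y
  rw [hw, map_zero, map_zero, neg_zero] at h3
  rw [← h3, ← hy]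

/-- Eigenvalues of elements of `𝔭₀` are real. -/
lemma im_eq_zero {H : L} (hH : θ H = -H) {μ : ℂ} {z : ℂ ⊗[ℝ] L} (hz : z ≠ 0)
    (h : ⁅((1 : ℂ) ⊗ₜ[ℝ] H : ℂ ⊗[ℝ] L), z⁆ = μ • z) : μ.im = 0 := by
  have h1 := hθ.killing_sub_conjTheta H μ z z
  rw [h, sub_self, map_zero, LinearMap.zero_apply, hH, TensorProduct.tmul_neg, neg_lie, h,
    ← neg_smul, ← add_smul, conjTheta_smul, map_smul, smul_eq_mul, eq_comm, neg_eq_zero] at h1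
  have h2 := (mul_eq_zero.1 h1).resolve_right fun h0 => hz (hθ.eq_zero_of_killing_conjTheta h0)
  have h3 := congrArg Complex.im h2
  simp at h3
  linarith

end IsCartanInv

end Complexification

/-! ### The subspaces of the statement in terms of the triple and Z. -/

section Modules

open Complex

attribute [local instance] bracketComplex

section Real

variable {L : Type*} [LieRing L] [LieAlgebra ℝ L]

lemma one_tmul_smul {V : Type*} [AddCommGroup V] [Module ℝ V] (r : ℝ) (x : V) :
    (1 : ℂ) ⊗ₜ[ℝ] (r • x) = (r : ℂ) • ((1 : ℂ) ⊗ₜ[ℝ] x) := by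
  rw [← TensorProduct.smul_tmul, TensorProduct.smul_tmul', smul_eq_mul, mul_one, Complex.real_smul,
    mul_one]

lemma one_tmul_smul_lie (r : ℝ) (x : L) (y : ℂ ⊗[ℝ] L) :
    ⁅((1 : ℂ) ⊗ₜ[ℝ] (r • x) : ℂ ⊗[ℝ] L), y⁆ = (r : ℂ) • ⁅((1 : ℂ) ⊗ₜ[ℝ] x : ℂ ⊗[ℝ] L), y⁆ := by
  rw [one_tmul_smul]
  exact smul_lie (r : ℂ) ((1 : ℂ) ⊗ₜ[ℝ] x : ℂ ⊗[ℝ] L) y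

lemma one_tmul_add_lie (x x' : L) (y : ℂ ⊗[ℝ] L) :
    ⁅((1 : ℂ) ⊗ₜ[ℝ] (x + x') : ℂ ⊗[ℝ] L), y⁆ =
      ⁅((1 : ℂ) ⊗ₜ[ℝ] x : ℂ ⊗[ℝ] L), y⁆ + ⁅((1 : ℂ) ⊗ₜ[ℝ] x' : ℂ ⊗[ℝ] L), y⁆ := by
  rw [TensorProduct.tmul_add, add_lie]

lemma one_tmul_lie_comm {x y : L} (h : ⁅x, y⁆ = 0) (z : ℂ ⊗[ℝ] L) :
    ⁅((1 : ℂ) ⊗ₜ[ℝ] x : ℂ ⊗[ℝ] L), ⁅((1 : ℂ) ⊗ₜ[ℝ] y : ℂ ⊗[ℝ] L), z⁆⁆ =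
      ⁅((1 : ℂ) ⊗ₜ[ℝ] y : ℂ ⊗[ℝ] L), ⁅((1 : ℂ) ⊗ₜ[ℝ] x : ℂ ⊗[ℝ] L), z⁆⁆ := by
  rw [leibniz_lie, one_tmul_lie_one_tmul, h, TensorProduct.tmul_zero, zero_lie, zero_add]

/-- An element that is killed by `h`, `e` and `Z² + 1` commutes with the vectors of weight `2` that
commute with `b`. -/
lemma HermitianTriple.lie_eq_zero {𝔤 : Type*} [LieRing 𝔤] [LieAlgebra ℂ 𝔤] [FiniteDimensional ℂ 𝔤]
    {e f h b x y : 𝔤} (t : HermitianTriple e f h b) (hx : ⁅h, x⁆ = 0) (hex : ⁅e, x⁆ = 0)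
    (hZx : ⁅b + (1 / 2 : ℂ) • (e - f), ⁅b + (1 / 2 : ℂ) • (e - f), x⁆⁆ = -x)
    (hy1 : ⁅h, y⁆ = (2 : ℂ) • y) (hy2 : ⁅b, y⁆ = 0) : ⁅x, y⁆ = 0 := by
  have hfx := t.lie_f_eq_zero hx hex
  have hbb : ⁅b, ⁅b, x⁆⁆ = -x := by
    have hex' : ⁅e, ⁅b, x⁆⁆ = 0 := by
      rw [leibniz_lie, ← lie_skew e b, t.be, hex, neg_zero, zero_lie, lie_zero, add_zero]
    have hfx' : ⁅f, ⁅b, x⁆⁆ = 0 := by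
      rw [leibniz_lie, ← lie_skew f b, t.bf, hfx, neg_zero, zero_lie, lie_zero, add_zero]
    simpa only [add_lie, smul_lie, sub_lie, hex, hfx, sub_zero, smul_zero, add_zero, hex', hfx']
      using hZx
  have hw : ⁅h, ⁅x, y⁆⁆ = (2 : ℂ) • ⁅x, y⁆ := by
    rw [leibniz_lie, hx, zero_lie, zero_add, hy1, lie_smul]
  obtain ⟨hA, hB⟩ := t.opA_of_weight_two hw
  have hbw : ⁅b, ⁅x, y⁆⁆ = 0 := by
    rw [HermitianTriple.lie_b (h := h), hA, hB]; module
  -- Since b kills y, [x, y] = -[[b, [b, x]], y] = -[b, [b, [x, y]]], and b kills [x, y], which has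
  -- weight 2.
  have h3 : ∀ z : 𝔤, ⁅b, ⁅z, y⁆⁆ = ⁅⁅b, z⁆, y⁆ := fun z => by
    rw [leibniz_lie, hy2, lie_zero, add_zero]
  have h4 := h3 ⁅b, x⁆
  rw [← h3 x, hbw, lie_zero, hbb, neg_lie, eq_comm, neg_eq_zero] at h4
  exact h4

variable {θ : L ≃ₗ⁅ℝ⁆ L}

lemma theta_lie_of_center (hinv : ∀ X, θ (θ X) = X) {Z : L} (hZ : θ Z = Z)
    (hZk : ∀ W, θ W = W → ⁅Z, W⁆ = 0) (X : L) : θ ⁅Z, X⁆ = -⁅Z, X⁆ := by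
  have h1 := hZk (X + θ X) (by rw [map_add, hinv, add_comm])
  rw [lie_add] at h1
  rw [LieEquiv.map_lie, hZ]
  exact (neg_eq_of_add_eq_zero_right h1).symm

lemma center_lie_cube (hinv : ∀ X, θ (θ X) = X) {Z : L} (hZ : θ Z = Z)
    (hZk : ∀ W, θ W = W → ⁅Z, W⁆ = 0) (hZp : ∀ X, θ X = -X → ⁅Z, ⁅Z, X⁆⁆ = -X) (X : L) :
    ⁅Z, ⁅Z, ⁅Z, X⁆⁆⁆ = -⁅Z, X⁆ :=
  hZp _ (theta_lie_of_center hinv hZ hZk X)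

/-- The complexified `𝔰𝔩₂`-triple of the real root. -/
lemma hermitianTriple_of_real (hinv : ∀ X, θ (θ X) = X) {Z : L} (hZ : θ Z = Z)
    (hZk : ∀ W, θ W = W → ⁅Z, W⁆ = 0) (hZp : ∀ X, θ X = -X → ⁅Z, ⁅Z, X⁆⁆ = -X) {e b h : L}
    (hh : θ h = -h) (hef : ⁅e, -θ e⁆ = h) (he : ⁅h, e⁆ = (2 : ℝ) • e) (hbe : ⁅b, e⁆ = 0)
    (hbf : ⁅b, θ e⁆ = 0) (hZb : Z = b + (1 / 2 : ℝ) • (e + θ e)) :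
    (1 : ℂ) ⊗ₜ[ℝ] Z = (1 : ℂ) ⊗ₜ[ℝ] b +
      (1 / 2 : ℂ) • ((1 : ℂ) ⊗ₜ[ℝ] e - (1 : ℂ) ⊗ₜ[ℝ] (-θ e)) ∧
    HermitianTriple ((1 : ℂ) ⊗ₜ[ℝ] e : ℂ ⊗[ℝ] L) ((1 : ℂ) ⊗ₜ[ℝ] (-θ e)) ((1 : ℂ) ⊗ₜ[ℝ] h)
      ((1 : ℂ) ⊗ₜ[ℝ] b) := by
  have hZC : (1 : ℂ) ⊗ₜ[ℝ] Z = (1 : ℂ) ⊗ₜ[ℝ] b +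
      (1 / 2 : ℂ) • ((1 : ℂ) ⊗ₜ[ℝ] e - (1 : ℂ) ⊗ₜ[ℝ] (-θ e)) := by
    rw [hZb, TensorProduct.tmul_add, one_tmul_smul, ← TensorProduct.tmul_sub, sub_neg_eq_add]
    push_cast
    rfl
  have hf : ⁅h, -θ e⁆ = (-2 : ℝ) • -θ e := by
    have h1 := congrArg θ he
    rw [LieEquiv.map_lie, hh, map_smul, neg_lie] at h1
    rw [lie_neg, h1]
    module
  refine ⟨hZC, ⟨?_, ?_, ?_, ?_, ?_, ?_⟩⟩
  · rw [one_tmul_lie_one_tmul, hef]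
  · rw [one_tmul_lie_one_tmul, he, one_tmul_smul]
    norm_num
  · rw [one_tmul_lie_one_tmul, hf, one_tmul_smul]
    norm_num
  · rw [one_tmul_lie_one_tmul, hbe, TensorProduct.tmul_zero]
  · rw [one_tmul_lie_one_tmul, lie_neg, hbf, neg_zero, TensorProduct.tmul_zero]
  · intro x
    rw [← hZC]
    obtain ⟨y, z, rfl⟩ := exists_cx x
    simp only [one_tmul_lie_cx, center_lie_cube hinv hZ hZk hZp, neg_cx]

end Real

variable {n : ℕ} {G : Type*} [TopologicalSpace G] [ChartedSpace (EuclideanSpace ℝ (Fin n)) G]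
  [Group G] [LieGroup (𝓡 n) ∞ G] {θ : RLie n G ≃ₗ⁅ℝ⁆ RLie n G} {𝔥 : LieSubalgebra ℝ (RLie n G)}

lemma mem_rootSp {α : 𝔥 →ₗ[ℝ] ℂ} {x : CLie n G} :
    x ∈ rootSp α ↔ ∀ H : 𝔥, ⁅((1 : ℂ) ⊗ₜ[ℝ] (H : RLie n G) : CLie n G), x⁆ = α H • x := by
  rw [rootSp, Submodule.mem_iInf]
  exact forall_congr' fun H => Module.End.mem_eigenspace_iff

lemma mem_aR {X : RLie n G} : X ∈ aR n θ 𝔥 ↔ X ∈ 𝔥 ∧ θ X = -X := by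
  rw [aR, Submodule.mem_inf, mem_pR]; rfl

section Center

variable {Z : RLie n G} (hinv : ∀ X, θ (θ X) = X) (hZ : θ Z = Z)
  (hZk : ∀ W, θ W = W → ⁅Z, W⁆ = 0)
include hinv hZ hZk

/-- ad Z maps 𝔤₀ into 𝔭₀, so an eigenvector for a nonzero eigenvalue lies in 𝔭 automatically. -/
lemma mem_pMinus_iff {J : pR n θ →ₗ[ℝ] pR n θ} (hZJ : ∀ X : pR n θ, ⁅Z, (X : RLie n G)⁆ = J X)
    {x : CLie n G} : x ∈ pMinus n θ J ↔ ⁅((1 : ℂ) ⊗ₜ[ℝ] Z : CLie n G), x⁆ = -I • x := by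
  constructor
  · rintro ⟨y, hy, rfl⟩
    rw [SetLike.mem_coe, Module.End.mem_eigenspace_iff] at hy
    obtain ⟨u, v, rfl⟩ := exists_cx y
    rw [← map_smul, ← hy]
    simp only [cx, map_add, LinearMap.baseChange_tmul, Submodule.subtype_apply, ← hZJ]
    exact one_tmul_lie_cx Z _ _
  · intro hx
    obtain ⟨u, v, rfl⟩ := exists_cx x
    rw [one_tmul_lie_cx, neg_I_smul_cx, cx_inj] at hx
    have hv : θ v = -v := by rw [← hx.1]; exact theta_lie_of_center hinv hZ hZk u
    have hu : θ u = -u := by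
      rw [← neg_neg u, ← hx.2, map_neg, theta_lie_of_center hinv hZ hZk]
    refine ⟨cx ⟨u, mem_pR.2 hu⟩ ⟨v, mem_pR.2 hv⟩, ?_, ?_⟩
    · rw [SetLike.mem_coe, Module.End.mem_eigenspace_iff, neg_I_smul_cx]
      simp only [cx, map_add, LinearMap.baseChange_tmul]
      congr 2
      · exact Subtype.ext ((hZJ _).symm.trans hx.1)
      · exact Subtype.ext ((hZJ _).symm.trans hx.2)
    · simp only [cx, map_add, LinearMap.baseChange_tmul, Submodule.subtype_apply]

/-- The equation (ad Z)² = -1 cuts out 𝔭; since 𝔞₀ is the line of h, the other two conditions cut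
out 𝔪. -/
lemma mem_pM_iff (hZp : ∀ X, θ X = -X → ⁅Z, ⁅Z, X⁆⁆ = -X) {h : RLie n G} (hh : h ∈ aR n θ 𝔥)
    (hone : ∀ H ∈ aR n θ 𝔥, ∃ r : ℝ, H = r • h) {x : CLie n G} :
    x ∈ pM θ 𝔥 ↔ ⁅((1 : ℂ) ⊗ₜ[ℝ] h : CLie n G), x⁆ = 0 ∧
      ⁅((1 : ℂ) ⊗ₜ[ℝ] Z : CLie n G), ⁅((1 : ℂ) ⊗ₜ[ℝ] Z : CLie n G), x⁆⁆ = -x ∧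
      killingForm ℂ (CLie n G) x ((1 : ℂ) ⊗ₜ[ℝ] h) = 0 := by
  have key : ∀ X : RLie n G, X ∈ mR n θ 𝔥 ⊓ pR n θ ↔
      ⁅h, X⁆ = 0 ∧ ⁅Z, ⁅Z, X⁆⁆ = -X ∧ kf n G X h = 0 := by
    intro X
    rw [Submodule.mem_inf, mem_pR]
    constructor
    · rintro ⟨⟨h1, h2⟩, h3⟩
      exact ⟨h1 h hh, hZp X h3, h2 h hh⟩
    · rintro ⟨h1, h2, h3⟩
      refine ⟨⟨fun H hH => ?_, fun H hH => ?_⟩, ?_⟩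
      · obtain ⟨r, rfl⟩ := hone H hH
        rw [smul_lie, h1, smul_zero]
      · obtain ⟨r, rfl⟩ := hone H hH
        rw [map_smul, h3, smul_zero]
      · rw [← neg_neg X, ← h2, map_neg, theta_lie_of_center hinv hZ hZk]
  obtain ⟨u, v, rfl⟩ := exists_cx x
  rw [pM, cx_mem_baseChange, key, key, one_tmul_lie_cx, one_tmul_lie_cx, one_tmul_lie_cx, neg_cx,
    cx_inj, killingForm_cx_one_tmul_eq_zero, ← show cx (0 : RLie n G) 0 = 0 by simp [cx], cx_inj]
  tauto

end Center

/-- One root vector e tests the whole root space, by `HermitianTriple.lie_eq_zero`; the dimension of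
the root space is not needed. -/
lemma mem_pM2_iff {αr : 𝔥 →ₗ[ℝ] ℂ} {e f h b : CLie n G} (t : HermitianTriple e f h b)
    (he : e ∈ rootSp αr) (hY : ∀ y ∈ rootSp αr, ⁅h, y⁆ = (2 : ℂ) • y ∧ ⁅b, y⁆ = 0)
    (hpM : ∀ x ∈ pM θ 𝔥, ⁅h, x⁆ = 0 ∧
      ⁅b + (1 / 2 : ℂ) • (e - f), ⁅b + (1 / 2 : ℂ) • (e - f), x⁆⁆ = -x) {x : CLie n G} :
    x ∈ pM2 θ αr ↔ x ∈ pM θ 𝔥 ∧ ⁅e, x⁆ = 0 := by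
  constructor
  · rintro ⟨h1, h2⟩
    refine ⟨h1, ?_⟩
    rw [← lie_skew, neg_eq_zero]
    exact h2 e he
  · rintro ⟨h1, h2⟩
    refine ⟨h1, fun y hy => ?_⟩
    exact t.lie_eq_zero (hpM x h1).1 h2 (hpM x h1).2 (hY y hy).1 (hY y hy).2

/-- 𝔭_{M₂} is the complexification of a subspace of 𝔭₀, because e is real. On 𝔭₀ the Killing form is
positive definite, so the real and imaginary parts vanish separately. -/
lemma eq_zero_of_mem_pM1_pM2 (hθ : IsCartanInv θ) {αr : 𝔥 →ₗ[ℝ] ℂ} {e : RLie n G}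
    (hpM2 : ∀ x, x ∈ pM2 θ αr ↔ x ∈ pM θ 𝔥 ∧ ⁅((1 : ℂ) ⊗ₜ[ℝ] e : CLie n G), x⁆ = 0)
    {x : CLie n G} (h1 : x ∈ pM1 θ αr) (h2 : x ∈ pM2 θ αr) : x = 0 := by
  obtain ⟨u, v, rfl⟩ := exists_cx x
  obtain ⟨hp, he⟩ := (hpM2 _).1 h2
  rw [one_tmul_lie_cx, ← show cx (0 : RLie n G) 0 = 0 by simp [cx], cx_inj] at he
  rw [pM, cx_mem_baseChange] at hp
  have key : ∀ w : RLie n G, w ∈ mR n θ 𝔥 ⊓ pR n θ → ⁅e, w⁆ = 0 →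
      (1 : ℂ) ⊗ₜ[ℝ] w ∈ pM2 θ αr := by
    intro w hw hew
    refine (hpM2 _).2 ⟨?_, ?_⟩
    · exact Submodule.tmul_mem_baseChange_of_mem _ hw
    · rw [one_tmul_lie_one_tmul, hew, TensorProduct.tmul_zero]
  have hu := (killingForm_cx_one_tmul_eq_zero.1 (h1.2 _ (key u hp.1 he.1))).1
  have hv := (killingForm_cx_one_tmul_eq_zero.1 (h1.2 _ (key v hp.2 he.2))).2
  have hu0 : u = 0 := by
    by_contra h0
    exact (hθ.pos_of_p (mem_pR.1 hp.1.2) h0).ne' hu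
  have hv0 : v = 0 := by
    by_contra h0
    exact (hθ.pos_of_p (mem_pR.1 hp.2.2) h0).ne' hv
  rw [hu0, hv0]
  simp [cx]

/-- A `θ`-stable Cartan subalgebra acts semisimply. -/
lemma lie_eq_smul_of_mem_maxGenEigenspace (hθ : IsCartanInv θ) {H : RLie n G}
    (hH : ⁅H, θ H⁆ = 0) {μ : ℂ} {x : CLie n G}
    (hx : x ∈ (LieAlgebra.ad ℂ (CLie n G) ((1 : ℂ) ⊗ₜ[ℝ] H)).maxGenEigenspace μ) :
    ⁅((1 : ℂ) ⊗ₜ[ℝ] H : CLie n G), x⁆ = μ • x := by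
  obtain ⟨k, hk⟩ := (Module.End.mem_maxGenEigenspace _ _ _).1 hx
  set T : Module.End ℂ (CLie n G) :=
    LieAlgebra.ad ℂ (CLie n G) ((1 : ℂ) ⊗ₜ[ℝ] H) - μ • (1 : Module.End ℂ (CLie n G)) with hT
  have hTx : ∀ y, T y = ⁅((1 : ℂ) ⊗ₜ[ℝ] H : CLie n G), y⁆ - μ • y := fun y => rfl
  have h2 : ∀ y, T (T y) = 0 → T y = 0 := fun y hy =>
    hθ.sub_eq_zero_of_sub_sub hH (hTx y) ((hTx _).symm.trans hy)
  have h3 : ∀ k : ℕ, (T ^ (k + 1)) x = 0 → T x = 0 := by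
    intro k
    induction k with
    | zero => intro h; simpa using h
    | succ k ih =>
      intro h
      refine ih ?_
      rw [pow_succ', pow_succ', Module.End.mul_apply, Module.End.mul_apply] at h
      rw [pow_succ', Module.End.mul_apply]
      exact h2 _ h
  have h4 : T x = 0 := h3 k (by rw [pow_succ', Module.End.mul_apply, hk, map_zero])
  exact sub_eq_zero.1 ((hTx x).symm.trans h4)

lemma mem_nUpper_iff (hθ : IsCartanInv θ) {H₀ : 𝔥} (h𝔥 : SplitRankOne θ 𝔥 (H₀ : RLie n G))
    {αr : 𝔥 →ₗ[ℝ] ℂ} {c : ℝ} (hc : (c : ℂ) * αr H₀ = 2) {e f b : CLie n G}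
    (t : HermitianTriple e f ((1 : ℂ) ⊗ₜ[ℝ] (c • (H₀ : RLie n G))) b) {x : CLie n G} :
    x ∈ nUpper θ αr ↔ ⁅((1 : ℂ) ⊗ₜ[ℝ] (c • (H₀ : RLie n G)) : CLie n G), x⁆ = x := by
  have hweight : ∀ (β : 𝔥 →ₗ[ℝ] ℂ) (s : ℂ), β H₀ = s * αr H₀ → ∀ y ∈ rootSp β,
      ⁅((1 : ℂ) ⊗ₜ[ℝ] (c • (H₀ : RLie n G)) : CLie n G), y⁆ = (2 * s) • y := by
    intro β s hβ y hy
    rw [one_tmul_smul_lie, mem_rootSp.1 hy H₀, hβ, smul_smul]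
    congr 1
    linear_combination s * hc
  have hH₀ : (H₀ : RLie n G) ∈ aR n θ 𝔥 := mem_aR.2 ⟨h𝔥.mem, h𝔥.theta⟩
  let E : Submodule ℂ (CLie n G) :=
    Module.End.eigenspace (LieAlgebra.ad ℂ (CLie n G) ((1 : ℂ) ⊗ₜ[ℝ] (c • (H₀ : RLie n G)))) 1
  have hE : ∀ y, y ∈ E ↔ ⁅((1 : ℂ) ⊗ₜ[ℝ] (c • (H₀ : RLie n G)) : CLie n G), y⁆ = y := fun y => by
    rw [Module.End.mem_eigenspace_iff, one_smul]; rfl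
  constructor
  · intro hx
    rw [← hE]
    revert x
    change nUpper θ αr ≤ E
    refine sup_le (iSup_le ?_) (iSup_le ?_)
    · rintro ⟨β, hβ, hβ'⟩ y hy
      rw [hE, hweight β _ (hβ' H₀ hH₀) y hy]
      norm_num
    · rintro ⟨β, hβ, hβ'⟩ y hy
      -- The roots over 3/2 would give h-weight 3, which does not occur.
      have h0 : y = 0 := t.eq_zero_of_weight (hweight β _ (hβ' H₀ hH₀) y hy) (by norm_num)
        (by norm_num) (by norm_num)
      rw [h0]
      exact zero_mem _
  · intro hx
    have hmaps : ∀ (H : 𝔥), ∀ y ∈ E,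
        LieAlgebra.ad ℂ (CLie n G) ((1 : ℂ) ⊗ₜ[ℝ] (H : RLie n G)) y ∈ E := by
      intro H y hy
      rw [hE] at hy ⊢
      have h1 := one_tmul_lie_comm (h𝔥.abelian H H.2 (c • H₀) (𝔥.smul_mem c H₀.2)) y
      conv_rhs => rw [← hy]
      exact h1.symm
    let F : 𝔥 → Module.End ℂ E := fun H =>
      (LieAlgebra.ad ℂ (CLie n G) ((1 : ℂ) ⊗ₜ[ℝ] (H : RLie n G))).restrict (hmaps H)
    -- 𝔥₀ acts on the weight-one space E by commuting operators. By semisimplicity the generalized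
    -- joint eigenvectors are genuine ones, so each nonzero one defines a root over 1/2.
    have htop := Module.End.iSup_iInf_maxGenEigenspace_eq_top_of_iSup_maxGenEigenspace_eq_top_of_commute
      F (fun H H' _ => LinearMap.ext fun y => 
        Subtype.ext (one_tmul_lie_comm (h𝔥.abelian H H.2 H' H'.2) (y : CLie n G)))
      fun H => Module.End.iSup_maxGenEigenspace_eq_top (F H)
    have hle : (⊤ : Submodule ℂ E) ≤ (nUpper θ αr).comap E.subtype := by
      rw [← htop]
      refine iSup_le fun χ v hv => ?_
      rw [Submodule.mem_comap, Submodule.subtype_apply]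
      by_cases hv0 : (v : CLie n G) = 0
      · rw [hv0]; exact zero_mem _
      have hχ : ∀ H : 𝔥, ⁅((1 : ℂ) ⊗ₜ[ℝ] (H : RLie n G) : CLie n G), (v : CLie n G)⁆ =
          χ H • (v : CLie n G) := by
        intro H
        refine lie_eq_smul_of_mem_maxGenEigenspace hθ (h𝔥.abelian _ H.2 _ (h𝔥.stable _ H.2)) ?_
        have h1 := (Submodule.mem_iInf _).1 hv H
        have h2 := Module.End.genEigenspace_restrict
          (LieAlgebra.ad ℂ (CLie n G) ((1 : ℂ) ⊗ₜ[ℝ] (H : RLie n G))) E ⊤ (χ H) (hmaps H)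
        have h3 := h2.le h1
        exact h3
      have hinj : ∀ {a b : ℂ}, a • (v : CLie n G) = b • (v : CLie n G) → a = b := fun h =>
        smul_left_injective ℂ hv0 h
      let β : 𝔥 →ₗ[ℝ] ℂ :=
        { toFun := χ
          map_add' := fun H H' => hinj (by
            rw [← hχ, add_smul, ← hχ, ← hχ, ← one_tmul_add_lie]; rfl)
          map_smul' := fun r H => hinj (by
            rw [← hχ, RingHom.id_apply, Complex.real_smul, mul_smul, ← hχ,
              ← one_tmul_smul_lie]; rfl) }
      have hvβ : (v : CLie n G) ∈ rootSp β := mem_rootSp.2 hχ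
      have hβH : β H₀ = 1 / 2 * αr H₀ := by
        have h1 := (hE v).1 v.2
        rw [one_tmul_smul_lie, hχ, smul_smul] at h1
        have h2 : (c : ℂ) * χ H₀ = 1 := hinj (by rw [h1, one_smul])
        have hc0 : (c : ℂ) ≠ 0 := fun h0 => by rw [h0, zero_mul] at h2; exact zero_ne_one h2
        refine mul_left_cancel₀ hc0 (h2.trans ?_)
        linear_combination (-1 / 2 : ℂ) * hc
      have hβ0 : β ≠ 0 := by
        intro h0
        rw [h0, LinearMap.zero_apply] at hβH
        have : αr H₀ = 0 := by linear_combination (-2 : ℂ) * hβH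
        rw [this, mul_zero] at hc
        exact two_ne_zero hc.symm
      refine Submodule.mem_sup_left (Submodule.mem_iSup_of_mem
        (p := fun β : {β : 𝔥 →ₗ[ℝ] ℂ // IsRoot β ∧ ∀ H : 𝔥, (H : RLie n G) ∈ aR n θ 𝔥 →
          β H = 1 / 2 * αr H} => rootSp β.1)
        ⟨β, ⟨hβ0, fun h0 => hv0 ?_⟩, fun H hH => ?_⟩ hvβ)
      · rw [h0] at hvβ
        exact (Submodule.mem_bot ℂ).1 hvβ
      · obtain ⟨r, hr⟩ := h𝔥.rank_one H H.2 (mem_aR.1 hH).2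
        have hr' : H = r • H₀ := Subtype.ext hr
        rw [hr', map_smul, map_smul, hβH, Complex.real_smul, Complex.real_smul]
        ring
    exact hle (Submodule.mem_top (x := ⟨x, (hE x).2 hx⟩))

end Modules

/-! ### Equivariance under K_M and the conclusion. -/

section Main

open Complex

attribute [local instance] bracketComplex

/-- The root vector `e` is determined by `h` and `Z`. -/
lemma root_vector_eq {L : Type*} [LieRing L] [LieAlgebra ℝ L] {θ : L ≃ₗ⁅ℝ⁆ L} {Z e b h : L}
    (hh : θ h = -h) (he : ⁅h, e⁆ = (2 : ℝ) • e) (hbh : ⁅b, h⁆ = 0)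
    (hZb : Z = b + (1 / 2 : ℝ) • (e + θ e)) :
    e = (-1 / 4 : ℝ) • ⁅h, ⁅Z, h⁆⁆ - (1 / 2 : ℝ) • ⁅Z, h⁆ := by
  have he' : ⁅h, θ e⁆ = (-2 : ℝ) • θ e := by
    have h1 := congrArg θ he
    rw [LieEquiv.map_lie, hh, map_smul, neg_lie] at h1
    rw [← neg_neg ⁅h, θ e⁆, h1]
    module
  have hZh : ⁅Z, h⁆ = θ e - e := by
    rw [hZb, add_lie, hbh, smul_lie, add_lie, ← lie_skew, he, ← lie_skew, he']
    module
  rw [hZh, lie_sub, he, he']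
  module

variable {n : ℕ} {G : Type*} [TopologicalSpace G] [ChartedSpace (EuclideanSpace ℝ (Fin n)) G]
  [Group G] [LieGroup (𝓡 n) ∞ G] {θ : RLie n G ≃ₗ⁅ℝ⁆ RLie n G} {𝔥 : LieSubalgebra ℝ (RLie n G)}
  {K : Subgroup G}

lemma kmRep_lie (k : kmGroup n θ 𝔥 K) {w : RLie n G}
    (h : ∀ X, Ad n G (k : G) ⁅w, X⁆ = ⁅w, Ad n G (k : G) X⁆) (x : CLie n G) :
    kmRep n θ 𝔥 K k ⁅((1 : ℂ) ⊗ₜ[ℝ] w : CLie n G), x⁆ =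
      ⁅((1 : ℂ) ⊗ₜ[ℝ] w : CLie n G), kmRep n θ 𝔥 K k x⁆ :=
  baseChange_lie (T := Ad n G (k : G)) (S := LinearMap.id) (T' := Ad n G (k : G)) h x

lemma kmRep_one_tmul (k : kmGroup n θ 𝔥 K) (w : RLie n G) :
    kmRep n θ 𝔥 K k ((1 : ℂ) ⊗ₜ[ℝ] w) = (1 : ℂ) ⊗ₜ[ℝ] Ad n G (k : G) w := rfl

lemma killing_kmRep (k : kmGroup n θ 𝔥 K) (x y : CLie n G) :
    killingForm ℂ (CLie n G) (kmRep n θ 𝔥 K k x) (kmRep n θ 𝔥 K k y) =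
      killingForm ℂ (CLie n G) x y := by
  have h1 : ∀ (c : ℂ) (w : RLie n G), kmRep n θ 𝔥 K k (c ⊗ₜ[ℝ] w) = c ⊗ₜ[ℝ] Ad n G (k : G) w :=
    fun c w => rfl
  obtain ⟨u, v, rfl⟩ := exists_cx x
  obtain ⟨u', v', rfl⟩ := exists_cx y
  simp only [cx, map_add, LinearMap.add_apply, h1, killingForm_tmul, killing_Ad]

lemma Ad_eq_self_of_mem_kmGroup {k : G} (hk : k ∈ kmGroup n θ 𝔥 K) {H : RLie n G}
    (hH : H ∈ aR n θ 𝔥) : Ad n G k H = H := by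
  obtain ⟨l, -, rfl⟩ := hk.2
  exact l.2 H hH

/-- A real root vector in the centralizer of `𝔟₀`. -/
lemma exists_real_root_vector (hI : IsCartanInv θ) {αr : 𝔥 →ₗ[ℝ] ℂ} (hαr : IsRealRoot θ αr)
    {H₀ : 𝔥} (hH₀ : θ (H₀ : RLie n G) = -H₀) : αr H₀ = ((αr H₀).re : ℂ) ∧
      ∃ e₀ ∈ SplitRankOne.centB θ 𝔥, e₀ ≠ 0 ∧ ⁅(H₀ : RLie n G), e₀⁆ = (αr H₀).re • e₀ := by
  obtain ⟨v, hv, hv0⟩ := Submodule.exists_mem_ne_zero_of_ne_bot hαr.1.2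
  have him := hI.im_eq_zero hH₀ hv0 (mem_rootSp.1 hv H₀)
  refine ⟨Complex.ext (by simp) (by simpa using him), ?_⟩
  obtain ⟨u, w, rfl⟩ := exists_cx v
  have h1 := fun H => mem_rootSp.1 hv H
  simp only [one_tmul_lie_cx, smul_cx, cx_inj] at h1
  have hb : ∀ b ∈ 𝔥, θ b = b → ⁅b, u⁆ = 0 ∧ ⁅b, w⁆ = 0 := by
    intro b hb hbθ
    have h2 := h1 ⟨b, hb⟩
    rw [hαr.2 ⟨b, hb⟩ (mem_kR.2 hbθ)] at h2
    simpa using h2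
  have h3 := h1 H₀
  simp only [him, zero_smul, sub_zero, zero_add] at h3
  -- The root vanishes on 𝔟₀ and is real on H₀, so u and w satisfy the same equations separately;
  -- one of them is nonzero.
  by_cases hu : u = 0
  · have hw : w ≠ 0 := by
      rintro rfl
      rw [hu] at hv0
      exact hv0 (by simp [cx])
    exact ⟨w, fun b hb' hbθ => (hb b hb' hbθ).2, hw, h3.2⟩
  · exact ⟨u, fun b hb' hbθ => (hb b hb' hbθ).1, hu, h3.1⟩

/-- A root vector for the real root that commutes with `𝔟₀` lies in the root space. -/
lemma one_tmul_mem_rootSp (hI : IsCartanInv θ) {αr : 𝔥 →ₗ[ℝ] ℂ} (hαr : IsRealRoot θ αr)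
    {H₀ : 𝔥} (h𝔥 : SplitRankOne θ 𝔥 (H₀ : RLie n G)) (hre : αr H₀ = ((αr H₀).re : ℂ))
    {e : RLie n G} (he : e ∈ SplitRankOne.centB θ 𝔥) (he' : ⁅(H₀ : RLie n G), e⁆ = (αr H₀).re • e) :
    (1 : ℂ) ⊗ₜ[ℝ] e ∈ rootSp αr := by
  refine mem_rootSp.2 fun H => ?_
  have hθH := h𝔥.stable H H.2
  obtain ⟨s, hs⟩ := h𝔥.rank_one ((1 / 2 : ℝ) • ((H : RLie n G) - θ H))
    (𝔥.smul_mem _ (sub_mem H.2 hθH)) (by rw [map_smul, map_sub, hI.involutive]; module)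
  let b : 𝔥 := (1 / 2 : ℝ) • (H + ⟨θ H, hθH⟩)
  have hbθ : θ (b : RLie n G) = b := by
    change θ ((1 / 2 : ℝ) • ((H : RLie n G) + θ H)) = (1 / 2 : ℝ) • ((H : RLie n G) + θ H)
    rw [map_smul, map_add, hI.involutive, add_comm]
  have hH : H = s • H₀ + b := by
    refine Subtype.ext ?_
    change (H : RLie n G) = s • (H₀ : RLie n G) + (1 / 2 : ℝ) • ((H : RLie n G) + θ H)
    rw [← hs]
    module
  have h1 : αr H = ((s * (αr H₀).re : ℝ) : ℂ) := by
    conv_lhs => rw [hH, map_add, hαr.2 b (mem_kR.2 hbθ), add_zero, map_smul, Complex.real_smul, hre]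
    push_cast
    rfl
  have h2 : ⁅(H : RLie n G), e⁆ = (s * (αr H₀).re) • e := by
    conv_lhs => rw [hH]
    change ⁅s • (H₀ : RLie n G) + (b : RLie n G), e⁆ = _
    rw [add_lie, smul_lie, he', he b b.2 hbθ, add_zero, smul_smul]
  rw [one_tmul_lie_one_tmul, h2, one_tmul_smul, h1]

/-- The decomposition of `𝔫^α` and `𝔭₋` as `K_M`-modules. -/
theorem exists_kmRep_decomposition (hθ : IsCartanInvolution n θ K)
    {J : pR n θ →ₗ[ℝ] pR n θ} (hJ : IsInvariantComplexStructure n θ K J)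
    (h𝔥 : 𝔥.IsCartanSubalgebra) (h𝔥θ : ∀ X ∈ 𝔥, θ X ∈ 𝔥)
    (hrank : Module.finrank ℝ (aR n θ 𝔥) = 1) {H₀ : 𝔥} (hH₀ : (H₀ : RLie n G) ∈ aR n θ 𝔥)
    (hne : H₀ ≠ 0) {αr : 𝔥 →ₗ[ℝ] ℂ} (hαr : IsRealRoot θ αr) (hpos : 0 < (αr H₀).re) :
    ∃ N Pminus P1 P2minus Nminus : Subrepresentation (kmRep n θ 𝔥 K),
      N.toSubmodule = nUpper θ αr ∧
      Pminus.toSubmodule = pMinus n θ J ∧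
      P1.toSubmodule = pM1 θ αr ∧
      P2minus.toSubmodule = pM2 θ αr ⊓ pMinus n θ J ∧
      Nminus ≤ N ∧
      Nonempty (N.toRepresentation.Equiv
        (Nminus.toRepresentation.prod Nminus.toRepresentation.dual)) ∧
      Nonempty (Pminus.toRepresentation.Equiv
        ((Representation.trivial ℂ (kmGroup n θ 𝔥 K) ℂ).prod
          (P1.toRepresentation.prod
            (P2minus.toRepresentation.prod Nminus.toRepresentation)))) := by
  have hI := hθ.isCartanInv
  have hinv := hI.involutive
  obtain ⟨Z, hZ, hZk, hZJ, hZK⟩ := hθ.exists_center hJ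
  have hZp : ∀ X, θ X = -X → ⁅Z, ⁅Z, X⁆⁆ = -X := by
    intro X hX
    have h1 := hZJ ⟨X, mem_pR.2 hX⟩
    have h2 := hZJ (J ⟨X, mem_pR.2 hX⟩)
    rw [hJ.sq] at h2
    dsimp only at h1
    rw [h1, h2]
    rfl
  have hH₀θ := (mem_aR.1 hH₀).2
  have hH₀0 : (H₀ : RLie n G) ≠ 0 := fun h0 => hne (Subtype.ext h0)
  have hone : ∀ H ∈ aR n θ 𝔥, ∃ s : ℝ, H = s • (H₀ : RLie n G) := by
    intro H hH
    obtain ⟨s, hs⟩ := (finrank_eq_one_iff_of_nonzero' (⟨H₀, hH₀⟩ : aR n θ 𝔥)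
      (fun h0 => hH₀0 (congrArg Subtype.val h0))).1 hrank ⟨H, hH⟩
    exact ⟨s, (congrArg Subtype.val hs).symm⟩
  have hS : SplitRankOne θ 𝔥 (H₀ : RLie n G) :=
    SplitRankOne.of_cartan hI h𝔥θ H₀.2 hH₀θ hH₀0 fun H h1 h2 => hone H (mem_aR.2 ⟨h1, h2⟩)
  obtain ⟨hre, e₀, he₀, he₀0, he₀'⟩ := exists_real_root_vector hI hαr hH₀θ
  obtain ⟨e, b, c, hc0, ⟨a, rfl, ha⟩, hcr, hb, hbθ, hef, hhe, hbe, hbf, hZb⟩ :=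
    hS.exists_sl2 hI hZ hZk hZp hpos he₀ he₀0 he₀'
  have heR : (1 : ℂ) ⊗ₜ[ℝ] (a • e₀) ∈ rootSp αr :=
    one_tmul_mem_rootSp hI hαr hS hre (Submodule.smul_mem _ a he₀)
      (by rw [lie_smul, he₀', smul_comm])
  generalize a • e₀ = e at *
  have hcα : (c : ℂ) * αr H₀ = 2 := by
    rw [hre]
    exact_mod_cast hcr
  have hhθ : θ (c • (H₀ : RLie n G)) = -(c • (H₀ : RLie n G)) := by rw [map_smul, hH₀θ, smul_neg]
  have hh𝔥 : c • (H₀ : RLie n G) ∈ 𝔥 := 𝔥.smul_mem c H₀.2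
  have hha : c • (H₀ : RLie n G) ∈ aR n θ 𝔥 := mem_aR.2 ⟨hh𝔥, hhθ⟩
  have hhone : ∀ H ∈ aR n θ 𝔥, ∃ s : ℝ, H = s • c • (H₀ : RLie n G) := by
    intro H hH
    obtain ⟨s, rfl⟩ := hone H hH
    exact ⟨s / c, by rw [smul_smul, div_mul_cancel₀ _ hc0]⟩
  obtain ⟨hZC, t⟩ := hermitianTriple_of_real hinv hZ hZk hZp hhθ hef hhe hbe hbf hZb
  have mN := fun x => mem_nUpper_iff hI hS hcα t (x := x)
  have mPm := fun x => mem_pMinus_iff hinv hZ hZk hZJ (x := x)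
  have mP := fun x => mem_pM_iff hinv hZ hZk hZp hha hhone (x := x)
  have hY : ∀ y ∈ rootSp αr,
      ⁅((1 : ℂ) ⊗ₜ[ℝ] (c • (H₀ : RLie n G)) : CLie n G), y⁆ = (2 : ℂ) • y ∧
      ⁅((1 : ℂ) ⊗ₜ[ℝ] b : CLie n G), y⁆ = 0 := by
    intro y hy
    refine ⟨?_, ?_⟩
    · rw [one_tmul_smul_lie, mem_rootSp.1 hy H₀, smul_smul, hcα]
    · rw [mem_rootSp.1 hy ⟨b, hb⟩, hαr.2 ⟨b, hb⟩ (mem_kR.2 hbθ), zero_smul]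
  have mP2 := fun x => mem_pM2_iff (θ := θ) t heR hY
    (fun x hx => ⟨((mP x).1 hx).1, hZC ▸ ((mP x).1 hx).2.1⟩) (x := x)
  -- the action of `K_M`
  have hkH : ∀ k : kmGroup n θ 𝔥 K, Ad n G (k : G) (c • (H₀ : RLie n G)) = c • (H₀ : RLie n G) :=
    fun k => Ad_eq_self_of_mem_kmGroup k.2 hha
  have hkZ : ∀ (k : kmGroup n θ 𝔥 K) (X : RLie n G),
      Ad n G (k : G) ⁅Z, X⁆ = ⁅Z, Ad n G (k : G) X⁆ := fun k X => hZK k k.2.1 X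
  -- K_M fixes h and commutes with ad Z, and `root_vector_eq` writes e through h and [Z, h].
  have hke : ∀ k : kmGroup n θ 𝔥 K, Ad n G (k : G) e = e := by
    intro k
    have h1 := root_vector_eq hhθ hhe (hS.abelian b hb _ hh𝔥) hZb
    have h2 : Ad n G (k : G) ⁅Z, c • (H₀ : RLie n G)⁆ = ⁅Z, c • (H₀ : RLie n G)⁆ := by
      rw [hkZ, hkH]
    have h3 : Ad n G (k : G) ⁅c • (H₀ : RLie n G), ⁅Z, c • (H₀ : RLie n G)⁆⁆ =
        ⁅c • (H₀ : RLie n G), ⁅Z, c • (H₀ : RLie n G)⁆⁆ := by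
      rw [Ad_lie, hkH, h2]
    rw [h1, map_sub, map_smul, map_smul, h2, h3]
  have hkf : ∀ k : kmGroup n θ 𝔥 K, Ad n G (k : G) (-θ e) = -θ e := by
    intro k
    rw [map_neg, hθ.Ad_theta k.2.1, hke]
  have lie_of_fixed : ∀ {w : RLie n G}, (∀ k : kmGroup n θ 𝔥 K, Ad n G (k : G) w = w) →
      ∀ k : kmGroup n θ 𝔥 K, ∀ X, Ad n G (k : G) ⁅w, X⁆ = ⁅w, Ad n G (k : G) X⁆ := by
    intro w hw k X
    rw [Ad_lie, hw]
  -- Ad(k)b = b is not needed: ad b is ad Z minus ad of (e + θe)/2, and K_M commutes with both.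
  have hkb : ∀ (k : kmGroup n θ 𝔥 K) (X : RLie n G),
      Ad n G (k : G) ⁅b, X⁆ = ⁅b, Ad n G (k : G) X⁆ := by
    have hkeθ : ∀ k : kmGroup n θ 𝔥 K, Ad n G (k : G) ((1 / 2 : ℝ) • (e + θ e)) =
        (1 / 2 : ℝ) • (e + θ e) := by
      intro k
      rw [map_smul, map_add, hθ.Ad_theta k.2.1, hke]
    have hb' : b = Z - (1 / 2 : ℝ) • (e + θ e) := by rw [hZb]; abel
    intro k X
    rw [hb', sub_lie, map_sub, hkZ, lie_of_fixed hkeθ, sub_lie]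
  have ρh := fun k => kmRep_lie k (lie_of_fixed hkH k)
  have ρe := fun k => kmRep_lie k (lie_of_fixed hke k)
  have ρf := fun k => kmRep_lie k (lie_of_fixed hkf k)
  have ρZ := fun k => kmRep_lie k (hkZ k)
  have ρb := fun k => kmRep_lie k (hkb k)
  have ρA : ∀ (k : kmGroup n θ 𝔥 K) (x : CLie n G), kmRep n θ 𝔥 K k
      (HermitianTriple.opA ((1 : ℂ) ⊗ₜ[ℝ] (c • (H₀ : RLie n G)) : CLie n G) ((1 : ℂ) ⊗ₜ[ℝ] b) x) =
      HermitianTriple.opA ((1 : ℂ) ⊗ₜ[ℝ] (c • (H₀ : RLie n G)) : CLie n G) ((1 : ℂ) ⊗ₜ[ℝ] b)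
        (kmRep n θ 𝔥 K k x) := by
    intro k x
    rw [HermitianTriple.opA_apply, HermitianTriple.opA_apply, ← ρh, ← ρb]
    simp only [map_add, map_smul]
  have sP : ∀ (k : kmGroup n θ 𝔥 K) (x : CLie n G), x ∈ pM θ 𝔥 → kmRep n θ 𝔥 K k x ∈ pM θ 𝔥 := by
    intro k x hx
    obtain ⟨h1, h2, h3⟩ := (mP x).1 hx
    refine (mP _).2 ⟨?_, ?_, ?_⟩
    · rw [← ρh, h1, map_zero]
    · rw [← ρZ, ← ρZ, h2, map_neg]
    · have h4 := killing_kmRep k x ((1 : ℂ) ⊗ₜ[ℝ] (c • (H₀ : RLie n G)))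
      rw [kmRep_one_tmul, hkH] at h4
      rw [h4, h3]
  have sP2 : ∀ (k : kmGroup n θ 𝔥 K) (x : CLie n G), x ∈ pM2 θ αr →
      kmRep n θ 𝔥 K k x ∈ pM2 θ αr := by
    intro k x hx
    obtain ⟨h1, h2⟩ := (mP2 x).1 hx
    exact (mP2 _).2 ⟨sP k x h1, by rw [← ρe, h2, map_zero]⟩
  have sPm : ∀ (k : kmGroup n θ 𝔥 K) (x : CLie n G), x ∈ pMinus n θ J →
      kmRep n θ 𝔥 K k x ∈ pMinus n θ J := fun k x hx =>
    (mPm _).2 (by rw [← ρZ, (mPm x).1 hx, map_smul])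
  let N : Subrepresentation (kmRep n θ 𝔥 K) := ⟨nUpper θ αr, fun k x hx =>
    (mN _).2 (by rw [← ρh, (mN x).1 hx])⟩
  let Pm : Subrepresentation (kmRep n θ 𝔥 K) := ⟨pMinus n θ J, sPm⟩
  let P1 : Subrepresentation (kmRep n θ 𝔥 K) := ⟨pM1 θ αr, fun k x hx =>
    ⟨sP k x hx.1, fun y hy => by
      have h1 := killing_kmRep k x (kmRep n θ 𝔥 K k⁻¹ y)
      rw [← Module.End.mul_apply, ← map_mul, mul_inv_cancel, map_one, Module.End.one_apply] at h1
      rw [h1]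
      exact hx.2 _ (sP2 _ y hy)⟩⟩
  let P2m : Subrepresentation (kmRep n θ 𝔥 K) := ⟨pM2 θ αr ⊓ pMinus n θ J, fun k x hx =>
    ⟨sP2 k x hx.1, sPm k x hx.2⟩⟩
  let N' : Subrepresentation (kmRep n θ 𝔥 K) :=
    ⟨nMinus ((1 : ℂ) ⊗ₜ[ℝ] (c • (H₀ : RLie n G)) : CLie n G) ((1 : ℂ) ⊗ₜ[ℝ] b), fun k x hx =>
      ⟨by rw [← ρh, hx.1], by rw [← ρA, hx.2, map_zero]⟩⟩
  have hκh : killingForm ℂ (CLie n G) ((1 : ℂ) ⊗ₜ[ℝ] (c • (H₀ : RLie n G)))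
      ((1 : ℂ) ⊗ₜ[ℝ] (c • (H₀ : RLie n G))) ≠ 0 := by
    rw [killingForm_tmul, one_mul, one_mul]
    exact_mod_cast (hI.pos_of_p hhθ (smul_ne_zero hc0 hH₀0)).ne'
  refine ⟨N, Pm, P1, P2m, N', rfl, rfl, rfl, rfl, fun x hx => (mN x).2 hx.1, ?_, ?_⟩
  · exact t.exists_equiv_nMinus _ hI.nondeg_complex killing_kmRep ρf ρA N N' mN rfl
  · exact t.exists_equiv_prod _ hκh ρe ρf (fun k => by rw [kmRep_one_tmul, hke])
      (P := pM θ 𝔥) (P₂ := pM2 θ αr) (fun x => hZC ▸ mP x) mP2 Pm P1 P2m N'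
      (fun x => hZC ▸ mPm x) (fun x => Iff.rfl)
      (fun x h1 h2 => eq_zero_of_mem_pM1_pM2 hI mP2 h1 h2) rfl rfl

end Main
end HermitianLie

end

theorem mainTheorem12 {n : ℕ} {G : Type*} [TopologicalSpace G] [T2Space G]
    [ChartedSpace (EuclideanSpace ℝ (Fin n)) G] [Group G] [LieGroup (𝓡 n) ∞ G]
    [ConnectedSpace G] [Finite (Subgroup.center G)]
    [LieAlgebra.IsSemisimple ℝ (HermitianLie.RLie n G)]
    (K : Subgroup G) (hK : HermitianLie.IsMaximalCompact K)
    (θ : HermitianLie.RLie n G ≃ₗ⁅ℝ⁆ HermitianLie.RLie n G)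
    (hθ : HermitianLie.IsCartanInvolution n θ K)
    (J : HermitianLie.pR n θ →ₗ[ℝ] HermitianLie.pR n θ)
    (hJ : HermitianLie.IsInvariantComplexStructure n θ K J)
    (𝔥 : LieSubalgebra ℝ (HermitianLie.RLie n G)) (h𝔥 : 𝔥.IsCartanSubalgebra)
    (h𝔥θ : ∀ X ∈ 𝔥, θ X ∈ 𝔥)
    (hrank : Module.finrank ℝ (HermitianLie.aR n θ 𝔥) = 1)
    -- a generator of `𝔞₀` that fixes the parabolic `P = MAN`: the roots that are positive on it
    -- are those that occur in `𝔫`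
    (Hpos : 𝔥) (hHpos : (Hpos : HermitianLie.RLie n G) ∈ HermitianLie.aR n θ 𝔥) (hH0 : Hpos ≠ 0)
    (αr : 𝔥 →ₗ[ℝ] ℂ) (hαr : HermitianLie.IsRealRoot θ αr) (hαpos : 0 < (αr Hpos).re) :
    ∃ N Pminus P1 P2minus Nminus : Subrepresentation (HermitianLie.kmRep n θ 𝔥 K),
      N.toSubmodule = HermitianLie.nUpper θ αr ∧
      Pminus.toSubmodule = HermitianLie.pMinus n θ J ∧
      P1.toSubmodule = HermitianLie.pM1 θ αr ∧
      P2minus.toSubmodule = HermitianLie.pM2 θ αr ⊓ HermitianLie.pMinus n θ J ∧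
      Nminus ≤ N ∧
      Nonempty (N.toRepresentation.Equiv
        (Nminus.toRepresentation.prod Nminus.toRepresentation.dual)) ∧
      Nonempty (Pminus.toRepresentation.Equiv
        ((Representation.trivial ℂ (HermitianLie.kmGroup n θ 𝔥 K) ℂ).prod
          (P1.toRepresentation.prod
            (P2minus.toRepresentation.prod Nminus.toRepresentation)))) := by
  exact HermitianLie.exists_kmRep_decomposition hθ hJ h𝔥 h𝔥θ hrank hHpos hH0 hαr hαpos
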